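/- Let $(M,F)$ be a connected $n$-dimensional Finsler manifold: $F:TM\to\mathbb R$ is continuous, $C^\infty$ off the zero section, $F(x,y)>0$ for $y\neq0$, $F(x,\lambda y)=|\lambda|F(x,y)$ for all $\lambda\in\mathbb R$, and the fundamental tensor $g_{ij}(x,y)=\frac12\frac{\partial^2F^2}{\partial y^i\partial y^j}$ is positive definite for $y\ne0$. Put $$\Gamma^i_{jk}=\tfrac12g^{im}\Big(\tfrac{\partial g_{mk}}{\partial x^j}+\tfrac{\partial g_{jm}}{\partial x^k}-\tfrac{\partial g_{jk}}{\partial x^m}\Big),\quad N^i_j=\tfrac12\tfrac{\partial}{\partial y^j}\big(\Gamma^i_{kl}y^ky^l\big),\quad \tfrac{\delta}{\delta x^i}=\tfrac{\partial}{\partial x^i}-N_i^j\tfrac{\partial}{\partial y^j},$$ $$L^i_{jk}=\tfrac12g^{im}\Big(\tfrac{\delta g_{mk}}{\delta x^j}+\tfrac{\delta g_{jm}}{\delta x^k}-\tfrac{\delta g_{jk}}{\delta x^m}\Big),\quad C^i_{jk}=\tfrac12g^{im}\Big(\tfrac{\partial g_{mk}}{\partial y^j}+\tfrac{\partial g_{jm}}{\partial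 y^k}-\tfrac{\partial g_{jk}}{\partial y^m}\Big),\quad R^i_{jk}=\tfrac{\delta N^i_j}{\delta x^k}-\tfrac{\delta N^i_k}{\delta x^j}.$$ For a vector field $X$ along a regular curve $c$ let, with all coefficients taken at $(c(t),\dot c(t))$, $$\Big(\frac{\nabla X}{dt}\Big)^i=\frac{dX^i}{dt}+X^m\Big[L^i_{mk}\dot c^k+C^i_{mk}\big(\ddot c^k+N^k_l\dot c^l\big)\Big],\qquad \big(R^2(X,\dot c)\dot c\big)^i=R^i_{jk}\,\dot c^jX^k .$$ A $C^\infty$ regular curve $c$ is a geodesic if $\nabla\dot c/dt=0$. Let $x_0,x_1\in M$, let $\Omega$ be the set of piecewise $C^\infty$ regular curves $c:[0,1]\to M$ from $x_0$ to $x_1$, and, for $c\in\Omega$, let $T_c\Omega$ be the space of continuous, piecewise $C^\infty$ vector fields along $c$ that vanish at $0$ and $1$. Let $p\in\mathbb R\setminus\{0,1\}$ and, for $\gamma\in\Omega$, $E_p(\gamma)=\int_0^1 g(\dot\gamma,\dot\gamma)^{p/2}dt$, where $g(\dot\gamma,\dot\gamma)=g_{ij}(\gamma,\dot\gamma)\dot\gamma^i\dot\gamma^j$.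 Let $c\in\Omega$ be a geodesic and $X\in T_c\Omega$. Then, for every $Y\in T_c\Omega$, there are two-parameter variations $(c_{s_1s_2})\subset\Omega$ of $c=c_{00}$ (continuous, and for some partition of $[0,1]$ smooth in $(s_1,s_2,t)$ on each closed subinterval) with $\partial c_{s_1s_2}/\partial s_1(0,0,\cdot)=X$ and $\partial c_{s_1s_2}/\partial s_2(0,0,\cdot)=Y$, and the number $$I_p(X,Y)=\frac{\partial^2E_p(c_{s_1s_2})}{\partial s_1\partial s_2}(0,0)$$ exists and is the same for all of them. Moreover, $I_p(X,Y)=0$ for all $Y\in T_c\Omega$ if and only if $X$ is a Jacobi field, that is, $X$ is $C^\infty$ and $$\frac{\nabla}{dt}\frac{\nabla X}{dt}+R^2(X,\dot c)\dot c=0\quad\text{on }[0,1].$$ -/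

import Mathlib

open Set Filter Topology Manifold
open scoped ContDiff

noncomputable section

namespace FinslerPEnergy

/-- The model space `ℝⁿ`. -/
abbrev E (n : ℕ) := EuclideanSpace ℝ (Fin n)

/-- The model with corners of (boundaryless) `n`-dimensional manifolds. -/
abbrev I (n : ℕ) : ModelWithCorners ℝ (E n) (E n) := 𝓘(ℝ, E n)

/-- The `i`-th standard basis vector of `ℝⁿ`. -/
def basisVec {n : ℕ} (i : Fin n) : E n := EuclideanSpace.single i (1 : ℝ)

section Finsler

variable {n : ℕ} {M : Type*} [TopologicalSpace M] [ChartedSpace (E n) M]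

/-- The fundamental tensor of `F : TM → ℝ` at `v ∈ T_x M`, applied to `u, w ∈ T_x M`:
one half of the second derivative of `F²` along the fibre `T_x M`, at `v`, in the directions
`u` and `w`. For `u = ∂/∂xⁱ`, `w = ∂/∂xʲ` it is `(1/2) ∂²F²/∂yⁱ∂yʲ`. -/
def fundamentalTensor (F : TangentBundle (I n) M → ℝ) (x : M) (v u w : TangentSpace (I n) x) : ℝ :=
  (1 / 2) * deriv (fun a : ℝ => deriv (fun b : ℝ => F ⟨x, v + a • u + b • w⟩ ^ 2) 0) 0

variable (n M) in
/-- A (reversible) Finsler metric on the smooth manifold `M`. -/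
structure FinslerMetric [IsManifold (I n) ∞ M] where
  /-- the fundamental function `F : TM → ℝ` -/
  toFun : TangentBundle (I n) M → ℝ
  pos : ∀ (x : M) (v : TangentSpace (I n) x), v ≠ 0 → 0 < toFun ⟨x, v⟩
  homogeneous : ∀ (x : M) (v : TangentSpace (I n) x) (r : ℝ),
    toFun ⟨x, r • v⟩ = |r| * toFun ⟨x, v⟩
  posDef : ∀ (x : M) (v u : TangentSpace (I n) x), v ≠ 0 → u ≠ 0 →
    0 < fundamentalTensor toFun x v u u
  smooth : ContMDiffOn (I n).tangent 𝓘(ℝ, ℝ) ∞ toFun {w | w.2 ≠ 0}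
  continuous : Continuous toFun

variable [IsManifold (I n) ∞ M]

/-! ### The Cartan connection in a chart

In a chart `e`, a point of `TM` has coordinates `(x, y)`, where `x ∈ e.target` and `y ∈ ℝⁿ`. -/

/-- `∂h/∂xⁱ`. -/
def partialX (i : Fin n) (h : E n → E n → ℝ) (x y : E n) : ℝ :=
  fderiv ℝ (fun x' => h x' y) x (basisVec i)

/-- `∂h/∂yⁱ`. -/
def partialY (i : Fin n) (h : E n → E n → ℝ) (x y : E n) : ℝ :=
  fderiv ℝ (fun y' => h x y') y (basisVec i)

/-- The tangent vector with coordinates `(x, y)` in the chart `e`, i.e. `yⁱ ∂/∂xⁱ`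
at the point with coordinates `x`. -/
def coordVec (e : OpenPartialHomeomorph M (E n)) (x y : E n) : TangentSpace (I n) (e.symm x) :=
  mfderiv (I n) (I n) e.symm x y

namespace FinslerMetric

variable (F : FinslerMetric n M) (e : OpenPartialHomeomorph M (E n))

/-- The components `g_{ij}(x, y)` of the fundamental tensor in the chart `e`. -/
def g (i j : Fin n) (x y : E n) : ℝ :=
  fundamentalTensor F.toFun (e.symm x) (coordVec e x y)
    (coordVec e x (basisVec i)) (coordVec e x (basisVec j))

/-- The inverse matrix `g^{ij}(x, y)`. -/
def gInv (i j : Fin n) (x y : E n) : ℝ :=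
  (Matrix.of fun a b => F.g e a b x y)⁻¹ i j

/-- `Γ^i_{jk} = (1/2) g^{im} (∂g_{mk}/∂x^j + ∂g_{jm}/∂x^k - ∂g_{jk}/∂x^m)`. -/
def Gam (i j k : Fin n) (x y : E n) : ℝ :=
  (1 / 2) * ∑ m, F.gInv e i m x y *
    (partialX j (F.g e m k) x y + partialX k (F.g e j m) x y - partialX m (F.g e j k) x y)

/-- The nonlinear connection `N^i_j = (1/2) ∂(Γ^i_{kl} y^k y^l)/∂y^j`. -/
def N (i j : Fin n) (x y : E n) : ℝ :=
  (1 / 2) * partialY j (fun x' y' => ∑ k, ∑ l, F.Gam e i k l x' y' * y' k * y' l) x y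

/-- `δh/δx^i = ∂h/∂x^i - N^j_i ∂h/∂y^j`. -/
def deltaX (i : Fin n) (h : E n → E n → ℝ) (x y : E n) : ℝ :=
  partialX i h x y - ∑ j, F.N e j i x y * partialY j h x y

/-- `L^i_{jk} = (1/2) g^{im} (δg_{mk}/δx^j + δg_{jm}/δx^k - δg_{jk}/δx^m)`. -/
def L (i j k : Fin n) (x y : E n) : ℝ :=
  (1 / 2) * ∑ m, F.gInv e i m x y *
    (F.deltaX e j (F.g e m k) x y + F.deltaX e k (F.g e j m) x y - F.deltaX e m (F.g e j k) x y)

/-- `C^i_{jk} = (1/2) g^{im} (∂g_{mk}/∂y^j + ∂g_{jm}/∂y^k - ∂g_{jk}/∂y^m)`. -/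
def C (i j k : Fin n) (x y : E n) : ℝ :=
  (1 / 2) * ∑ m, F.gInv e i m x y *
    (partialY j (F.g e m k) x y + partialY k (F.g e j m) x y - partialY m (F.g e j k) x y)

/-- `R^i_{jk} = δN^i_j/δx^k - δN^i_k/δx^j`. It is the contraction `y^h R^i_{hjk}` of the
`h`-curvature of the Cartan connection. -/
def R (i j k : Fin n) (x y : E n) : ℝ :=
  F.deltaX e k (F.N e i j) x y - F.deltaX e j (F.N e i k) x y

/-- Coordinates `dcⁱ/dt` of the velocity of the curve `c : [0,1] → M` in the chart `e`. -/
def coordVel (e : OpenPartialHomeomorph M (E n)) (c : ℝ → M) (t : ℝ) : E n :=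
  derivWithin (fun s => e (c s)) (Icc 0 1) t

/-- Coordinates in the chart `e` of the covariant derivative `∇X/dt` along `c`, where `ξ` is the
tuple of coordinates of the vector field `X` along `c`:
`dX^i/dt + X^m [L^i_{mk} dc^k/dt + C^i_{mk} (d²c^k/dt² + N^k_l dc^l/dt)]`,
with `L, C, N` taken at `(c, dc/dt)`. -/
def covDeriv (c : ℝ → M) (ξ : ℝ → E n) (t : ℝ) : E n :=
  WithLp.toLp 2 fun i =>
    derivWithin ξ (Icc 0 1) t i +
      ∑ m, ξ t m *
        (∑ k, F.L e i m k (e (c t)) (coordVel e c t) * coordVel e c t k +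
          ∑ k, F.C e i m k (e (c t)) (coordVel e c t) *
            (derivWithin (coordVel e c) (Icc 0 1) t k +
              ∑ l, F.N e k l (e (c t)) (coordVel e c t) * coordVel e c t l))

/-- Coordinates in the chart `e` of `R²(X, ċ)ċ`, namely `R^i_{jk}(c, ċ) (dc^j/dt) X^k`, where `ξ`
is the tuple of coordinates of `X`. -/
def curvTerm (c : ℝ → M) (ξ : ℝ → E n) (t : ℝ) : E n :=
  WithLp.toLp 2 fun i =>
    ∑ j, ∑ k, F.R e i j k (e (c t)) (coordVel e c t) * coordVel e c t j * ξ t k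

/-- Coordinates in the chart `e` of a vector field `X` along `c`. -/
def coordField (e : OpenPartialHomeomorph M (E n)) (c : ℝ → M)
    (X : (t : ℝ) → TangentSpace (I n) (c t)) (t : ℝ) : E n :=
  mfderiv (I n) (I n) e (c t) (X t)

/-- The curve `c : [0,1] → M` (only the values on `[0,1]` matter) is a geodesic: it is `C^∞` and
regular, and `∇ċ/dt = 0`, in all charts of the atlas. -/
structure IsGeodesic (c : ℝ → M) : Prop where
  smooth : ContMDiffOn 𝓘(ℝ, ℝ) (I n) ∞ c (Icc 0 1)
  regular : ∀ t ∈ Icc (0 : ℝ) 1, mfderivWithin 𝓘(ℝ, ℝ) (I n) c (Icc 0 1) t (1 : ℝ) ≠ 0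
  eq_zero : ∀ e ∈ atlas (E n) M, ∀ t ∈ Icc (0 : ℝ) 1, c t ∈ e.source →
    F.covDeriv e c (coordVel e c) t = 0

/-- The vector field `X` along `c : [0,1] → M` is a Jacobi field: it is `C^∞` and
`∇/dt ∇X/dt + R²(X, ċ)ċ = 0`, in all charts of the atlas. -/
structure IsJacobi (c : ℝ → M) (X : (t : ℝ) → TangentSpace (I n) (c t)) : Prop where
  smooth : ContMDiffOn 𝓘(ℝ, ℝ) (I n).tangent ∞
    (fun t => (⟨c t, X t⟩ : TangentBundle (I n) M)) (Icc 0 1)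
  eq_zero : ∀ e ∈ atlas (E n) M, ∀ t ∈ Icc (0 : ℝ) 1, c t ∈ e.source →
    F.covDeriv e c (F.covDeriv e c (coordField e c X)) t + F.curvTerm e c (coordField e c X) t = 0

end FinslerMetric

/-! ### The path space, variations and the `p`-energy -/

/-- `0 = τ 0 < τ 1 < ⋯ < τ k = 1`. -/
structure IsPartition {k : ℕ} (τ : Fin (k + 1) → ℝ) : Prop where
  strictMono : StrictMono τ
  zero : τ 0 = 0
  last : τ (Fin.last k) = 1

/-- The space `Ω` of (continuous) piecewise `C^∞` regular curves `[0,1] → M` from `x₀` to `x₁`.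
Curves are maps on `ℝ` of which only the values on `[0,1]` matter. -/
def pathSpace (n : ℕ) {M : Type*} [TopologicalSpace M] [ChartedSpace (E n) M] (x₀ x₁ : M) :
    Set (ℝ → M) :=
  {γ | γ 0 = x₀ ∧ γ 1 = x₁ ∧ ContinuousOn γ (Icc 0 1) ∧
    ∃ (k : ℕ) (τ : Fin (k + 1) → ℝ), IsPartition τ ∧ ∀ i : Fin k,
      ContMDiffOn 𝓘(ℝ, ℝ) (I n) ∞ γ (Icc (τ i.castSucc) (τ i.succ)) ∧
      ∀ t ∈ Icc (τ i.castSucc) (τ i.succ),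
        mfderivWithin 𝓘(ℝ, ℝ) (I n) γ (Icc (τ i.castSucc) (τ i.succ)) t (1 : ℝ) ≠ 0}

/-- `T_cΩ`: continuous, piecewise `C^∞` vector fields along `c : [0,1] → M` that vanish at
`t = 0` and `t = 1`. -/
def tangentPathSpace (c : ℝ → M) : Set ((t : ℝ) → TangentSpace (I n) (c t)) :=
  {X | X 0 = 0 ∧ X 1 = 0 ∧
    ContinuousOn (fun t => (⟨c t, X t⟩ : TangentBundle (I n) M)) (Icc 0 1) ∧
    ∃ (k : ℕ) (τ : Fin (k + 1) → ℝ), IsPartition τ ∧ ∀ i : Fin k,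
      ContMDiffOn 𝓘(ℝ, ℝ) (I n).tangent ∞
        (fun t => (⟨c t, X t⟩ : TangentBundle (I n) M)) (Icc (τ i.castSucc) (τ i.succ))}

/-- `α s₁ s₂ ∈ Ω`, `|s₁|, |s₂| < ε`, is a two-parameter variation of `c` with variation fields
`∂α/∂s₁ (0, 0, ·) = X` and `∂α/∂s₂ (0, 0, ·) = Y`. As usual, `α` is continuous, and smooth on
`(-ε, ε)² × [τ i, τ (i + 1)]` for a suitable partition of `[0,1]`. -/
structure IsVariation (x₀ x₁ : M) (c : ℝ → M) (X Y : (t : ℝ) → TangentSpace (I n) (c t))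
    (ε : ℝ) (α : ℝ → ℝ → ℝ → M) : Prop where
  pos : 0 < ε
  mem : ∀ s₁ ∈ Ioo (-ε) ε, ∀ s₂ ∈ Ioo (-ε) ε, α s₁ s₂ ∈ pathSpace n x₀ x₁
  base : ∀ t ∈ Icc (0 : ℝ) 1, α 0 0 t = c t
  continuous : ContinuousOn (fun q : ℝ × ℝ × ℝ => α q.1 q.2.1 q.2.2)
    (Ioo (-ε) ε ×ˢ Ioo (-ε) ε ×ˢ Icc 0 1)
  smooth : ∃ (k : ℕ) (τ : Fin (k + 1) → ℝ), IsPartition τ ∧ ∀ i : Fin k,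
    ContMDiffOn 𝓘(ℝ, ℝ × ℝ × ℝ) (I n) ∞ (fun q : ℝ × ℝ × ℝ => α q.1 q.2.1 q.2.2)
      (Ioo (-ε) ε ×ˢ Ioo (-ε) ε ×ˢ Icc (τ i.castSucc) (τ i.succ))
  field₁ : ∀ t ∈ Icc (0 : ℝ) 1,
    (⟨α 0 0 t, mfderiv 𝓘(ℝ, ℝ) (I n) (fun s => α s 0 t) 0 (1 : ℝ)⟩ : TangentBundle (I n) M) =
      ⟨c t, X t⟩
  field₂ : ∀ t ∈ Icc (0 : ℝ) 1,
    (⟨α 0 0 t, mfderiv 𝓘(ℝ, ℝ) (I n) (fun s => α 0 s t) 0 (1 : ℝ)⟩ : TangentBundle (I n) M) =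
      ⟨c t, Y t⟩

/-- The mixed partial derivative `∂²f/∂s₁∂s₂ (0, 0)` exists and equals `r`. -/
def HasMixedDerivAtZero (f : ℝ → ℝ → ℝ) (r : ℝ) : Prop :=
  ∃ D : ℝ → ℝ, (∀ᶠ s₁ in 𝓝 (0 : ℝ), HasDerivAt (fun s₂ => f s₁ s₂) (D s₁) 0) ∧ HasDerivAt D r 0

namespace FinslerMetric

variable (F : FinslerMetric n M)

/-- The `p`-energy `E_p(γ) = ∫₀¹ g(γ̇, γ̇)^{p/2} dt`. The velocity is taken at all `t ∈ (0, 1)`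
outside the finite set of corners of `γ`, which does not contribute to the integral. -/
def energy (p : ℝ) (γ : ℝ → M) : ℝ :=
  ∫ t in (0 : ℝ)..1,
    fundamentalTensor F.toFun (γ t) (mfderiv 𝓘(ℝ, ℝ) (I n) γ t (1 : ℝ))
      (mfderiv 𝓘(ℝ, ℝ) (I n) γ t (1 : ℝ)) (mfderiv 𝓘(ℝ, ℝ) (I n) γ t (1 : ℝ)) ^ (p / 2)

/-- `r` is the value of the second variation of `E_p` at `c` in the directions `X`, `Y`: there are
two-parameter variations of `c` with variation fields `X`, `Y`, and for each of them
`∂²E_p(c_{s₁s₂})/∂s₁∂s₂ (0, 0)` exists and equals `r`. -/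
def IsSecondVariation (p : ℝ) (x₀ x₁ : M) (c : ℝ → M)
    (X Y : (t : ℝ) → TangentSpace (I n) (c t)) (r : ℝ) : Prop :=
  (∃ ε α, IsVariation x₀ x₁ c X Y ε α) ∧
  ∀ ε α, IsVariation x₀ x₁ c X Y ε α →
    HasMixedDerivAtZero (fun s₁ s₂ => F.energy p (α s₁ s₂)) r

/-- The number `I_p(X, Y)` (meaningful if there is one `r` as in `IsSecondVariation`). -/
def secondVariation (p : ℝ) (x₀ x₁ : M) (c : ℝ → M)
    (X Y : (t : ℝ) → TangentSpace (I n) (c t)) : ℝ :=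
  Classical.epsilon fun r => F.IsSecondVariation p x₀ x₁ c X Y r

end FinslerMetric

end Finsler

end FinslerPEnergy

end

open Set Filter Topology Manifold
open scoped ContDiff

noncomputable section

/-! Write G^i = Γ^i_{kl} y^k y^l for the spray and L = F^p for the Lagrangian in a chart. Euler's
identity for homogeneous functions (`Homog.euler`) and the symmetry of iterated fibre derivatives of
F² give N^i_j y^j = G^i, L^i_{jk} y^k = N^i_j and y^j C^i_{jk} = 0. Hence a geodesic solves ẍ + G(x,
ẋ) = 0, along it ∇ξ/dt = ξ' + Nξ, and the left side of the Jacobi equation is ξ'' + dG(ξ, ξ'), the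
linearization of the geodesic equation (`IsGeodesic.jacobiOp_apply`).

The spray conserves F² (`sum_spray_mul_mom`), so the spray is compatible with every power of F: the
Euler-Lagrange expression of F^p along a curve is B_{ij}(ẍ^i + G^i), where B is the fibre Hessian of
F^p (`euler_lagrange_spray`). B is p F^{p-2} g plus a rank-one term, and contracting it with y
produces the factor p(p-1); for p ≠ 0, 1 it is nondegenerate (`eq_zero_of_sum_lagHess`). It may be
indefinite; only nondegeneracy is used.

On a smooth piece [a, b] of a variation, integration by parts in t writes ∂E/∂s₂ as a boundary term
minus the integral of the Euler-Lagrange expression paired with ∂x/∂s₂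
(`hasMixedDerivAtZero_integral`). Differentiate in s₁ at the geodesic: since ẍ + G = 0 there, only
the factor ẍ + G gets differentiated, and the integrand becomes B(JX, Y) with J the Jacobi operator
(`dd_euler_lagrange`). The boundary terms of adjacent pieces differ only by the one-sided
derivatives of X, and at t = 0, 1 they vanish because the endpoints are fixed and Y = 0. So
`hasMixedDerivAtZero_energy` gives I_p(X, Y) = -∑ B(jump of X', Y) - ∫ B(JX, Y) dt, whose right
side, `indexForm`, does not involve the variation. Lagrangian, boundary pairing and interior
integrand have descriptions on M itself, so charts serve only for local computation and no
transformation law for the connection is needed.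

Variations exist (`exists_isVariation`): they are built piece by piece inside charts, each new piece
starting from the endpoints of the previous one; curves close to the geodesic are regular by
compactness.

If X is a Jacobi field, both terms vanish. Conversely, testing with bump fields gives JX = 0
wherever X is smooth (`jacobiOp_eq_zero`), and then, with the integral gone, that X' has no jumps
(`jump_eq_zero_of_indexForm`). Thus X is C¹ across its break points and solves a linear equation
with smooth coefficients on both sides, which forces smoothness (`fieldSmoothAt_of_jump_eq_zero`).
The equation reaches t = 0 and t = 1 by continuity. -/

namespace FinslerPEnergy

/-! ### Directional derivatives of smooth functions on a domain with dense interior -/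

section DirDeriv

variable {X Y V : Type*} [NormedAddCommGroup X] [NormedSpace ℝ X]
  [NormedAddCommGroup Y] [NormedSpace ℝ Y] [NormedAddCommGroup V] [NormedSpace ℝ V]

/-- The derivative of `f` within `S` at `q` in the direction `v`. -/
def dd (S : Set X) (v : X) (f : X → V) (q : X) : V := fderivWithin ℝ f S q v

/-- Sets on which derivatives within the set are unique and second derivatives are symmetric. -/
structure NiceDomain (S : Set X) : Prop where
  uniqueDiffOn : UniqueDiffOn ℝ S
  subset_closure : S ⊆ closure (interior S)

theorem _root_.IsOpen.niceDomain {S : Set X} (h : IsOpen S) : NiceDomain S :=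
  ⟨h.uniqueDiffOn, by rw [h.interior_eq]; exact subset_closure⟩

theorem NiceDomain.inter_open {S W : Set X} (h : NiceDomain S) (hW : IsOpen W) :
    NiceDomain (S ∩ W) := by
  refine ⟨h.uniqueDiffOn.inter hW, fun q hq => ?_⟩
  rw [interior_inter, hW.interior_eq]
  rw [inter_comm]
  exact hW.inter_closure ⟨hq.2, h.subset_closure hq.1⟩

variable {S : Set X} {q : X} {v w : X}

theorem _root_.ContDiffOn.dd {f : X → V} (hf : ContDiffOn ℝ ∞ f S) (hS : NiceDomain S) (v : X) :
    ContDiffOn ℝ ∞ (dd S v f) S :=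
  (hf.fderivWithin hS.uniqueDiffOn (by simp)).clm_apply contDiffOn_const

theorem diffAt {f : X → V} (hf : ContDiffOn ℝ ∞ f S) (hq : q ∈ S) :
    DifferentiableWithinAt ℝ f S q := hf.differentiableOn (by simp) q hq

/-- Families of curves live on slabs closed in t, so mixed partials must commute at boundary points
as well. Being a limit of interior points is what makes this true there, which is why `NiceDomain`
contains `subset_closure`. -/
theorem dd_comm {f : X → V} (hf : ContDiffOn ℝ ∞ f S) (hS : NiceDomain S) (hq : q ∈ S)
    (v w : X) : dd S v (dd S w f) q = dd S w (dd S v f) q := by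
  have h := (hf q hq).isSymmSndFDerivWithinAt (by simp; exact WithTop.coe_le_coe.2 le_top) hS.uniqueDiffOn (hS.subset_closure hq) hq
  have hd : DifferentiableWithinAt ℝ (fderivWithin ℝ f S) S q :=
    diffAt (hf.fderivWithin hS.uniqueDiffOn (m := ∞) (by simp)) hq
  have key : ∀ v w : X, dd S v (dd S w f) q = fderivWithin ℝ (fderivWithin ℝ f S) S q v w := by
    intro v w
    unfold dd
    rw [fderivWithin_clm_apply (hS.uniqueDiffOn q hq) hd (differentiableWithinAt_const _)]
    simp
  rw [key, key]
  exact h v w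

theorem dd_congr {f g : X → V} (h : EqOn f g S) (hq : q ∈ S) : dd S v f q = dd S v g q := by
  unfold dd; rw [fderivWithin_congr h (h hq)]

theorem dd_inter_open {f : X → V} {W : Set X} (hW : IsOpen W) (hq : q ∈ W) :
    dd (S ∩ W) v f q = dd S v f q := by
  unfold dd; rw [fderivWithin_inter (hW.mem_nhds hq)]

theorem dd_open {f : X → V} (hS : IsOpen S) (hq : q ∈ S) : dd S v f q = fderiv ℝ f q v := by
  unfold dd; rw [fderivWithin_of_isOpen hS hq]

theorem dd_add_dir (f : X → V) : dd S (v + w) f q = dd S v f q + dd S w f q := by simp [dd]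

theorem dd_smul_dir (r : ℝ) (f : X → V) : dd S (r • v) f q = r • dd S v f q := by simp [dd]

theorem dd_sum_dir {ι : Type*} (s : Finset ι) (v : ι → X) (f : X → V) :
    dd S (∑ i ∈ s, v i) f q = ∑ i ∈ s, dd S (v i) f q := by simp [dd]

theorem dd_const (c : V) : dd S v (fun _ => c) q = 0 := by
  simp [dd]

theorem dd_add {f g : X → V} (hS : NiceDomain S) (hf : ContDiffOn ℝ ∞ f S)
    (hg : ContDiffOn ℝ ∞ g S) (hq : q ∈ S) :
    dd S v (fun q => f q + g q) q = dd S v f q + dd S v g q := by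
  unfold dd
  rw [fderivWithin_fun_add (hS.uniqueDiffOn q hq) (diffAt hf hq) (diffAt hg hq)]; rfl

theorem dd_sub {f g : X → V} (hS : NiceDomain S) (hf : ContDiffOn ℝ ∞ f S)
    (hg : ContDiffOn ℝ ∞ g S) (hq : q ∈ S) :
    dd S v (fun q => f q - g q) q = dd S v f q - dd S v g q := by
  unfold dd
  rw [fderivWithin_fun_sub (hS.uniqueDiffOn q hq) (diffAt hf hq) (diffAt hg hq)]; rfl

theorem dd_sum {ι : Type*} {s : Finset ι} {f : ι → X → V} (hS : NiceDomain S)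
    (hf : ∀ i ∈ s, ContDiffOn ℝ ∞ (f i) S) (hq : q ∈ S) :
    dd S v (fun q => ∑ i ∈ s, f i q) q = ∑ i ∈ s, dd S v (f i) q := by
  unfold dd
  rw [fderivWithin_fun_sum (hS.uniqueDiffOn q hq) (fun i hi => diffAt (hf i hi) hq)]; simp

theorem dd_mul {f g : X → ℝ} (hS : NiceDomain S) (hf : ContDiffOn ℝ ∞ f S)
    (hg : ContDiffOn ℝ ∞ g S) (hq : q ∈ S) :
    dd S v (fun q => f q * g q) q = dd S v f q * g q + f q * dd S v g q := by
  unfold dd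
  rw [fderivWithin_fun_mul (hS.uniqueDiffOn q hq) (diffAt hf hq) (diffAt hg hq)]
  simp; ring

theorem dd_const_mul {f : X → ℝ} (hS : NiceDomain S) (r : ℝ) (hf : ContDiffOn ℝ ∞ f S)
    (hq : q ∈ S) : dd S v (fun q => r * f q) q = r * dd S v f q := by
  rw [dd_mul hS contDiffOn_const hf hq, dd_const]; ring

theorem dd_clm (hS : NiceDomain S) (hq : q ∈ S) (l : X →L[ℝ] V) :
    dd S v (fun q => l q) q = l v := by
  unfold dd
  rw [l.fderivWithin (hS.uniqueDiffOn q hq)]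

theorem dd_clm_comp {f : X → V} (hS : NiceDomain S) (hf : ContDiffOn ℝ ∞ f S) (hq : q ∈ S)
    (l : V →L[ℝ] Y) : dd S v (fun q => l (f q)) q = l (dd S v f q) := by
  unfold dd
  have := l.hasFDerivAt.comp_hasFDerivWithinAt q (diffAt hf hq).hasFDerivWithinAt
  have h2 := this.fderivWithin (hS.uniqueDiffOn q hq)
  simp only [Function.comp_def] at h2
  rw [h2]; rfl

theorem dd_rpow {f : X → ℝ} (hS : NiceDomain S) (r : ℝ) (hf : ContDiffOn ℝ ∞ f S)
    (hpos : ∀ q ∈ S, 0 < f q) (hq : q ∈ S) :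
    dd S v (fun q => f q ^ r) q = r * f q ^ (r - 1) * dd S v f q := by
  unfold dd
  have := (diffAt hf hq).hasFDerivWithinAt.rpow_const (p := r) (Or.inl (hpos q hq).ne')
  rw [this.fderivWithin (hS.uniqueDiffOn q hq)]
  simp

theorem dd_comp {T : Set Y} {f : X → V} {x : Y → X} {p u : Y} (hT : NiceDomain T)
    (hf : ContDiffOn ℝ ∞ f S) (hx : ContDiffOn ℝ ∞ x T) (hmaps : MapsTo x T S) (hp : p ∈ T) :
    dd T u (fun p => f (x p)) p = dd S (dd T u x p) f (x p) := by
  unfold dd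
  have := (diffAt hf (hmaps hp)).hasFDerivWithinAt.comp p (diffAt hx hp).hasFDerivWithinAt hmaps
  have h2 := this.fderivWithin (hT.uniqueDiffOn p hp)
  simp only [Function.comp_def] at h2
  rw [h2]; rfl

theorem hasDerivWithinAt_comp_curve {f : X → V} {x : ℝ → X} {x' : X} {s : Set ℝ} {t : ℝ}
    (hf : ContDiffOn ℝ ∞ f S) (hS : IsOpen S) (hx : HasDerivWithinAt x x' s t) (ht : x t ∈ S) :
    HasDerivWithinAt (fun t => f (x t)) (dd S x' f (x t)) s t := by
  have h := (diffAt hf ht).differentiableAt (hS.mem_nhds ht)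
  rw [dd_open hS ht]
  exact h.hasFDerivAt.comp_hasDerivWithinAt t hx

end DirDeriv

/-! ### Functions of position and velocity -/

section PhaseSpace

variable {n : ℕ}

/-- The uncurried form of a function of position and velocity. -/
abbrev unc (h : E n → E n → ℝ) : E n × E n → ℝ := fun q => h q.1 q.2

/-- The standard basis vector in the position directions. -/
abbrev bx (i : Fin n) : E n × E n := (basisVec i, 0)

/-- The standard basis vector in the velocity directions. -/
abbrev bY (i : Fin n) : E n × E n := (0, basisVec i)

variable {S : Set (E n × E n)} {h : E n → E n → ℝ} {x y : E n}

/-- Turns the partial derivatives used in the definitions into directional derivatives of a single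
function on phase space, to which the product rule, the chain rule and `dd_comm` apply. -/
theorem fderiv_left_eq_dd (hS : IsOpen S) (hh : ContDiffOn ℝ ∞ (unc h) S) (hq : (x, y) ∈ S)
    (u : E n) : fderiv ℝ (fun x' => h x' y) x u = dd S (u, 0) (unc h) (x, y) := by
  rw [dd_open hS hq]
  have h1 := ((diffAt hh hq).differentiableAt (hS.mem_nhds hq)).hasFDerivAt
  have h2 : HasFDerivAt (fun x' : E n => (x', y)) (ContinuousLinearMap.inl ℝ (E n) (E n)) x :=
    hasFDerivAt_prodMk_left x y
  have h3 := h1.comp x h2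
  have h4 := h3.fderiv
  simp only [Function.comp_def] at h4
  rw [h4]; simp

theorem fderiv_right_eq_dd (hS : IsOpen S) (hh : ContDiffOn ℝ ∞ (unc h) S) (hq : (x, y) ∈ S)
    (u : E n) : fderiv ℝ (fun y' => h x y') y u = dd S (0, u) (unc h) (x, y) := by
  rw [dd_open hS hq]
  have h1 := ((diffAt hh hq).differentiableAt (hS.mem_nhds hq)).hasFDerivAt
  have h2 : HasFDerivAt (fun y' : E n => (x, y')) (ContinuousLinearMap.inr ℝ (E n) (E n)) y :=
    hasFDerivAt_prodMk_right x y
  have h3 := h1.comp y h2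
  have h4 := h3.fderiv
  simp only [Function.comp_def] at h4
  rw [h4]; simp

theorem partialX_eq_dd (hS : IsOpen S) (hh : ContDiffOn ℝ ∞ (unc h) S) (hq : (x, y) ∈ S)
    (i : Fin n) : partialX i h x y = dd S (bx i) (unc h) (x, y) := fderiv_left_eq_dd hS hh hq _

theorem partialY_eq_dd (hS : IsOpen S) (hh : ContDiffOn ℝ ∞ (unc h) S) (hq : (x, y) ∈ S)
    (i : Fin n) : partialY i h x y = dd S (bY i) (unc h) (x, y) := fderiv_right_eq_dd hS hh hq _

theorem sum_smul_basisVec (y : E n) : ∑ i, y i • basisVec i = y := by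
  ext j
  simp [basisVec, Pi.single_apply]

theorem sum_smul_bY (y : E n) : ∑ i, y i • bY i = ((0 : E n), y) := by
  conv_rhs => rw [← sum_smul_basisVec y]
  ext1
  · simp [Prod.fst_sum]
  · simp [Prod.snd_sum]

theorem sum_smul_bx (y : E n) : ∑ i, y i • bx i = (y, (0 : E n)) := by
  conv_rhs => rw [← sum_smul_basisVec y]
  ext1
  · simp [Prod.fst_sum]
  · simp [Prod.snd_sum]

theorem dd_right_eq_sum (y : E n) (f : E n × E n → ℝ) (q : E n × E n) :
    dd S (0, y) f q = ∑ i, y i * dd S (bY i) f q := by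
  rw [← sum_smul_bY y, dd_sum_dir]
  exact Finset.sum_congr rfl fun i _ => by rw [dd_smul_dir, smul_eq_mul]

theorem dd_left_eq_sum (y : E n) (f : E n × E n → ℝ) (q : E n × E n) :
    dd S (y, 0) f q = ∑ i, y i * dd S (bx i) f q := by
  rw [← sum_smul_bx y, dd_sum_dir]
  exact Finset.sum_congr rfl fun i _ => by rw [dd_smul_dir, smul_eq_mul]

theorem contDiffOn_vel (k : Fin n) : ContDiffOn ℝ ∞ (fun q : E n × E n => q.2 k) S := by
  fun_prop

theorem dd_vel (hS : NiceDomain S) {q : E n × E n} (hq : q ∈ S) (k : Fin n) (v : E n × E n) :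
    dd S v (fun q : E n × E n => q.2 k) q = v.2 k :=
  dd_clm hS hq ((EuclideanSpace.proj k : E n →L[ℝ] ℝ).comp (ContinuousLinearMap.snd ℝ (E n) (E n)))

theorem basisVec_apply (i k : Fin n) : (basisVec i : E n) k = if k = i then 1 else 0 := by
  simp [basisVec]

end PhaseSpace

end FinslerPEnergy

namespace FinslerPEnergy

/-! ### Charts of the tangent bundle -/

section TangentCharts

variable {n : ℕ} {M : Type*} [TopologicalSpace M] [ChartedSpace (E n) M]

/-- The tangent vector with given coordinates in the chart `e`. -/
def vecOfCoords (e : OpenPartialHomeomorph M (E n)) (q : E n × E n) : TangentBundle (I n) M :=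
  ⟨e.symm q.1, coordVec e q.1 q.2⟩

/-- The coordinates of a tangent vector in the chart `e`. -/
def coordsOfVec (e : OpenPartialHomeomorph M (E n)) (w : TangentBundle (I n) M) : E n × E n :=
  (e w.1, mfderiv (I n) (I n) e w.1 w.2)

theorem coordVec_smul (e : OpenPartialHomeomorph M (E n)) (x y : E n) (r : ℝ) :
    coordVec e x (r • y) = r • coordVec e x y := map_smul (mfderiv (I n) (I n) e.symm x) r y

theorem coordVec_add (e : OpenPartialHomeomorph M (E n)) (x y z : E n) :
    coordVec e x (y + z) = coordVec e x y + coordVec e x z :=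
  map_add (mfderiv (I n) (I n) e.symm x) y z

theorem contMDiff_toTangentModel :
    ContMDiff 𝓘(ℝ, E n × E n) (I n).tangent ∞
      (fun q : E n × E n => (⟨q.1, q.2⟩ : TangentBundle (I n) (E n))) := by
  intro q
  apply Bundle.contMDiffAt_totalSpace.2
  refine ⟨contDiff_fst.contMDiff q, ?_⟩
  convert! (contDiff_snd (𝕜 := ℝ) (n := ∞) (E := E n) (F := E n)).contMDiff q with y
  all_goals (simp; rfl)

variable [IsManifold (I n) ∞ M] {e : OpenPartialHomeomorph M (E n)}

theorem mem_maxAtlas (he : e ∈ atlas (E n) M) : e ∈ IsManifold.maximalAtlas (I n) ∞ M :=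
  IsManifold.subset_maximalAtlas he

theorem mdiff_chart (he : e ∈ atlas (E n) M) : e.MDifferentiable (I n) (I n) :=
  have : IsManifold (I n) 1 M := IsManifold.of_le (n := ∞) (by simp)
  mdifferentiable_of_mem_atlas he

/-- This is the tangent map of the inverse chart, precomposed with the trivialization of the tangent
bundle of ℝⁿ. -/
theorem contMDiffOn_vecOfCoords (he : e ∈ atlas (E n) M) :
    ContMDiffOn 𝓘(ℝ, E n × E n) (I n).tangent ∞ (vecOfCoords e) (e.target ×ˢ univ) := by
  have : IsManifold (I n) 1 M := IsManifold.of_le (n := ∞) (by simp)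
  have h1 : ContMDiffOn (I n).tangent (I n).tangent ∞
      (tangentMapWithin (I n) (I n) e.symm e.target)
      (Bundle.TotalSpace.proj ⁻¹' e.target) :=
    (contMDiffOn_symm_of_mem_maximalAtlas (mem_maxAtlas he)).contMDiffOn_tangentMapWithin
      (by simp) e.open_target.uniqueMDiffOn
  have h2 := h1.comp (contMDiff_toTangentModel (n := n)).contMDiffOn
    (s := e.target ×ˢ univ) (fun q hq => hq.1)
  refine h2.congr fun q hq => ?_
  simp only [Function.comp, tangentMapWithin, vecOfCoords, coordVec]
  rw [mfderivWithin_of_isOpen e.open_target hq.1]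

theorem contMDiffOn_coordsOfVec (he : e ∈ atlas (E n) M) :
    ContMDiffOn (I n).tangent 𝓘(ℝ, E n × E n) ∞ (coordsOfVec e)
      {w : TangentBundle (I n) M | w.1 ∈ e.source} := by
  have : IsManifold (I n) 1 M := IsManifold.of_le (n := ∞) (by simp)
  have h0 := contMDiffOn_of_mem_maximalAtlas (mem_maxAtlas he)
  have h1 : ContMDiffOn (I n).tangent (I n).tangent ∞
      (tangentMapWithin (I n) (I n) e e.source)
      (Bundle.TotalSpace.proj ⁻¹' e.source) :=
    h0.contMDiffOn_tangentMapWithin (by simp) e.open_source.uniqueMDiffOn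
  have h2 := (contMDiff_snd_tangentBundle_modelSpace (E n) (I n) (n := ∞)).comp_contMDiffOn h1
  have h3 : ContMDiffOn (I n).tangent (I n) ∞ (fun w : TangentBundle (I n) M => e w.1)
      (Bundle.TotalSpace.proj ⁻¹' e.source) :=
    h0.comp (Bundle.contMDiff_proj (TangentSpace (I n) : M → Type _)).contMDiffOn (fun w hw => hw)
  refine (h3.prodMk_space h2).congr fun w hw => ?_
  simp only [coordsOfVec, Function.comp, tangentMapWithin]
  rw [mfderivWithin_of_isOpen e.open_source hw]

theorem coordVec_mfderiv (he : e ∈ atlas (E n) M) {p : M} (hp : p ∈ e.source) (v : TangentSpace (I n) p) :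
    vecOfCoords e (e p, mfderiv (I n) (I n) e p v) = ⟨p, v⟩ := by
  have h := DFunLike.congr_fun ((mdiff_chart he).symm_comp_deriv hp) v
  have h2 := e.left_inv hp
  unfold vecOfCoords coordVec
  dsimp only
  erw [ContinuousLinearMap.comp_apply] at h
  refine Bundle.TotalSpace.ext h2 (heq_of_eq h)

theorem mfderiv_coordVec (he : e ∈ atlas (E n) M) {x : E n} (hx : x ∈ e.target) (y : E n) :
    mfderiv (I n) (I n) e (e.symm x) (coordVec e x y) = y :=
  DFunLike.congr_fun ((mdiff_chart he).comp_symm_deriv hx) y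

theorem coordsOfVec_vecOfCoords (he : e ∈ atlas (E n) M) {q : E n × E n} (hq : q.1 ∈ e.target) :
    coordsOfVec e (vecOfCoords e q) = q :=
  Prod.ext (e.right_inv hq) (mfderiv_coordVec he hq q.2)

end TangentCharts

end FinslerPEnergy

namespace FinslerPEnergy

/-! ### Homogeneous functions -/

section Homogeneous

variable {n : ℕ} {S : Set (E n × E n)} {f h : E n × E n → ℝ} {k : ℕ}

/-- Positive homogeneity of degree `k` in the velocity variable. -/
def Homog (S : Set (E n × E n)) (k : ℕ) (f : E n × E n → ℝ) : Prop :=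
  ∀ q ∈ S, ∀ r : ℝ, 0 < r → f (q.1, r • q.2) = r ^ k * f q

/-- Sets that are stable under positive dilations of the velocity. -/
def Conic (S : Set (E n × E n)) : Prop := ∀ q ∈ S, ∀ r : ℝ, 0 < r → (q.1, r • q.2) ∈ S

/-- Dilation of the velocity. -/
def dilation (r : ℝ) : E n × E n →L[ℝ] E n × E n :=
  (ContinuousLinearMap.fst ℝ (E n) (E n)).prod (r • ContinuousLinearMap.snd ℝ (E n) (E n))

theorem dilation_apply (r : ℝ) (q : E n × E n) : dilation r q = (q.1, r • q.2) := rfl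

/-- Chain rule for the linear dilation applied to f(x, ry) = r^k f(x, y). The dilation fixes
position directions and multiplies velocity directions by r, so ∂/∂x keeps the degree (`Homog.ddX`)
and ∂/∂y lowers it by one (`Homog.ddY`). -/
theorem Homog.dd_dilation (hf : Homog S k f) (hS : NiceDomain S) (hc : Conic S)
    (hs : ContDiffOn ℝ ∞ f S) {q : E n × E n} (hq : q ∈ S) {r : ℝ} (hr : 0 < r)
    (v : E n × E n) : dd S (dilation r v) f (q.1, r • q.2) = r ^ k * dd S v f q := by
  have h1 : dd S v (fun q => f (dilation r q)) q = r ^ k * dd S v f q := by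
    rw [← dd_const_mul hS _ hs hq]
    exact dd_congr (fun q hq => hf q hq r hr) hq
  rw [← h1, dd_comp (T := S) hS hs (dilation r).contDiff.contDiffOn (fun q hq => hc q hq r hr) hq,
    dd_clm hS hq]
  rfl

theorem Homog.ddX (hf : Homog S k f) (hS : NiceDomain S) (hc : Conic S)
    (hs : ContDiffOn ℝ ∞ f S) (u : E n) : Homog S k (dd S (u, 0) f) := by
  intro q hq r hr
  have := hf.dd_dilation hS hc hs hq hr (u, 0)
  rwa [dilation_apply, smul_zero] at this

theorem Homog.ddY (hf : Homog S (k + 1) f) (hS : NiceDomain S) (hc : Conic S)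
    (hs : ContDiffOn ℝ ∞ f S) (u : E n) : Homog S k (dd S (0, u) f) := by
  intro q hq r hr
  have := hf.dd_dilation hS hc hs hq hr (0, u)
  rw [dilation_apply] at this
  have h2 : ((0 : E n), r • u) = r • ((0 : E n), u) := by simp
  dsimp only at this
  rw [h2, dd_smul_dir, pow_succ, smul_eq_mul] at this
  have hr' := hr.ne'
  field_simp at this
  linarith

/-- Euler's identity. -/
theorem Homog.euler (hf : Homog S k f) (hS : IsOpen S)
    (hs : ContDiffOn ℝ ∞ f S) {q : E n × E n} (hq : q ∈ S) :
    ∑ i, q.2 i * dd S (bY i) f q = k * f q := by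
  rw [← dd_right_eq_sum]
  have hx : HasDerivWithinAt (fun r : ℝ => (q.1, r • q.2)) ((0 : E n), q.2) univ 1 := by
    refine (hasDerivWithinAt_const _ _ _).prodMk ?_
    simpa using (hasDerivAt_id' (1 : ℝ)).smul_const q.2
  have h1 := hasDerivWithinAt_comp_curve hs hS hx (by simpa using hq)
  simp only [one_smul, hasDerivWithinAt_univ, Prod.mk.eta] at h1
  have h2 : HasDerivAt (fun r : ℝ => r ^ k * f q) (k * f q) 1 := by
    simpa using (hasDerivAt_pow k (1 : ℝ)).mul_const (f q)
  refine h1.unique (h2.congr_of_eventuallyEq ?_)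
  filter_upwards [lt_mem_nhds (zero_lt_one (α := ℝ))] with r hr
  exact hf q hq r hr

theorem Homog.mul {l : ℕ} (hf : Homog S k f) (hh : Homog S l h) :
    Homog S (k + l) (fun q => f q * h q) := by
  intro q hq r hr
  dsimp only
  rw [hf q hq r hr, hh q hq r hr]; ring

theorem Homog.sum {ι : Type*} {s : Finset ι} {f : ι → E n × E n → ℝ}
    (hf : ∀ i ∈ s, Homog S k (f i)) : Homog S k (fun q => ∑ i ∈ s, f i q) := by
  intro q hq r hr
  dsimp only
  rw [Finset.mul_sum]
  exact Finset.sum_congr rfl fun i hi => hf i hi q hq r hr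

theorem Homog.add (hf : Homog S k f) (hh : Homog S k h) : Homog S k (fun q => f q + h q) := by
  intro q hq r hr
  dsimp only
  rw [hf q hq r hr, hh q hq r hr]; ring

theorem Homog.sub (hf : Homog S k f) (hh : Homog S k h) : Homog S k (fun q => f q - h q) := by
  intro q hq r hr
  dsimp only
  rw [hf q hq r hr, hh q hq r hr]; ring

theorem Homog.const_mul (c : ℝ) (hf : Homog S k f) : Homog S k (fun q => c * f q) := by
  intro q hq r hr
  dsimp only
  rw [hf q hq r hr]; ring

theorem homog_vel (i : Fin n) : Homog S 1 (fun q => q.2 i) := by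
  intro q hq r hr
  simp

theorem Homog.congr (hf : Homog S k f) (hc : Conic S) (h' : EqOn h f S) : Homog S k h := by
  intro q hq r hr
  rw [h' (hc q hq r hr), h' hq, hf q hq r hr]

end Homogeneous

/-! ### Smoothness of matrix inverses -/

theorem contDiffOn_matrix_det {X : Type*} [NormedAddCommGroup X] [NormedSpace ℝ X] {m : ℕ}
    {S : Set X} {A : X → Matrix (Fin m) (Fin m) ℝ} (hA : ∀ i j, ContDiffOn ℝ ∞ (fun q => A q i j) S) :
    ContDiffOn ℝ ∞ (fun q => (A q).det) S := by
  simp only [Matrix.det_apply]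
  refine ContDiffOn.sum fun σ _ => ContDiffOn.const_smul _ ?_
  exact contDiffOn_prod fun i _ => hA _ _

/-- Cramer's rule: entries of the adjugate are determinants of matrices with smooth entries. -/
theorem contDiffOn_matrix_inv {X : Type*} [NormedAddCommGroup X] [NormedSpace ℝ X] {m : ℕ}
    {S : Set X} {A : X → Matrix (Fin m) (Fin m) ℝ} (hA : ∀ i j, ContDiffOn ℝ ∞ (fun q => A q i j) S)
    (hdet : ∀ q ∈ S, (A q).det ≠ 0) (i j : Fin m) :
    ContDiffOn ℝ ∞ (fun q => (A q)⁻¹ i j) S := by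
  have : (fun q => (A q)⁻¹ i j) = fun q => (A q).det⁻¹ * (A q).adjugate i j := by
    funext q
    rw [Matrix.inv_def, Ring.inverse_eq_inv']
    rfl
  rw [this]
  refine ContDiffOn.mul ((contDiffOn_matrix_det hA).inv hdet) ?_
  simp only [Matrix.adjugate_apply]
  refine contDiffOn_matrix_det fun a b => ?_
  by_cases h : a = j
  · subst h; simp only [Matrix.updateRow_self]; exact contDiffOn_const
  · simp only [Matrix.updateRow_ne h]; exact hA a b

/-! ### The squared metric in a chart -/

section Slit

variable {n : ℕ} {M : Type*} [TopologicalSpace M] {e : OpenPartialHomeomorph M (E n)}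

/-- The coordinates of nonzero tangent vectors. -/
def slit (e : OpenPartialHomeomorph M (E n)) : Set (E n × E n) := e.target ×ˢ {0}ᶜ

theorem isOpen_slit : IsOpen (slit e) := e.open_target.prod isOpen_compl_singleton

theorem conic_slit : Conic (slit e) := fun _ hq _ hr => ⟨hq.1, smul_ne_zero hr.ne' hq.2⟩

end Slit

section ChartMetric

variable {n : ℕ} {M : Type*} [TopologicalSpace M] [ChartedSpace (E n) M]
  [IsManifold (I n) ∞ M] (F : FinslerMetric n M) {e : OpenPartialHomeomorph M (E n)}

/-- The function `F²` in the chart `e`. -/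
def FinslerMetric.sq (e : OpenPartialHomeomorph M (E n)) (q : E n × E n) : ℝ :=
  F.toFun (vecOfCoords e q) ^ 2

namespace FinslerMetric

theorem coordVec_ne_zero (he : e ∈ atlas (E n) M) {q : E n × E n} (hq : q ∈ slit e) :
    coordVec e q.1 q.2 ≠ 0 := by
  intro h
  have := mfderiv_coordVec he hq.1 q.2
  rw [h, map_zero] at this
  exact hq.2 this.symm

theorem contDiffOn_sq (he : e ∈ atlas (E n) M) : ContDiffOn ℝ ∞ (F.sq e) (slit e) := by
  have h := F.smooth.comp ((contMDiffOn_vecOfCoords he).mono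
    (prod_mono_right (subset_univ ({0}ᶜ)))) (fun q hq => coordVec_ne_zero he hq)
  exact (contMDiffOn_iff_contDiffOn.1 h).pow 2

theorem sq_smul (x y : E n) (r : ℝ) : F.sq e (x, r • y) = r ^ 2 * F.sq e (x, y) := by
  unfold sq vecOfCoords
  dsimp only
  rw [coordVec_smul, F.homogeneous, mul_pow, sq_abs]

theorem homog_sq : Homog (slit e) 2 (F.sq e) := fun _ _ _ _ => F.sq_smul _ _ _

theorem sq_pos (he : e ∈ atlas (E n) M) {q : E n × E n} (hq : q ∈ slit e) : 0 < F.sq e q :=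
  pow_pos (F.pos _ _ (coordVec_ne_zero he hq)) 2

/-- `coordVec` is linear on fibres, so the iterated derivative along lines in the tangent space is
one along lines in ℝⁿ. -/
theorem fundamentalTensor_coordVec (he : e ∈ atlas (E n) M) {x y : E n} (hq : (x, y) ∈ slit e)
    (u w : E n) :
    fundamentalTensor F.toFun (e.symm x) (coordVec e x y) (coordVec e x u) (coordVec e x w) =
      1 / 2 * dd (slit e) (0, u) (dd (slit e) (0, w) (F.sq e)) (x, y) := by
  have hs := F.contDiffOn_sq he
  have hS : IsOpen (slit e) := isOpen_slit
  have hlin : ∀ a b : ℝ, F.toFun ⟨e.symm x, coordVec e x y + a • coordVec e x u +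
      b • coordVec e x w⟩ ^ 2 = F.sq e (x, y + a • u + b • w) := by
    intro a b
    unfold sq vecOfCoords
    simp only [coordVec_add, coordVec_smul]
  unfold fundamentalTensor
  simp only [hlin]
  congr 1
  have hcurve : ∀ (z u : E n) (a : ℝ), HasDerivWithinAt (fun a : ℝ => (x, z + a • u))
      ((0 : E n), u) univ a := by
    intro z u a
    refine (hasDerivWithinAt_const _ _ _).prodMk ?_
    simpa using ((hasDerivAt_id' a).smul_const u).const_add z
  -- F² is smooth only off the zero section, so the inner derivative is computed only for a close to
  -- 0, where y + a u ≠ 0.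
  have hev : ∀ᶠ a in 𝓝 (0 : ℝ), (x, y + a • u) ∈ slit e := by
    have hc : ContinuousAt (fun a : ℝ => (x, y + a • u)) 0 := by fun_prop
    exact hc.eventually (hS.mem_nhds (by simpa using hq))
  have h1 : (fun a : ℝ => deriv (fun b : ℝ => F.sq e (x, y + a • u + b • w)) 0) =ᶠ[𝓝 0]
      fun a => dd (slit e) (0, w) (F.sq e) (x, y + a • u) := by
    filter_upwards [hev] with a ha
    have h := hasDerivWithinAt_comp_curve hs hS (hcurve (y + a • u) w 0) (by simpa using ha)
    rw [hasDerivWithinAt_univ] at h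
    simpa using h.deriv
  rw [h1.deriv_eq]
  have h := hasDerivWithinAt_comp_curve (hs.dd hS.niceDomain (0, w)) hS (hcurve y u 0)
    (by simpa using hq)
  rw [hasDerivWithinAt_univ] at h
  simpa using h.deriv

/-- The derivative `(1/2) ∂F²/∂yⁱ`. -/
def mom (e : OpenPartialHomeomorph M (E n)) (i : Fin n) (q : E n × E n) : ℝ :=
  1 / 2 * dd (slit e) (bY i) (F.sq e) q

theorem contDiffOn_mom (he : e ∈ atlas (E n) M) (i : Fin n) :
    ContDiffOn ℝ ∞ (F.mom e i) (slit e) :=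
  contDiffOn_const.mul ((F.contDiffOn_sq he).dd isOpen_slit.niceDomain _)

theorem homog_mom (he : e ∈ atlas (E n) M) (i : Fin n) : Homog (slit e) 1 (F.mom e i) :=
  (F.homog_sq.ddY isOpen_slit.niceDomain conic_slit (F.contDiffOn_sq he) _).const_mul _

theorem g_eq_dd_dd (he : e ∈ atlas (E n) M) (i j : Fin n) {q : E n × E n} (hq : q ∈ slit e) :
    F.g e i j q.1 q.2 = 1 / 2 * dd (slit e) (bY i) (dd (slit e) (bY j) (F.sq e)) q :=
  F.fundamentalTensor_coordVec he hq _ _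

theorem g_eq_dd_mom (he : e ∈ atlas (E n) M) (i j : Fin n) :
    EqOn (unc (F.g e i j)) (dd (slit e) (bY i) (F.mom e j)) (slit e) := by
  intro q hq
  unfold mom unc
  rw [F.g_eq_dd_dd he i j hq, dd_const_mul isOpen_slit.niceDomain _
    ((F.contDiffOn_sq he).dd isOpen_slit.niceDomain _) hq]

theorem contDiffOn_g (he : e ∈ atlas (E n) M) (i j : Fin n) :
    ContDiffOn ℝ ∞ (unc (F.g e i j)) (slit e) :=
  ((F.contDiffOn_mom he j).dd isOpen_slit.niceDomain _).congr (F.g_eq_dd_mom he i j)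

theorem homog_g (he : e ∈ atlas (E n) M) (i j : Fin n) : Homog (slit e) 0 (unc (F.g e i j)) :=
  ((F.homog_mom he j).ddY isOpen_slit.niceDomain conic_slit (F.contDiffOn_mom he j) _).congr
    conic_slit (F.g_eq_dd_mom he i j)

theorem g_symm (he : e ∈ atlas (E n) M) (i j : Fin n) {q : E n × E n} (hq : q ∈ slit e) :
    F.g e i j q.1 q.2 = F.g e j i q.1 q.2 := by
  rw [F.g_eq_dd_dd he i j hq, F.g_eq_dd_dd he j i hq,
    dd_comm (F.contDiffOn_sq he) isOpen_slit.niceDomain hq]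

theorem dd_g_symm (he : e ∈ atlas (E n) M) (i j : Fin n) (v : E n × E n) {q : E n × E n}
    (hq : q ∈ slit e) : dd (slit e) v (unc (F.g e i j)) q = dd (slit e) v (unc (F.g e j i)) q :=
  dd_congr (fun _ hq => F.g_symm he i j hq) hq

/-- Together with `dd_g_symm` this is the total symmetry of the Cartan tensor, a third fibre
derivative of F². -/
theorem dd_g_rotate (he : e ∈ atlas (E n) M) (i j k : Fin n) {q : E n × E n} (hq : q ∈ slit e) :
    dd (slit e) (bY k) (unc (F.g e i j)) q = dd (slit e) (bY i) (unc (F.g e k j)) q := by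
  rw [dd_congr (F.g_eq_dd_mom he i j) hq, dd_congr (F.g_eq_dd_mom he k j) hq,
    dd_comm (F.contDiffOn_mom he j) isOpen_slit.niceDomain hq]

/-- Euler's identity for the momenta, which have degree 1. The next identities are Euler's for F²
(degree 2) and for g (degree 0). -/
theorem sum_g_mul_vel (he : e ∈ atlas (E n) M) (i : Fin n) {q : E n × E n} (hq : q ∈ slit e) :
    ∑ j, F.g e i j q.1 q.2 * q.2 j = F.mom e i q := by
  have h := (F.homog_mom he i).euler isOpen_slit (F.contDiffOn_mom he i) hq
  rw [Nat.cast_one, one_mul] at h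
  rw [← h]
  refine Finset.sum_congr rfl fun j _ => ?_
  rw [F.g_symm he i j hq, mul_comm]
  congr 1
  exact F.g_eq_dd_mom he j i hq

theorem sum_mom_mul_vel (he : e ∈ atlas (E n) M) {q : E n × E n} (hq : q ∈ slit e) :
    ∑ j, F.mom e j q * q.2 j = F.sq e q := by
  have h := (F.homog_sq (e := e)).euler isOpen_slit (F.contDiffOn_sq he) hq
  have h2 : F.sq e q = 1 / 2 * ((2 : ℕ) * F.sq e q) := by push_cast; ring
  rw [h2, ← h, Finset.mul_sum]
  refine Finset.sum_congr rfl fun j _ => ?_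
  unfold mom; ring

theorem sum_vel_mul_dd_g (he : e ∈ atlas (E n) M) (i j : Fin n) {q : E n × E n}
    (hq : q ∈ slit e) : ∑ k, q.2 k * dd (slit e) (bY k) (unc (F.g e i j)) q = 0 := by
  have h := (F.homog_g he i j).euler isOpen_slit (F.contDiffOn_g he i j) hq
  simpa using h

theorem sum_vel_mul_dd_g' (he : e ∈ atlas (E n) M) (i j : Fin n) {q : E n × E n}
    (hq : q ∈ slit e) : ∑ k, q.2 k * dd (slit e) (bY j) (unc (F.g e i k)) q = 0 := by
  rw [← F.sum_vel_mul_dd_g he j i hq]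
  refine Finset.sum_congr rfl fun k _ => ?_
  rw [F.dd_g_symm he i k _ hq, F.dd_g_rotate he k i j hq]

/-- Position derivative of `sum_g_mul_vel`; the velocity coordinates are constants for ∂/∂x. -/
theorem sum_vel_mul_ddX_g (he : e ∈ atlas (E n) M) (i k : Fin n) {q : E n × E n}
    (hq : q ∈ slit e) :
    ∑ j, q.2 j * dd (slit e) (bx k) (unc (F.g e i j)) q = dd (slit e) (bx k) (F.mom e i) q := by
  have hS : NiceDomain (slit e) := isOpen_slit.niceDomain
  rw [← dd_congr (fun q hq => F.sum_g_mul_vel he i hq) hq,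
    dd_sum hS (fun j _ => (F.contDiffOn_g he i j).mul (contDiffOn_vel j)) hq]
  refine Finset.sum_congr rfl fun j _ => ?_
  rw [dd_mul hS (F.contDiffOn_g he i j) (contDiffOn_vel j) hq, dd_vel hS hq]
  simp [mul_comm]

theorem sum_vel_mul_ddX_mom (he : e ∈ atlas (E n) M) (k : Fin n) {q : E n × E n}
    (hq : q ∈ slit e) :
    ∑ j, q.2 j * dd (slit e) (bx k) (F.mom e j) q = dd (slit e) (bx k) (F.sq e) q := by
  have hS : NiceDomain (slit e) := isOpen_slit.niceDomain
  rw [← dd_congr (fun q hq => F.sum_mom_mul_vel he hq) hq,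
    dd_sum hS (fun j _ => (F.contDiffOn_mom he j).mul (contDiffOn_vel j)) hq]
  refine Finset.sum_congr rfl fun j _ => ?_
  rw [dd_mul hS (F.contDiffOn_mom he j) (contDiffOn_vel j) hq, dd_vel hS hq]
  simp [mul_comm]

/-! #### The inverse of the fundamental tensor -/

theorem sum_g_pos (he : e ∈ atlas (E n) M) {q : E n × E n} (hq : q ∈ slit e) {u : E n}
    (hu : u ≠ 0) : 0 < ∑ i, ∑ j, u i * u j * F.g e i j q.1 q.2 := by
  have hS : NiceDomain (slit e) := isOpen_slit.niceDomain
  have h := F.posDef (e.symm q.1) (coordVec e q.1 q.2) (coordVec e q.1 u)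
    (coordVec_ne_zero he hq) (coordVec_ne_zero (q := (q.1, u)) he ⟨hq.1, hu⟩)
  rw [F.fundamentalTensor_coordVec he hq] at h
  convert h using 1
  rw [dd_right_eq_sum, Finset.mul_sum]
  refine Finset.sum_congr rfl fun i _ => ?_
  rw [dd_congr (fun q hq => dd_right_eq_sum u (F.sq e) q) hq,
    dd_sum hS (fun j _ => contDiffOn_const.mul ((F.contDiffOn_sq he).dd hS _)) hq,
    Finset.mul_sum, Finset.mul_sum]
  refine Finset.sum_congr rfl fun j _ => ?_
  rw [dd_const_mul hS _ ((F.contDiffOn_sq he).dd hS _) hq, F.g_eq_dd_dd he i j hq]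
  ring

/-- The matrix `g_{ij}`. -/
def gMat (e : OpenPartialHomeomorph M (E n)) (q : E n × E n) : Matrix (Fin n) (Fin n) ℝ :=
  Matrix.of fun a b => F.g e a b q.1 q.2

theorem det_gMat_ne_zero (he : e ∈ atlas (E n) M) {q : E n × E n} (hq : q ∈ slit e) :
    (F.gMat e q).det ≠ 0 := by
  intro h
  obtain ⟨v, hv, hv0⟩ := Matrix.exists_mulVec_eq_zero_iff.2 h
  have hv' : (WithLp.toLp 2 v : E n) ≠ 0 := fun h => hv (by simpa using h)
  have := F.sum_g_pos he hq hv'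
  refine this.ne' ?_
  refine Finset.sum_eq_zero fun i _ => ?_
  have h2 := congrFun hv0 i
  simp only [Matrix.mulVec, dotProduct, Pi.zero_apply, gMat, Matrix.of_apply] at h2
  calc _ = v i * ∑ j, F.g e i j q.1 q.2 * v j := by
        rw [Finset.mul_sum]; exact Finset.sum_congr rfl fun j _ => by ring
    _ = 0 := by rw [h2, mul_zero]

theorem contDiffOn_gInv (he : e ∈ atlas (E n) M) (i j : Fin n) :
    ContDiffOn ℝ ∞ (unc (F.gInv e i j)) (slit e) :=
  contDiffOn_matrix_inv (A := F.gMat e) (fun i j => F.contDiffOn_g he i j)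
    (fun _ hq => F.det_gMat_ne_zero he hq) i j

theorem homog_gInv (he : e ∈ atlas (E n) M) (i j : Fin n) :
    Homog (slit e) 0 (unc (F.gInv e i j)) := by
  intro q hq r hr
  have : F.gMat e (q.1, r • q.2) = F.gMat e q := by
    ext a b
    simpa [gMat] using F.homog_g he a b q hq r hr
  change (F.gMat e (q.1, r • q.2))⁻¹ i j = r ^ 0 * (F.gMat e q)⁻¹ i j
  rw [this, pow_zero, one_mul]

theorem sum_gInv_mul_g (he : e ∈ atlas (E n) M) (i j : Fin n) {q : E n × E n} (hq : q ∈ slit e) :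
    ∑ m, F.gInv e i m q.1 q.2 * F.g e m j q.1 q.2 = if i = j then 1 else 0 := by
  have h := Matrix.nonsing_inv_mul (F.gMat e q) (isUnit_iff_ne_zero.2 (F.det_gMat_ne_zero he hq))
  have h2 := congrFun (congrFun h i) j
  rwa [Matrix.mul_apply, Matrix.one_apply] at h2

theorem sum_g_mul_gInv (he : e ∈ atlas (E n) M) (i j : Fin n) {q : E n × E n} (hq : q ∈ slit e) :
    ∑ m, F.g e i m q.1 q.2 * F.gInv e m j q.1 q.2 = if i = j then 1 else 0 := by
  have h := Matrix.mul_nonsing_inv (F.gMat e q) (isUnit_iff_ne_zero.2 (F.det_gMat_ne_zero he hq))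
  have h2 := congrFun (congrFun h i) j
  rwa [Matrix.mul_apply, Matrix.one_apply] at h2

theorem sum_gInv_mul_sum_g (he : e ∈ atlas (E n) M) (i : Fin n) (v : Fin n → ℝ) {q : E n × E n}
    (hq : q ∈ slit e) :
    ∑ m, F.gInv e i m q.1 q.2 * ∑ j, F.g e m j q.1 q.2 * v j = v i := by
  simp only [Finset.mul_sum, ← mul_assoc]
  rw [Finset.sum_comm]
  simp only [← Finset.sum_mul, F.sum_gInv_mul_g he _ _ hq]
  simp

theorem sum_g_mul_sum_gInv (he : e ∈ atlas (E n) M) (i : Fin n) (v : Fin n → ℝ) {q : E n × E n}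
    (hq : q ∈ slit e) :
    ∑ m, F.g e i m q.1 q.2 * ∑ j, F.gInv e m j q.1 q.2 * v j = v i := by
  simp only [Finset.mul_sum, ← mul_assoc]
  rw [Finset.sum_comm]
  simp only [← Finset.sum_mul, F.sum_g_mul_gInv he _ _ hq]
  simp

end FinslerMetric

end ChartMetric

end FinslerPEnergy

namespace FinslerPEnergy

/-! ### The spray and the Cartan connection in a chart -/

section Connection

variable {n : ℕ} {M : Type*} [TopologicalSpace M] [ChartedSpace (E n) M]
  [IsManifold (I n) ∞ M] (F : FinslerMetric n M) {e : OpenPartialHomeomorph M (E n)}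

namespace FinslerMetric

theorem Gam_eq (he : e ∈ atlas (E n) M) (i j k : Fin n) :
    EqOn (unc (F.Gam e i j k)) (fun q => (1 / 2) * ∑ m, unc (F.gInv e i m) q *
      (dd (slit e) (bx j) (unc (F.g e m k)) q + dd (slit e) (bx k) (unc (F.g e j m)) q -
        dd (slit e) (bx m) (unc (F.g e j k)) q)) (slit e) := by
  intro q hq
  simp only [unc, Gam, partialX_eq_dd isOpen_slit (F.contDiffOn_g he _ _) hq]

theorem contDiffOn_Gam (he : e ∈ atlas (E n) M) (i j k : Fin n) :
    ContDiffOn ℝ ∞ (unc (F.Gam e i j k)) (slit e) := by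
  have hS : NiceDomain (slit e) := isOpen_slit.niceDomain
  refine ContDiffOn.congr ?_ (F.Gam_eq he i j k)
  refine contDiffOn_const.mul (ContDiffOn.sum fun m _ => (F.contDiffOn_gInv he i m).mul ?_)
  exact (((F.contDiffOn_g he m k).dd hS _).add ((F.contDiffOn_g he j m).dd hS _)).sub
    ((F.contDiffOn_g he j k).dd hS _)

theorem homog_Gam (he : e ∈ atlas (E n) M) (i j k : Fin n) :
    Homog (slit e) 0 (unc (F.Gam e i j k)) := by
  have hS : NiceDomain (slit e) := isOpen_slit.niceDomain
  have hX : ∀ i j u, Homog (slit e) 0 (dd (slit e) (bx u) (unc (F.g e i j))) := fun i j u =>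
    (F.homog_g he i j).ddX hS conic_slit (F.contDiffOn_g he i j) _
  refine Homog.congr ?_ conic_slit (F.Gam_eq he i j k)
  refine Homog.const_mul _ (Homog.sum fun m _ => ?_)
  exact (F.homog_gInv he i m).mul (((hX _ _ _).add (hX _ _ _)).sub (hX _ _ _))

/-- The spray coefficients `Γ^i_{kl} y^k y^l`. -/
def spray (e : OpenPartialHomeomorph M (E n)) (i : Fin n) (x y : E n) : ℝ :=
  ∑ k, ∑ l, F.Gam e i k l x y * y k * y l

theorem contDiffOn_spray (he : e ∈ atlas (E n) M) (i : Fin n) :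
    ContDiffOn ℝ ∞ (unc (F.spray e i)) (slit e) :=
  ContDiffOn.sum fun k _ => ContDiffOn.sum fun l _ =>
    ((F.contDiffOn_Gam he i k l).mul (contDiffOn_vel k)).mul (contDiffOn_vel l)

theorem homog_spray (he : e ∈ atlas (E n) M) (i : Fin n) :
    Homog (slit e) 2 (unc (F.spray e i)) :=
  Homog.sum fun k _ => Homog.sum fun l _ =>
    ((F.homog_Gam he i k l).mul (homog_vel k)).mul (homog_vel l)

theorem N_eq (he : e ∈ atlas (E n) M) (i j : Fin n) :
    EqOn (unc (F.N e i j)) (fun q => 1 / 2 * dd (slit e) (bY j) (unc (F.spray e i)) q)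
      (slit e) := by
  intro q hq
  exact congrArg _ (partialY_eq_dd isOpen_slit (F.contDiffOn_spray he i) hq j)

theorem contDiffOn_N (he : e ∈ atlas (E n) M) (i j : Fin n) :
    ContDiffOn ℝ ∞ (unc (F.N e i j)) (slit e) :=
  (contDiffOn_const.mul ((F.contDiffOn_spray he i).dd isOpen_slit.niceDomain _)).congr
    (F.N_eq he i j)

theorem ddY_spray (he : e ∈ atlas (E n) M) (i j : Fin n) {q : E n × E n} (hq : q ∈ slit e) :
    dd (slit e) (bY j) (unc (F.spray e i)) q = 2 * F.N e i j q.1 q.2 := by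
  have := F.N_eq he i j hq
  simp only [unc] at this
  linarith

/-- Euler's identity for the spray, of degree 2; the factor 2 cancels the 1/2 in the definition of
N. -/
theorem sum_N_mul_vel (he : e ∈ atlas (E n) M) (i : Fin n) {q : E n × E n} (hq : q ∈ slit e) :
    ∑ j, F.N e i j q.1 q.2 * q.2 j = F.spray e i q.1 q.2 := by
  have h := (F.homog_spray he i).euler isOpen_slit (F.contDiffOn_spray he i) hq
  have h2 : F.spray e i q.1 q.2 = 1 / 2 * ((2 : ℕ) * unc (F.spray e i) q) := by push_cast; ring
  rw [h2, ← h, Finset.mul_sum]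
  refine Finset.sum_congr rfl fun j _ => ?_
  rw [F.ddY_spray he i j hq]; ring

theorem sum_g_mul_Gam (he : e ∈ atlas (E n) M) (m k l : Fin n) {q : E n × E n} (hq : q ∈ slit e) :
    ∑ i, F.g e m i q.1 q.2 * F.Gam e i k l q.1 q.2 = 1 / 2 *
      (dd (slit e) (bx k) (unc (F.g e m l)) q + dd (slit e) (bx l) (unc (F.g e k m)) q -
        dd (slit e) (bx m) (unc (F.g e k l)) q) := by
  rw [← F.sum_g_mul_sum_gInv he m (fun m => 1 / 2 *
      (dd (slit e) (bx k) (unc (F.g e m l)) q + dd (slit e) (bx l) (unc (F.g e k m)) q -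
        dd (slit e) (bx m) (unc (F.g e k l)) q)) hq]
  refine Finset.sum_congr rfl fun i _ => ?_
  have := F.Gam_eq he i k l hq
  simp only [unc] at this
  rw [this, Finset.mul_sum]
  congr 1
  exact Finset.sum_congr rfl fun j _ => by ring

/-- Lowering the index of the spray coefficients. -/
theorem sum_g_mul_spray (he : e ∈ atlas (E n) M) (m : Fin n) {q : E n × E n} (hq : q ∈ slit e) :
    ∑ i, F.g e m i q.1 q.2 * F.spray e i q.1 q.2 =
      ∑ k, q.2 k * dd (slit e) (bx k) (F.mom e m) q - 1 / 2 * dd (slit e) (bx m) (F.sq e) q := by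
  have h1 : ∑ i, F.g e m i q.1 q.2 * F.spray e i q.1 q.2 =
      ∑ k, ∑ l, (∑ i, F.g e m i q.1 q.2 * F.Gam e i k l q.1 q.2) * q.2 k * q.2 l := by
    simp only [spray, Finset.mul_sum, Finset.sum_mul]
    rw [Finset.sum_comm]
    refine Finset.sum_congr rfl fun k _ => ?_
    rw [Finset.sum_comm]
    exact Finset.sum_congr rfl fun l _ => Finset.sum_congr rfl fun i _ => by ring
  rw [h1]
  simp only [F.sum_g_mul_Gam he _ _ _ hq]
  have h2 : ∀ k, q.2 k * dd (slit e) (bx k) (F.mom e m) q =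
      ∑ l, q.2 k * (q.2 l * dd (slit e) (bx k) (unc (F.g e m l)) q) := fun k => by
    rw [← F.sum_vel_mul_ddX_g he m k hq, Finset.mul_sum]
  have h3 : ∑ k, q.2 k * dd (slit e) (bx k) (F.mom e m) q =
      ∑ k, ∑ l, q.2 k * (q.2 l * dd (slit e) (bx l) (unc (F.g e k m)) q) := by
    simp only [h2]
    rw [Finset.sum_comm]
    refine Finset.sum_congr rfl fun k _ => Finset.sum_congr rfl fun l _ => ?_
    rw [F.dd_g_symm he m k _ hq]; ring
  have h4 : dd (slit e) (bx m) (F.sq e) q =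
      ∑ k, ∑ l, q.2 k * (q.2 l * dd (slit e) (bx m) (unc (F.g e k l)) q) := by
    rw [← F.sum_vel_mul_ddX_mom he m hq]
    refine Finset.sum_congr rfl fun k _ => ?_
    rw [← F.sum_vel_mul_ddX_g he k m hq, Finset.mul_sum]
  -- The sum is split into halves because the two terms ∂_k g_{ml} and ∂_l g_{km} of the Christoffel
  -- symbol have equal contractions with y^k y^l; `h3` is the relabelled version.
  have h5 : ∑ k, q.2 k * dd (slit e) (bx k) (F.mom e m) q =
      1 / 2 * ∑ k, q.2 k * dd (slit e) (bx k) (F.mom e m) q +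
      1 / 2 * ∑ k, q.2 k * dd (slit e) (bx k) (F.mom e m) q := by ring
  rw [h5]
  conv_rhs => enter [1, 2]; rw [h3]
  rw [h4]
  simp only [h2, Finset.mul_sum, ← Finset.sum_add_distrib, ← Finset.sum_sub_distrib]
  exact Finset.sum_congr rfl fun k _ => Finset.sum_congr rfl fun l _ => by ring

theorem ddY_mom (he : e ∈ atlas (E n) M) (i j : Fin n) {q : E n × E n} (hq : q ∈ slit e) :
    dd (slit e) (bY i) (F.mom e j) q = F.g e i j q.1 q.2 := (F.g_eq_dd_mom he i j hq).symm

/-- The derivative of `sum_g_mul_spray` along the fibre. -/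
theorem sum_g_mul_N (he : e ∈ atlas (E n) M) (m j : Fin n) {q : E n × E n} (hq : q ∈ slit e) :
    2 * ∑ i, F.g e m i q.1 q.2 * F.N e i j q.1 q.2 =
      dd (slit e) (bx j) (F.mom e m) q - dd (slit e) (bx m) (F.mom e j) q +
      ∑ k, q.2 k * dd (slit e) (bx k) (unc (F.g e j m)) q -
      ∑ i, F.spray e i q.1 q.2 * dd (slit e) (bY i) (unc (F.g e j m)) q := by
  have hS : NiceDomain (slit e) := isOpen_slit.niceDomain
  have hmom := F.contDiffOn_mom he m
  have hsq := F.contDiffOn_sq he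
  have h := dd_congr (v := bY j) (fun q hq => F.sum_g_mul_spray he m hq) hq
  rw [dd_sum hS (fun i _ => (F.contDiffOn_g he m i).mul (F.contDiffOn_spray he i)) hq,
    dd_sub hS (ContDiffOn.sum fun k _ => (contDiffOn_vel k).mul (hmom.dd hS _))
      (contDiffOn_const.mul (hsq.dd hS _)) hq,
    dd_sum hS (fun k _ => (contDiffOn_vel k).mul (hmom.dd hS _)) hq,
    dd_const_mul hS _ (hsq.dd hS _) hq, dd_comm hsq hS hq] at h
  have h1 : ∀ k, dd (slit e) (bY j) (fun q => q.2 k * dd (slit e) (bx k) (F.mom e m) q) q =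
      (if k = j then dd (slit e) (bx k) (F.mom e m) q else 0) +
        q.2 k * dd (slit e) (bx k) (unc (F.g e j m)) q := by
    intro k
    rw [dd_mul hS (contDiffOn_vel k) (hmom.dd hS _) hq, dd_vel hS hq, dd_comm hmom hS hq,
      dd_congr (fun q hq => F.ddY_mom he j m hq) hq, basisVec_apply]
    simp
  -- By total symmetry ∂g_{mi}/∂y^j = ∂g_{jm}/∂y^i, so the spray ends up contracted with the index
  -- of differentiation.
  have h2 : ∀ i, dd (slit e) (bY j) (fun q => F.g e m i q.1 q.2 * F.spray e i q.1 q.2) q =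
      F.spray e i q.1 q.2 * dd (slit e) (bY i) (unc (F.g e j m)) q +
        2 * (F.g e m i q.1 q.2 * F.N e i j q.1 q.2) := by
    intro i
    rw [dd_mul hS (F.contDiffOn_g he m i) (F.contDiffOn_spray he i) hq, F.ddY_spray he i j hq,
      F.dd_g_symm he m i _ hq, F.dd_g_rotate he i m j hq]
    ring
  have h3 : 1 / 2 * dd (slit e) (bx m) (dd (slit e) (bY j) (F.sq e)) q =
      dd (slit e) (bx m) (F.mom e j) q := by
    rw [← dd_const_mul hS _ (hsq.dd hS _) hq]; rfl
  simp only [h1, h2, Finset.sum_add_distrib, ← Finset.mul_sum, h3] at h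
  simp only [Finset.sum_ite_eq', Finset.mem_univ, if_true] at h
  linarith

theorem deltaX_eq (i : Fin n) {h : E n → E n → ℝ} (hh : ContDiffOn ℝ ∞ (unc h) (slit e))
    {q : E n × E n} (hq : q ∈ slit e) :
    F.deltaX e i h q.1 q.2 = dd (slit e) (bx i) (unc h) q -
      ∑ j, F.N e j i q.1 q.2 * dd (slit e) (bY j) (unc h) q := by
  simp only [deltaX, partialX_eq_dd isOpen_slit hh hq, partialY_eq_dd isOpen_slit hh hq]

/-- The vertical part of δ/δx^j contributes nothing: y^k ∂g_{mk}/∂y^l = 0 by `sum_vel_mul_dd_g'`. -/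
theorem sum_vel_mul_deltaX_g (he : e ∈ atlas (E n) M) (m j : Fin n) {q : E n × E n}
    (hq : q ∈ slit e) :
    ∑ k, F.deltaX e j (F.g e m k) q.1 q.2 * q.2 k = dd (slit e) (bx j) (F.mom e m) q := by
  simp only [F.deltaX_eq j (F.contDiffOn_g he _ _) hq, sub_mul, Finset.sum_sub_distrib]
  rw [← F.sum_vel_mul_ddX_g he m j hq]
  have : ∑ k, (∑ l, F.N e l j q.1 q.2 * dd (slit e) (bY l) (unc (F.g e m k)) q) * q.2 k = 0 := by
    simp only [Finset.sum_mul]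
    rw [Finset.sum_comm]
    refine Finset.sum_eq_zero fun l _ => ?_
    rw [← mul_zero (F.N e l j q.1 q.2), ← F.sum_vel_mul_dd_g' he m l hq, Finset.mul_sum]
    exact Finset.sum_congr rfl fun k _ => by ring
  rw [this, sub_zero]
  exact Finset.sum_congr rfl fun k _ => by ring

/-- Since N^i_k y^k = G^i, the operator y^k δ/δx^k is differentiation along the geodesic flow. -/
theorem sum_vel_mul_deltaX (he : e ∈ atlas (E n) M) {h : E n → E n → ℝ}
    (hh : ContDiffOn ℝ ∞ (unc h) (slit e)) {q : E n × E n} (hq : q ∈ slit e) :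
    ∑ k, F.deltaX e k h q.1 q.2 * q.2 k = ∑ k, q.2 k * dd (slit e) (bx k) (unc h) q -
      ∑ i, F.spray e i q.1 q.2 * dd (slit e) (bY i) (unc h) q := by
  simp only [F.deltaX_eq _ hh hq, sub_mul, Finset.sum_sub_distrib]
  congr 1
  · exact Finset.sum_congr rfl fun k _ => by ring
  · simp only [Finset.sum_mul]
    rw [Finset.sum_comm]
    refine Finset.sum_congr rfl fun i _ => ?_
    rw [← F.sum_N_mul_vel he i hq, Finset.sum_mul]
    exact Finset.sum_congr rfl fun k _ => by ring

/-- The Cartan connection induces the nonlinear connection: `L^i_{jk} y^k = N^i_j`. -/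
theorem sum_L_mul_vel (he : e ∈ atlas (E n) M) (i j : Fin n) {q : E n × E n} (hq : q ∈ slit e) :
    ∑ k, F.L e i j k q.1 q.2 * q.2 k = F.N e i j q.1 q.2 := by
  have h1 : ∑ k, F.L e i j k q.1 q.2 * q.2 k = 1 / 2 * ∑ m, F.gInv e i m q.1 q.2 *
      (∑ k, F.deltaX e j (F.g e m k) q.1 q.2 * q.2 k +
        ∑ k, F.deltaX e k (F.g e j m) q.1 q.2 * q.2 k -
        ∑ k, F.deltaX e m (F.g e j k) q.1 q.2 * q.2 k) := by
    simp only [L, Finset.mul_sum, Finset.sum_mul, ← Finset.sum_add_distrib,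
      ← Finset.sum_sub_distrib]
    rw [Finset.sum_comm]
    exact Finset.sum_congr rfl fun k _ => Finset.sum_congr rfl fun l _ => by ring
  -- Contracted with y^k, the three derivatives in the definition of L become the right side of
  -- `sum_g_mul_N`; the inverse matrix then removes g.
  have h2 : ∀ m, ∑ k, F.deltaX e j (F.g e m k) q.1 q.2 * q.2 k +
        ∑ k, F.deltaX e k (F.g e j m) q.1 q.2 * q.2 k -
        ∑ k, F.deltaX e m (F.g e j k) q.1 q.2 * q.2 k =
      ∑ i, F.g e m i q.1 q.2 * (2 * F.N e i j q.1 q.2) := by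
    intro m
    rw [F.sum_vel_mul_deltaX_g he m j hq, F.sum_vel_mul_deltaX_g he j m hq,
      F.sum_vel_mul_deltaX he (F.contDiffOn_g he j m) hq]
    have := F.sum_g_mul_N he m j hq
    have h3 : ∑ i, F.g e m i q.1 q.2 * (2 * F.N e i j q.1 q.2) =
        2 * ∑ i, F.g e m i q.1 q.2 * F.N e i j q.1 q.2 := by
      rw [Finset.mul_sum]; exact Finset.sum_congr rfl fun i _ => by ring
    linarith
  simp only [h1, h2]
  rw [F.sum_gInv_mul_sum_g he i _ hq]
  ring

theorem sum_vel_mul_C (he : e ∈ atlas (E n) M) (i k : Fin n) {q : E n × E n} (hq : q ∈ slit e) :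
    ∑ j, q.2 j * F.C e i j k q.1 q.2 = 0 := by
  have h1 : ∑ j, q.2 j * F.C e i j k q.1 q.2 = 1 / 2 * ∑ m, F.gInv e i m q.1 q.2 *
      (∑ j, q.2 j * dd (slit e) (bY j) (unc (F.g e m k)) q +
        ∑ j, q.2 j * dd (slit e) (bY k) (unc (F.g e m j)) q -
        ∑ j, q.2 j * dd (slit e) (bY m) (unc (F.g e k j)) q) := by
    simp only [C, Finset.mul_sum, ← Finset.sum_add_distrib,
      ← Finset.sum_sub_distrib, partialY_eq_dd isOpen_slit (F.contDiffOn_g he _ _) hq]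
    rw [Finset.sum_comm]
    refine Finset.sum_congr rfl fun m _ => Finset.sum_congr rfl fun j _ => ?_
    rw [F.dd_g_symm he j m _ hq, F.dd_g_symm he j k _ hq]
    ring
  rw [h1]
  simp only [F.sum_vel_mul_dd_g he _ _ hq, F.sum_vel_mul_dd_g' he _ _ hq]
  simp

/-- Expresses the contracted curvature through the position derivative of the spray, NN, and the
derivative of N along the geodesic flow: exactly the terms that turn ∇∇ξ into the linearized
geodesic equation. -/
theorem sum_R_mul_vel (he : e ∈ atlas (E n) M) (i k : Fin n) {q : E n × E n} (hq : q ∈ slit e) :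
    ∑ j, F.R e i j k q.1 q.2 * q.2 j = dd (slit e) (bx k) (unc (F.spray e i)) q -
      ∑ l, F.N e i l q.1 q.2 * F.N e l k q.1 q.2 -
      (∑ j, q.2 j * dd (slit e) (bx j) (unc (F.N e i k)) q -
        ∑ l, F.spray e l q.1 q.2 * dd (slit e) (bY l) (unc (F.N e i k)) q) := by
  have hS : NiceDomain (slit e) := isOpen_slit.niceDomain
  have hN := F.contDiffOn_N he
  -- Product rule for N^i_j y^j = G^i; the derivative of the factor y^j accounts for the subtracted
  -- sum.
  have key : ∀ v : E n × E n, ∑ j, dd (slit e) v (unc (F.N e i j)) q * q.2 j =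
      dd (slit e) v (unc (F.spray e i)) q - ∑ j, F.N e i j q.1 q.2 * v.2 j := by
    intro v
    rw [← dd_congr (fun q hq => F.sum_N_mul_vel he i hq) hq,
      dd_sum hS (fun j _ => (hN i j).mul (contDiffOn_vel j)) hq, ← Finset.sum_sub_distrib]
    refine Finset.sum_congr rfl fun j _ => ?_
    rw [dd_mul hS (hN i j) (contDiffOn_vel j) hq, dd_vel hS hq]
    ring
  simp only [R, sub_mul, Finset.sum_sub_distrib]
  rw [F.sum_vel_mul_deltaX he (hN i k) hq]
  congr 1
  simp only [F.deltaX_eq _ (hN _ _) hq, sub_mul, Finset.sum_sub_distrib]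
  congr 1
  · rw [key]; simp
  · simp only [Finset.sum_mul]
    rw [Finset.sum_comm]
    refine Finset.sum_congr rfl fun l _ => ?_
    -- In a vertical direction the result is 2N - N = N, because ∂G/∂y = 2N.
    have h2 := key (bY l)
    rw [F.ddY_spray he i l hq] at h2
    simp only [basisVec_apply, mul_ite, mul_one, mul_zero, Finset.sum_ite_eq', Finset.mem_univ,
      if_true] at h2
    have h3 : ∑ j, F.N e l k q.1 q.2 * dd (slit e) (bY l) (unc (F.N e i j)) q * q.2 j =
        F.N e l k q.1 q.2 * ∑ j, dd (slit e) (bY l) (unc (F.N e i j)) q * q.2 j := by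
      rw [Finset.mul_sum]; exact Finset.sum_congr rfl fun j _ => by ring
    rw [h3, h2]; ring

/-! #### The Lagrangian of the `p`-energy -/

/-- The Lagrangian `F^p` in a chart. -/
def lag (e : OpenPartialHomeomorph M (E n)) (p : ℝ) (q : E n × E n) : ℝ := F.sq e q ^ (p / 2)

theorem contDiffOn_lag (he : e ∈ atlas (E n) M) (p : ℝ) :
    ContDiffOn ℝ ∞ (F.lag e p) (slit e) :=
  (F.contDiffOn_sq he).rpow_const_of_ne fun _ hq => (F.sq_pos he hq).ne'

theorem contDiffOn_sq_rpow (he : e ∈ atlas (E n) M) (r : ℝ) :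
    ContDiffOn ℝ ∞ (fun q => F.sq e q ^ r) (slit e) :=
  (F.contDiffOn_sq he).rpow_const_of_ne fun _ hq => (F.sq_pos he hq).ne'

theorem dd_lag (he : e ∈ atlas (E n) M) (p : ℝ) (v : E n × E n) {q : E n × E n}
    (hq : q ∈ slit e) :
    dd (slit e) v (F.lag e p) q = p / 2 * F.sq e q ^ (p / 2 - 1) * dd (slit e) v (F.sq e) q :=
  dd_rpow isOpen_slit.niceDomain _ (F.contDiffOn_sq he) (fun _ hq => F.sq_pos he hq) hq

theorem ddY_lag (he : e ∈ atlas (E n) M) (p : ℝ) (i : Fin n) {q : E n × E n}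
    (hq : q ∈ slit e) :
    dd (slit e) (bY i) (F.lag e p) q = p * F.sq e q ^ (p / 2 - 1) * F.mom e i q := by
  rw [F.dd_lag he p _ hq, mom]; ring

theorem dd_ddY_lag (he : e ∈ atlas (E n) M) (p : ℝ) (i : Fin n) (v : E n × E n) {q : E n × E n}
    (hq : q ∈ slit e) :
    dd (slit e) v (dd (slit e) (bY i) (F.lag e p)) q =
      p * (p / 2 - 1) * F.sq e q ^ (p / 2 - 1 - 1) * dd (slit e) v (F.sq e) q * F.mom e i q +
      p * F.sq e q ^ (p / 2 - 1) * dd (slit e) v (F.mom e i) q := by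
  have hS : NiceDomain (slit e) := isOpen_slit.niceDomain
  rw [dd_congr (fun q hq => F.ddY_lag he p i hq) hq,
    dd_mul hS (contDiffOn_const.mul (F.contDiffOn_sq_rpow he _)) (F.contDiffOn_mom he i) hq,
    dd_const_mul hS _ (F.contDiffOn_sq_rpow he _) hq,
    dd_rpow hS _ (F.contDiffOn_sq he) (fun _ hq => F.sq_pos he hq) hq]
  ring

/-- The fibre Hessian of the Lagrangian. -/
def lagHess (e : OpenPartialHomeomorph M (E n)) (p : ℝ) (i j : Fin n) (q : E n × E n) : ℝ :=
  dd (slit e) (bY i) (dd (slit e) (bY j) (F.lag e p)) q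

theorem contDiffOn_lagHess (he : e ∈ atlas (E n) M) (p : ℝ) (i j : Fin n) :
    ContDiffOn ℝ ∞ (F.lagHess e p i j) (slit e) :=
  ((F.contDiffOn_lag he p).dd isOpen_slit.niceDomain _).dd isOpen_slit.niceDomain _

/-- A rank-one perturbation of p F^{p-2} g in the direction of the momentum; the coefficient p(p -
2) is 2p(p/2 - 1), as ∂F²/∂y^i is twice the momentum. -/
theorem lagHess_eq (he : e ∈ atlas (E n) M) (p : ℝ) (i j : Fin n) {q : E n × E n}
    (hq : q ∈ slit e) :
    F.lagHess e p i j q =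
      p * (p - 2) * F.sq e q ^ (p / 2 - 1 - 1) * F.mom e i q * F.mom e j q +
      p * F.sq e q ^ (p / 2 - 1) * F.g e i j q.1 q.2 := by
  rw [lagHess, F.dd_ddY_lag he p j _ hq, F.ddY_mom he i j hq, mom, mom]
  ring

/-- Conservation of F² under the geodesic flow, obtained by contracting the lowered spray with y. It
is the reason why all powers of F share the same geodesics of constant speed. -/
theorem sum_spray_mul_mom (he : e ∈ atlas (E n) M) {q : E n × E n} (hq : q ∈ slit e) :
    ∑ i, F.spray e i q.1 q.2 * F.mom e i q =
      1 / 2 * ∑ k, q.2 k * dd (slit e) (bx k) (F.sq e) q := by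
  have h1 : ∑ i, F.spray e i q.1 q.2 * F.mom e i q =
      ∑ m, q.2 m * ∑ i, F.g e m i q.1 q.2 * F.spray e i q.1 q.2 := by
    simp only [← F.sum_g_mul_vel he _ hq, Finset.mul_sum]
    rw [Finset.sum_comm]
    refine Finset.sum_congr rfl fun k _ => Finset.sum_congr rfl fun l _ => ?_
    rw [F.g_symm he l k hq]; ring
  have h2 : ∑ m, q.2 m * ∑ k, q.2 k * dd (slit e) (bx k) (F.mom e m) q =
      ∑ k, q.2 k * dd (slit e) (bx k) (F.sq e) q := by
    simp only [← F.sum_vel_mul_ddX_mom he _ hq, Finset.mul_sum]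
    rw [Finset.sum_comm]
    exact Finset.sum_congr rfl fun k _ => Finset.sum_congr rfl fun l _ => by ring
  rw [h1]
  simp only [F.sum_g_mul_spray he _ hq, mul_sub, Finset.sum_sub_distrib, h2]
  have h3 : ∑ m, q.2 m * (1 / 2 * dd (slit e) (bx m) (F.sq e) q) =
      1 / 2 * ∑ k, q.2 k * dd (slit e) (bx k) (F.sq e) q := by
    rw [Finset.mul_sum]; exact Finset.sum_congr rfl fun k _ => by ring
  rw [h3]; ring

/-- The spray is the Euler-Lagrange vector field of `F^p`. -/
theorem euler_lagrange_spray (he : e ∈ atlas (E n) M) (p : ℝ) (j : Fin n) {q : E n × E n}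
    (hq : q ∈ slit e) :
    ∑ k, q.2 k * dd (slit e) (bx k) (dd (slit e) (bY j) (F.lag e p)) q -
      dd (slit e) (bx j) (F.lag e p) q = ∑ i, F.spray e i q.1 q.2 * F.lagHess e p i j q := by
  simp only [F.dd_ddY_lag he p j _ hq, F.lagHess_eq he p _ j hq, F.dd_lag he p _ hq]
  have h1 : ∑ i, F.spray e i q.1 q.2 *
      (p * (p - 2) * F.sq e q ^ (p / 2 - 1 - 1) * F.mom e i q * F.mom e j q +
        p * F.sq e q ^ (p / 2 - 1) * F.g e i j q.1 q.2) =
      p * (p - 2) * F.sq e q ^ (p / 2 - 1 - 1) * F.mom e j q *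
        (∑ i, F.spray e i q.1 q.2 * F.mom e i q) +
      p * F.sq e q ^ (p / 2 - 1) * ∑ i, F.g e j i q.1 q.2 * F.spray e i q.1 q.2 := by
    rw [Finset.mul_sum, Finset.mul_sum, ← Finset.sum_add_distrib]
    refine Finset.sum_congr rfl fun i _ => ?_
    rw [F.g_symm he j i hq]; ring
  have h2 : ∑ k, q.2 k *
      (p * (p / 2 - 1) * F.sq e q ^ (p / 2 - 1 - 1) * dd (slit e) (bx k) (F.sq e) q * F.mom e j q +
        p * F.sq e q ^ (p / 2 - 1) * dd (slit e) (bx k) (F.mom e j) q) =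
      p * (p / 2 - 1) * F.sq e q ^ (p / 2 - 1 - 1) * F.mom e j q *
        (∑ k, q.2 k * dd (slit e) (bx k) (F.sq e) q) +
      p * F.sq e q ^ (p / 2 - 1) * ∑ k, q.2 k * dd (slit e) (bx k) (F.mom e j) q := by
    rw [Finset.mul_sum, Finset.mul_sum, ← Finset.sum_add_distrib]
    exact Finset.sum_congr rfl fun i _ => by ring
  -- Conservation of F² matches the rank-one terms of the two sides; the remaining ones match by the
  -- formula for the lowered spray.
  rw [h1, h2, F.sum_spray_mul_mom he hq, F.sum_g_mul_spray he j hq]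
  ring

/-- The fibre Hessian of `F^p` is nondegenerate for `p ≠ 0, 1`. -/
theorem eq_zero_of_sum_lagHess (he : e ∈ atlas (E n) M) {p : ℝ} (hp0 : p ≠ 0) (hp1 : p ≠ 1)
    {q : E n × E n} (hq : q ∈ slit e) {u : E n}
    (hu : ∀ j, ∑ i, u i * F.lagHess e p i j q = 0) : u = 0 := by
  by_contra hne
  have hG := F.sq_pos he hq
  -- A is the g-product of u with y. Once it vanishes, the rank-one term disappears and positivity
  -- of g finishes the proof.
  obtain ⟨A, hA⟩ : ∃ A, A = ∑ i, u i * F.mom e i q := ⟨_, rfl⟩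
  have h1 : ∀ j, p * (p - 2) * F.sq e q ^ (p / 2 - 1 - 1) * A * F.mom e j q +
      p * F.sq e q ^ (p / 2 - 1) * ∑ i, u i * F.g e i j q.1 q.2 = 0 := by
    intro j
    rw [← hu j]
    simp only [F.lagHess_eq he p _ j hq, hA, Finset.mul_sum, Finset.sum_mul,
      ← Finset.sum_add_distrib]
    exact Finset.sum_congr rfl fun i _ => by ring
  have hpow : F.sq e q ^ (p / 2 - 1) = F.sq e q ^ (p / 2 - 1 - 1) * F.sq e q := by
    rw [Real.rpow_sub_one hG.ne' (p / 2 - 1)]; field_simp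
  have hpos := Real.rpow_pos_of_pos hG (p / 2 - 1 - 1)
  have hpos' := Real.rpow_pos_of_pos hG (p / 2 - 1)
  have hAg : ∑ j, (∑ i, u i * F.g e i j q.1 q.2) * q.2 j = A := by
    simp only [hA, ← F.sum_g_mul_vel he _ hq, Finset.mul_sum, Finset.sum_mul]
    rw [Finset.sum_comm]
    exact Finset.sum_congr rfl fun i _ => Finset.sum_congr rfl fun j _ => by ring
  have h2 : p * (p - 1) * F.sq e q ^ (p / 2 - 1) * A = 0 := by
    -- Contraction with y: both terms become multiples of F^{p-2} A, and the factor is p(p - 2) + p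
    -- = p(p - 1).
    have h3 : ∑ j, (p * (p - 2) * F.sq e q ^ (p / 2 - 1 - 1) * A * F.mom e j q +
      p * F.sq e q ^ (p / 2 - 1) * ∑ i, u i * F.g e i j q.1 q.2) * q.2 j =
      p * (p - 2) * F.sq e q ^ (p / 2 - 1 - 1) * A * (∑ j, F.mom e j q * q.2 j) +
      p * F.sq e q ^ (p / 2 - 1) * ∑ j, (∑ i, u i * F.g e i j q.1 q.2) * q.2 j := by
      rw [Finset.mul_sum, Finset.mul_sum, ← Finset.sum_add_distrib]
      exact Finset.sum_congr rfl fun j _ => by ring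
    simp only [h1, zero_mul, Finset.sum_const_zero] at h3
    rw [F.sum_mom_mul_vel he hq, hAg] at h3
    rw [hpow] at h3 ⊢
    linarith
  have hA0 : A = 0 := by
    rcases mul_eq_zero.1 h2 with h | h
    · rcases mul_eq_zero.1 h with h | h
      · rcases mul_eq_zero.1 h with h | h
        · exact absurd h hp0
        · exact absurd (by linarith) hp1
      · exact absurd h hpos'.ne'
    · exact h
  have h4 : ∀ j, ∑ i, u i * F.g e i j q.1 q.2 = 0 := by
    intro j
    have := h1 j
    rw [hA0, mul_zero, zero_mul, zero_add] at this
    exact (mul_eq_zero.1 this).resolve_left (mul_ne_zero hp0 hpos'.ne')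
  refine (F.sum_g_pos he hq hne).ne' ?_
  rw [Finset.sum_comm]
  refine Finset.sum_eq_zero fun j _ => ?_
  rw [← mul_zero (u j), ← h4 j, Finset.mul_sum]
  exact Finset.sum_congr rfl fun i _ => by ring

end FinslerMetric

end Connection

end FinslerPEnergy

namespace FinslerPEnergy

/-! ### Geodesics and the Jacobi operator in a chart -/

theorem contDiffWithinAt_derivWithin {V : Type*} [NormedAddCommGroup V] [NormedSpace ℝ V]
    {f : ℝ → V} {s : Set ℝ} {t : ℝ} (hf : ContDiffWithinAt ℝ ∞ f s t) (hs : UniqueDiffOn ℝ s)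
    (ht : t ∈ s) : ContDiffWithinAt ℝ ∞ (derivWithin f s) s t := by
  have h : ContDiffWithinAt ℝ ∞ (fderivWithin ℝ f s) s t :=
    hf.fderivWithin_right hs (by simp) ht
  have h2 := h.clm_apply (contDiffWithinAt_const (c := (1 : ℝ)))
  exact h2

theorem _root_.ContDiffWithinAt.hasDerivWithinAt_derivWithin {V : Type*} [NormedAddCommGroup V]
    [NormedSpace ℝ V] {f : ℝ → V} {s : Set ℝ} {t : ℝ} (hf : ContDiffWithinAt ℝ ∞ f s t) :
    HasDerivWithinAt f (derivWithin f s t) s t :=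
  (hf.differentiableWithinAt (by simp)).hasDerivWithinAt

theorem hasDerivWithinAt_apply {n : ℕ} {f : ℝ → E n} {f' : E n} {s : Set ℝ} {t : ℝ}
    (hf : HasDerivWithinAt f f' s t) (i : Fin n) : HasDerivWithinAt (fun t => f t i) (f' i) s t :=
  (EuclideanSpace.proj i : E n →L[ℝ] ℝ).hasFDerivAt.comp_hasDerivWithinAt t hf

theorem uniqueDiffOn_unitInterval : UniqueDiffOn ℝ (Icc (0 : ℝ) 1) := uniqueDiffOn_Icc_zero_one

theorem dd_phase_eq {n : ℕ} {S : Set (E n × E n)} (f : E n × E n → ℝ) (u w : E n) (q : E n × E n) :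
    dd S (u, w) f q =
      ∑ k, u k * dd S (bx k) f q + ∑ k, w k * dd S (bY k) f q := by
  have : (u, w) = (u, 0) + ((0 : E n), w) := by simp
  rw [this, dd_add_dir, dd_left_eq_sum, dd_right_eq_sum]

section CurveInChart

variable {n : ℕ} {M : Type*} [TopologicalSpace M] [ChartedSpace (E n) M]
  [IsManifold (I n) ∞ M] {e : OpenPartialHomeomorph M (E n)}

theorem hasFDerivWithinAt_chart_comp (he : e ∈ atlas (E n) M) {X : Type*} [NormedAddCommGroup X]
    [NormedSpace ℝ X] {γ : X → M} {S : Set X} {q : X}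
    (hγ : MDifferentiableWithinAt 𝓘(ℝ, X) (I n) γ S q) (hq : γ q ∈ e.source) :
    HasFDerivWithinAt (fun q => e (γ q))
      ((mfderiv (I n) (I n) e (γ q)).comp (mfderivWithin 𝓘(ℝ, X) (I n) γ S q)) S q :=
  (((mdiff_chart he).mdifferentiableAt hq).hasMFDerivAt.comp_hasMFDerivWithinAt q
    hγ.hasMFDerivWithinAt).hasFDerivWithinAt

theorem dd_chart_comp (he : e ∈ atlas (E n) M) {X : Type*} [NormedAddCommGroup X]
    [NormedSpace ℝ X] {γ : X → M} {S : Set X} {q : X} (hS : UniqueDiffWithinAt ℝ S q)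
    (hγ : MDifferentiableWithinAt 𝓘(ℝ, X) (I n) γ S q) (hq : γ q ∈ e.source) (v : X) :
    dd S v (fun q => e (γ q)) q =
      mfderiv (I n) (I n) e (γ q) (mfderivWithin 𝓘(ℝ, X) (I n) γ S q v) := by
  have h : fderivWithin ℝ (fun q => e (γ q)) S q = ((mfderiv (I n) (I n) e (γ q)).comp
      (mfderivWithin 𝓘(ℝ, X) (I n) γ S q) : X →L[ℝ] E n) :=
    HasFDerivWithinAt.fderivWithin (hasFDerivWithinAt_chart_comp he hγ hq) hS
  exact DFunLike.congr_fun h v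

theorem derivWithin_chart_comp (he : e ∈ atlas (E n) M) {γ : ℝ → M} {S : Set ℝ} {t : ℝ}
    (hS : UniqueDiffWithinAt ℝ S t)
    (hγ : MDifferentiableWithinAt 𝓘(ℝ, ℝ) (I n) γ S t) (hq : γ t ∈ e.source) :
    derivWithin (fun q => e (γ q)) S t =
      mfderiv (I n) (I n) e (γ t) (mfderivWithin 𝓘(ℝ, ℝ) (I n) γ S t (1 : ℝ)) :=
  dd_chart_comp he hS hγ hq 1

theorem contDiffWithinAt_chart_comp (he : e ∈ atlas (E n) M) {X : Type*} [NormedAddCommGroup X]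
    [NormedSpace ℝ X] {γ : X → M} {S : Set X} {q : X}
    (hγ : ContMDiffWithinAt 𝓘(ℝ, X) (I n) ∞ γ S q) (hq : γ q ∈ e.source) :
    ContDiffWithinAt ℝ ∞ (fun q => e (γ q)) S q :=
  contMDiffWithinAt_iff_contDiffWithinAt.1
    ((contMDiffAt_of_mem_maximalAtlas (mem_maxAtlas he) hq).comp_contMDiffWithinAt q hγ)

theorem mfderiv_chart_ne_zero (he : e ∈ atlas (E n) M) {x : M} (hx : x ∈ e.source)
    {v : TangentSpace (I n) x} (hv : v ≠ 0) : mfderiv (I n) (I n) e x v ≠ 0 := fun h =>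
  hv ((mdiff_chart he).mfderiv_injective hx (h.trans (map_zero _).symm))

end CurveInChart

namespace FinslerMetric

variable {n : ℕ} {M : Type*} [TopologicalSpace M] [ChartedSpace (E n) M]
  [IsManifold (I n) ∞ M] {F : FinslerMetric n M} {e : OpenPartialHomeomorph M (E n)} {c : ℝ → M}
  {t : ℝ}

/-- The coordinates of the position and velocity of a curve. -/
def phase (e : OpenPartialHomeomorph M (E n)) (c : ℝ → M) (t : ℝ) : E n × E n :=
  (e (c t), coordVel e c t)

theorem IsGeodesic.eventually_mem (hc : F.IsGeodesic c) (ht : t ∈ Icc (0 : ℝ) 1)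
    (hs : c t ∈ e.source) : ∀ᶠ s in 𝓝[Icc 0 1] t, s ∈ Icc (0 : ℝ) 1 ∧ c s ∈ e.source :=
  Filter.Eventually.and self_mem_nhdsWithin
    ((hc.smooth.continuousOn t ht).eventually (e.open_source.mem_nhds hs))

theorem IsGeodesic.contDiffWithinAt_pos (hc : F.IsGeodesic c) (he : e ∈ atlas (E n) M)
    (ht : t ∈ Icc (0 : ℝ) 1) (hs : c t ∈ e.source) :
    ContDiffWithinAt ℝ ∞ (fun s => e (c s)) (Icc 0 1) t :=
  contDiffWithinAt_chart_comp he (hc.smooth t ht) hs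

theorem IsGeodesic.contDiffWithinAt_vel (hc : F.IsGeodesic c) (he : e ∈ atlas (E n) M)
    (ht : t ∈ Icc (0 : ℝ) 1) (hs : c t ∈ e.source) :
    ContDiffWithinAt ℝ ∞ (coordVel e c) (Icc 0 1) t :=
  contDiffWithinAt_derivWithin (hc.contDiffWithinAt_pos he ht hs) uniqueDiffOn_unitInterval ht

theorem IsGeodesic.contDiffWithinAt_phase (hc : F.IsGeodesic c) (he : e ∈ atlas (E n) M)
    (ht : t ∈ Icc (0 : ℝ) 1) (hs : c t ∈ e.source) :
    ContDiffWithinAt ℝ ∞ (phase e c) (Icc 0 1) t :=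
  (hc.contDiffWithinAt_pos he ht hs).prodMk (hc.contDiffWithinAt_vel he ht hs)

theorem IsGeodesic.phase_mem (hc : F.IsGeodesic c) (he : e ∈ atlas (E n) M)
    (ht : t ∈ Icc (0 : ℝ) 1) (hs : c t ∈ e.source) : phase e c t ∈ slit e := by
  refine ⟨e.map_source hs, ?_⟩
  have h := derivWithin_chart_comp he (uniqueDiffOn_unitInterval t ht)
    ((hc.smooth t ht).mdifferentiableWithinAt (by simp)) hs
  have h2 := mfderiv_chart_ne_zero he hs (hc.regular t ht)
  rw [← h] at h2
  exact h2

/-- Since y^m C^i_{mk} = 0, the vector w is arbitrary. Applied with the acceleration inside w, this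
shows that ∇ċ/dt = 0 is the explicit equation ẍ = -G. -/
theorem sum_vel_mul_conn (F : FinslerMetric n M) (he : e ∈ atlas (E n) M) (i : Fin n)
    (w : Fin n → ℝ) {q : E n × E n} (hq : q ∈ slit e) :
    ∑ m, q.2 m * (∑ k, F.L e i m k q.1 q.2 * q.2 k + ∑ k, F.C e i m k q.1 q.2 * w k) =
      F.spray e i q.1 q.2 := by
  have h2 : ∑ m, q.2 m * ∑ k, F.C e i m k q.1 q.2 * w k = 0 := by
    simp only [Finset.mul_sum]
    rw [Finset.sum_comm]
    refine Finset.sum_eq_zero fun k _ => ?_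
    rw [← zero_mul (w k), ← F.sum_vel_mul_C he i k hq, Finset.sum_mul]
    exact Finset.sum_congr rfl fun k _ => by ring
  simp only [F.sum_L_mul_vel he i _ hq, mul_add, Finset.sum_add_distrib]
  rw [h2, add_zero, ← F.sum_N_mul_vel he i hq]
  exact Finset.sum_congr rfl fun k _ => mul_comm _ _

theorem IsGeodesic.acc_eq (hc : F.IsGeodesic c) (he : e ∈ atlas (E n) M)
    (ht : t ∈ Icc (0 : ℝ) 1) (hs : c t ∈ e.source) (i : Fin n) :
    derivWithin (coordVel e c) (Icc 0 1) t i = -F.spray e i (e (c t)) (coordVel e c t) := by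
  have hq : (e (c t), coordVel e c t) ∈ slit e := hc.phase_mem he ht hs
  have h := congrArg (fun v : E n => v i) (hc.eq_zero e he t ht hs)
  simp only [covDeriv, PiLp.zero_apply] at h
  rw [F.sum_vel_mul_conn he i (fun k => derivWithin (coordVel e c) (Icc 0 1) t k +
    ∑ l, F.N e k l (e (c t)) (coordVel e c t) * coordVel e c t l) hq] at h
  linarith

/-- Along a geodesic the bracket ẍ^k + N^k_l ẋ^l multiplying C is zero, and L contracts with ẋ to N.
-/
theorem IsGeodesic.covDeriv_apply (hc : F.IsGeodesic c) (he : e ∈ atlas (E n) M)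
    (ht : t ∈ Icc (0 : ℝ) 1) (hs : c t ∈ e.source) (ξ : ℝ → E n) (i : Fin n) :
    F.covDeriv e c ξ t i = derivWithin ξ (Icc 0 1) t i +
      ∑ m, ξ t m * unc (F.N e i m) (phase e c t) := by
  have hq : (e (c t), coordVel e c t) ∈ slit e := hc.phase_mem he ht hs
  have h2 : ∀ k, derivWithin (coordVel e c) (Icc 0 1) t k +
      ∑ l, F.N e k l (e (c t)) (coordVel e c t) * coordVel e c t l = 0 := by
    intro k
    have h3 := F.sum_N_mul_vel he k hq
    dsimp only at h3
    rw [hc.acc_eq he ht hs, h3]; ring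
  have h1 : ∀ m, ∑ k, F.L e i m k (e (c t)) (coordVel e c t) * coordVel e c t k =
      F.N e i m (e (c t)) (coordVel e c t) := by
    intro m
    have h3 := F.sum_L_mul_vel he i m hq
    exact h3
  simp only [covDeriv, h1, h2, mul_zero, Finset.sum_const_zero, add_zero]
  rfl

/-- The derivative along a geodesic of a function of position and velocity. -/
theorem IsGeodesic.hasDerivWithinAt_comp_phase (hc : F.IsGeodesic c) (he : e ∈ atlas (E n) M)
    (ht : t ∈ Icc (0 : ℝ) 1) (hs : c t ∈ e.source) {f : E n × E n → ℝ}
    (hf : ContDiffOn ℝ ∞ f (slit e)) :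
    HasDerivWithinAt (fun t => f (phase e c t))
      (∑ k, (phase e c t).2 k * dd (slit e) (bx k) f (phase e c t) -
        ∑ k, F.spray e k (phase e c t).1 (phase e c t).2 * dd (slit e) (bY k) f (phase e c t))
      (Icc 0 1) t := by
  have h := hasDerivWithinAt_comp_curve hf isOpen_slit
    ((hc.contDiffWithinAt_pos he ht hs).hasDerivWithinAt_derivWithin.prodMk
      (hc.contDiffWithinAt_vel he ht hs).hasDerivWithinAt_derivWithin) (hc.phase_mem he ht hs)
  have h2 : (∑ k, (phase e c t).2 k * dd (slit e) (bx k) f (phase e c t) -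
      ∑ k, F.spray e k (phase e c t).1 (phase e c t).2 * dd (slit e) (bY k) f (phase e c t)) =
      dd (slit e) (derivWithin (fun s => e (c s)) (Icc 0 1) t,
        derivWithin (coordVel e c) (Icc 0 1) t) f (e (c t), coordVel e c t) := by
    rw [dd_phase_eq]
    simp only [hc.acc_eq he ht hs, neg_mul, Finset.sum_neg_distrib, ← sub_eq_add_neg]
    rfl
  rw [h2]
  exact h

/-- The left hand side of the Jacobi equation in a chart. -/
def jacobiOp (F : FinslerMetric n M) (e : OpenPartialHomeomorph M (E n)) (c : ℝ → M)
    (ξ : ℝ → E n) (t : ℝ) : E n :=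
  F.covDeriv e c (F.covDeriv e c ξ) t + F.curvTerm e c ξ t

/-- The Jacobi equation is the linearization of the geodesic equation. -/
theorem IsGeodesic.jacobiOp_apply (hc : F.IsGeodesic c) (he : e ∈ atlas (E n) M)
    (ht : t ∈ Icc (0 : ℝ) 1) (hs : c t ∈ e.source) {ξ : ℝ → E n}
    (hξ : ContDiffWithinAt ℝ ∞ ξ (Icc 0 1) t) (i : Fin n) :
    F.jacobiOp e c ξ t i = derivWithin (derivWithin ξ (Icc 0 1)) (Icc 0 1) t i +
      dd (slit e) (ξ t, derivWithin ξ (Icc 0 1) t) (unc (F.spray e i)) (phase e c t) := by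
  have hU := uniqueDiffOn_unitInterval t ht
  have hq := hc.phase_mem he ht hs
  have hξ' := contDiffWithinAt_derivWithin hξ uniqueDiffOn_unitInterval ht
  have hcov : ∀ i, HasDerivWithinAt (fun s => derivWithin ξ (Icc 0 1) s i +
      ∑ m, ξ s m * unc (F.N e i m) (phase e c s))
      (derivWithin (derivWithin ξ (Icc 0 1)) (Icc 0 1) t i +
        ∑ m, (derivWithin ξ (Icc 0 1) t m * unc (F.N e i m) (phase e c t) + ξ t m *
          (∑ k, (phase e c t).2 k * dd (slit e) (bx k) (unc (F.N e i m)) (phase e c t) -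
            ∑ k, F.spray e k (phase e c t).1 (phase e c t).2 *
              dd (slit e) (bY k) (unc (F.N e i m)) (phase e c t)))) (Icc 0 1) t := by
    intro i
    refine (hasDerivWithinAt_apply hξ'.hasDerivWithinAt_derivWithin i).add ?_
    refine HasDerivWithinAt.fun_sum fun m _ => ?_
    exact (hasDerivWithinAt_apply hξ.hasDerivWithinAt_derivWithin m).mul
      (hc.hasDerivWithinAt_comp_phase he ht hs (F.contDiffOn_N he i m))
  -- The outer covariant derivative needs the formula for the inner one at all nearby times in [0,
  -- 1], where the curve is still in the chart.
  have hev : ∀ᶠ s in 𝓝[Icc 0 1] t, F.covDeriv e c ξ s =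
      WithLp.toLp 2 fun i => derivWithin ξ (Icc 0 1) s i +
        ∑ m, ξ s m * unc (F.N e i m) (phase e c s) := by
    filter_upwards [hc.eventually_mem ht hs] with s hs'
    ext i
    exact hc.covDeriv_apply he hs'.1 hs'.2 ξ i
  have hdw : derivWithin (F.covDeriv e c ξ) (Icc 0 1) t i =
      derivWithin (derivWithin ξ (Icc 0 1)) (Icc 0 1) t i +
        ∑ m, (derivWithin ξ (Icc 0 1) t m * unc (F.N e i m) (phase e c t) + ξ t m *
          (∑ k, (phase e c t).2 k * dd (slit e) (bx k) (unc (F.N e i m)) (phase e c t) -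
            ∑ k, F.spray e k (phase e c t).1 (phase e c t).2 *
              dd (slit e) (bY k) (unc (F.N e i m)) (phase e c t))) := by
    have h1 : HasDerivWithinAt (fun s => (WithLp.toLp 2 fun i => derivWithin ξ (Icc 0 1) s i +
        ∑ m, ξ s m * unc (F.N e i m) (phase e c s) : E n)) (WithLp.toLp 2 fun i =>
          derivWithin (derivWithin ξ (Icc 0 1)) (Icc 0 1) t i +
        ∑ m, (derivWithin ξ (Icc 0 1) t m * unc (F.N e i m) (phase e c t) + ξ t m *
          (∑ k, (phase e c t).2 k * dd (slit e) (bx k) (unc (F.N e i m)) (phase e c t) -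
            ∑ k, F.spray e k (phase e c t).1 (phase e c t).2 *
              dd (slit e) (bY k) (unc (F.N e i m)) (phase e c t)))) (Icc 0 1) t :=
      (PiLp.continuousLinearEquiv 2 ℝ (fun _ : Fin n => ℝ)).symm.hasFDerivAt.comp_hasDerivWithinAt
        t (hasDerivWithinAt_pi.2 hcov)
    rw [(h1.congr_of_eventuallyEq hev (hev.self_of_nhdsWithin ht)).derivWithin hU]
  unfold jacobiOp
  rw [PiLp.add_apply, hc.covDeriv_apply he ht hs, hdw]
  have hcurv : F.curvTerm e c ξ t i = ∑ k, ξ t k *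
      ∑ j, F.R e i j k (phase e c t).1 (phase e c t).2 * (phase e c t).2 j := by
    simp only [curvTerm, Finset.mul_sum]
    rw [Finset.sum_comm]
    exact Finset.sum_congr rfl fun k _ => Finset.sum_congr rfl fun j _ => by
      simp only [phase]; ring
  rw [hcurv, dd_phase_eq]
  -- ∇∇ξ is ξ'' + 2Nξ' + (dN/dt)ξ + NNξ, and the curvature term is (∂G/∂x)ξ - NNξ - (dN/dt)ξ. The
  -- sum is ξ'' + 2Nξ' + (∂G/∂x)ξ, where 2N = ∂G/∂y.
  simp only [F.sum_R_mul_vel he _ _ hq, F.ddY_spray he _ _ hq, hc.covDeriv_apply he ht hs]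
  have h6 : ∑ m, (derivWithin ξ (Icc 0 1) t m + ∑ k, ξ t k * unc (F.N e m k) (phase e c t)) *
      unc (F.N e i m) (phase e c t) =
      ∑ m, derivWithin ξ (Icc 0 1) t m * unc (F.N e i m) (phase e c t) +
      ∑ k, ξ t k * ∑ l, F.N e i l (phase e c t).1 (phase e c t).2 *
        F.N e l k (phase e c t).1 (phase e c t).2 := by
    simp only [add_mul, Finset.sum_add_distrib, Finset.sum_mul, Finset.mul_sum]
    congr 1
    rw [Finset.sum_comm]
    exact Finset.sum_congr rfl fun k _ => Finset.sum_congr rfl fun j _ => by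
      simp only [unc]; ring
  rw [h6]
  have h7 : ∑ k, derivWithin ξ (Icc 0 1) t k * (2 * F.N e i k (phase e c t).1 (phase e c t).2) =
      ∑ m, derivWithin ξ (Icc 0 1) t m * unc (F.N e i m) (phase e c t) +
      ∑ m, derivWithin ξ (Icc 0 1) t m * unc (F.N e i m) (phase e c t) := by
    rw [← Finset.sum_add_distrib]
    exact Finset.sum_congr rfl fun k _ => by simp only [unc]; ring
  rw [h7]
  simp only [mul_sub, Finset.sum_add_distrib, Finset.sum_sub_distrib]
  ring

end FinslerMetric

end FinslerPEnergy

namespace FinslerPEnergy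

/-! ### Differentiation of parametric integrals over an interval -/

theorem hasDerivWithinAt_slice {X V : Type*} [NormedAddCommGroup X] [NormedSpace ℝ X]
    [NormedAddCommGroup V] [NormedSpace ℝ V] {S : Set X} {f : X → V} (hf : ContDiffOn ℝ ∞ f S)
    {l : ℝ → X} {v : X} {T : Set ℝ} {r : ℝ} (hl : HasDerivWithinAt l v T r) (hT : MapsTo l T S)
    (hr : r ∈ T) : HasDerivWithinAt (fun r => f (l r)) (dd S v f (l r)) T r :=
  (diffAt hf (hT hr)).hasFDerivWithinAt.comp_hasDerivWithinAt r hl hT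

/-- The directions of the three variables `s₁`, `s₂`, `t`. -/
abbrev d1 : ℝ × ℝ × ℝ := (1, 0, 0)
/-- The direction of `s₂`. -/
abbrev d2 : ℝ × ℝ × ℝ := (0, 1, 0)
/-- The direction of `t`. -/
abbrev d3 : ℝ × ℝ × ℝ := (0, 0, 1)

theorem hasDerivWithinAt_line1 (s₂ t : ℝ) (T : Set ℝ) (r : ℝ) :
    HasDerivWithinAt (fun s : ℝ => ((s, s₂, t) : ℝ × ℝ × ℝ)) d1 T r :=
  (hasDerivWithinAt_id _ _).prodMk (hasDerivWithinAt_const _ _ _)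

theorem hasDerivWithinAt_line2 (s₁ t : ℝ) (T : Set ℝ) (r : ℝ) :
    HasDerivWithinAt (fun s : ℝ => ((s₁, s, t) : ℝ × ℝ × ℝ)) d2 T r :=
  (hasDerivWithinAt_const _ _ _).prodMk
    ((hasDerivWithinAt_id _ _).prodMk (hasDerivWithinAt_const _ _ _))

theorem hasDerivWithinAt_line3 (s₁ s₂ : ℝ) (T : Set ℝ) (r : ℝ) :
    HasDerivWithinAt (fun t : ℝ => ((s₁, s₂, t) : ℝ × ℝ × ℝ)) d3 T r :=
  (hasDerivWithinAt_const _ _ _).prodMk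
    ((hasDerivWithinAt_const _ _ _).prodMk (hasDerivWithinAt_id _ _))

/-- The triples `(s₁, s₂, t)` with `t ∈ [a, b]`. -/
def slab (a b : ℝ) : Set (ℝ × ℝ × ℝ) := {q | q.2.2 ∈ Icc a b}

theorem slab_eq (a b : ℝ) : slab a b = univ ×ˢ univ ×ˢ Icc a b := by
  ext q; simp [slab]

theorem niceDomain_slab {a b : ℝ} (hab : a < b) : NiceDomain (slab a b) := by
  rw [slab_eq]
  refine ⟨uniqueDiffOn_univ.prod (uniqueDiffOn_univ.prod (uniqueDiffOn_Icc hab)), ?_⟩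
  rw [interior_prod_eq, interior_univ, interior_prod_eq, interior_univ, interior_Icc,
    closure_prod_eq, closure_univ, closure_prod_eq, closure_univ, closure_Ioo hab.ne]

/-- The box of parameters of size `δ`. -/
def box (δ : ℝ) : Set (ℝ × ℝ × ℝ) := Ioo (-δ) δ ×ˢ Ioo (-δ) δ ×ˢ univ

theorem isOpen_box (δ : ℝ) : IsOpen (box δ) := isOpen_Ioo.prod (isOpen_Ioo.prod isOpen_univ)

/-- Tube lemma: compactness of [a, b] gives one size of (s₁, s₂) for all times. -/
theorem exists_box_of_eventually {a b : ℝ} {P : ℝ × ℝ × ℝ → Prop}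
    (h : ∀ t ∈ Icc a b, ∀ᶠ q in 𝓝 ((0 : ℝ), (0 : ℝ), t), P q) :
    ∃ δ > 0, ∀ q ∈ slab a b ∩ box δ, P q := by
  have h1 : ∀ᶠ z in 𝓝 ((0 : ℝ), (0 : ℝ)), ∀ t ∈ Icc a b, P (z.1, z.2, t) := by
    refine isCompact_Icc.eventually_forall_of_forall_eventually fun t ht => ?_
    have hc : Tendsto (fun w : (ℝ × ℝ) × ℝ => (w.1.1, w.1.2, w.2)) (𝓝 (((0 : ℝ), (0 : ℝ)), t))
        (𝓝 ((0 : ℝ), (0 : ℝ), t)) := by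
      have : Continuous (fun w : (ℝ × ℝ) × ℝ => (w.1.1, w.1.2, w.2)) := by fun_prop
      exact this.tendsto _
    exact hc.eventually (h t ht)
  obtain ⟨δ, hδ, hball⟩ := Metric.eventually_nhds_iff.1 h1
  refine ⟨δ, hδ, fun q hq => hball (y := (q.1, q.2.1)) ?_ q.2.2 hq.1⟩
  rw [Prod.dist_eq, max_lt_iff, Real.dist_0_eq_abs, Real.dist_0_eq_abs]
  exact ⟨abs_lt.2 hq.2.1, abs_lt.2 hq.2.2.1⟩

/-- `f` is smooth on the slab near `s₁ = s₂ = 0`. -/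
def SmoothNear (a b : ℝ) (f : ℝ × ℝ × ℝ → ℝ) : Prop :=
  ∀ t ∈ Icc a b, ∃ W, IsOpen W ∧ ((0 : ℝ), (0 : ℝ), t) ∈ W ∧ ContDiffOn ℝ ∞ f (slab a b ∩ W)

theorem SmoothNear.exists_box {a b : ℝ} {f : ℝ × ℝ × ℝ → ℝ} (hf : SmoothNear a b f) :
    ∃ δ > 0, ContDiffOn ℝ ∞ f (slab a b ∩ box δ) := by
  obtain ⟨δ, hδ, h⟩ := exists_box_of_eventually (a := a) (b := b)
    (P := fun q => q ∈ slab a b → ContDiffWithinAt ℝ ∞ f (slab a b) q) (by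
      intro t ht
      obtain ⟨W, hW, hm, hfW⟩ := hf t ht
      filter_upwards [hW.mem_nhds hm] with q hq hqs
      exact (contDiffWithinAt_inter (hW.mem_nhds hq)).1 (hfW q ⟨hqs, hq⟩))
  exact ⟨δ, hδ, fun q hq => (h q hq hq.1).mono inter_subset_left⟩

theorem hasDerivAt_integral_param {g g' : ℝ → ℝ → ℝ} {δ a b : ℝ} (hδ : 0 < δ) (hab : a ≤ b)
    (hg : ContinuousOn (Function.uncurry g) (Ioo (-δ) δ ×ˢ Icc a b))
    (hg' : ContinuousOn (Function.uncurry g') (Ioo (-δ) δ ×ˢ Icc a b))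
    (hd : ∀ s ∈ Ioo (-δ) δ, ∀ t ∈ Icc a b, HasDerivAt (fun s => g s t) (g' s t) s) :
    HasDerivAt (fun s => ∫ t in a..b, g s t) (∫ t in a..b, g' 0 t) 0 := by
  -- Half the parameter interval, so that the continuous derivative is bounded on a compact set;
  -- this constant dominates.
  have hK : IsCompact (Icc (-(δ / 2)) (δ / 2) ×ˢ Icc a b) := isCompact_Icc.prod isCompact_Icc
  have hsub : Icc (-(δ / 2)) (δ / 2) ⊆ Ioo (-δ) δ := fun s hs =>
    ⟨by linarith [hs.1], by linarith [hs.2]⟩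
  obtain ⟨K, hKb⟩ := hK.exists_bound_of_continuousOn (hg'.mono (prod_mono_left hsub))
  have hslice : ∀ {h : ℝ → ℝ → ℝ}, ContinuousOn (Function.uncurry h) (Ioo (-δ) δ ×ˢ Icc a b) →
      ∀ s ∈ Ioo (-δ) δ, ContinuousOn (h s) (Icc a b) := fun hh s hs =>
    hh.comp (f := fun t => (s, t)) (by fun_prop) fun t ht => ⟨hs, ht⟩
  have hmeas : ∀ {h : ℝ → ℝ → ℝ}, ContinuousOn (Function.uncurry h) (Ioo (-δ) δ ×ˢ Icc a b) →
      ∀ s ∈ Ioo (-δ) δ, IntervalIntegrable (h s) MeasureTheory.volume a b := fun hh s hs =>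
    ContinuousOn.intervalIntegrable (by rw [uIcc_of_le hab]; exact hslice hh s hs)
  have h0 : (0 : ℝ) ∈ Ioo (-δ) δ := ⟨by linarith, hδ⟩
  have hIoc : ∀ t ∈ uIoc a b, t ∈ Icc a b := fun t ht => by
    rw [uIoc_of_le hab] at ht; exact Ioc_subset_Icc_self ht
  have hnhds : Icc (-(δ / 2)) (δ / 2) ∈ 𝓝 (0 : ℝ) := Icc_mem_nhds (by linarith) (by linarith)
  refine (intervalIntegral.hasDerivAt_integral_of_dominated_loc_of_deriv_le
    (F := g) (F' := g') (bound := fun _ => K) hnhds ?_ (hmeas hg 0 h0) ?_ ?_ ?_ ?_).2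
  · filter_upwards [Ioo_mem_nhds h0.1 h0.2] with s hs
    exact (hmeas hg s hs).aestronglyMeasurable_restrict_uIoc
  · exact (hmeas hg' 0 h0).aestronglyMeasurable_restrict_uIoc
  · exact Eventually.of_forall fun t ht s hs => hKb (s, t) ⟨hs, hIoc t ht⟩
  · exact intervalIntegrable_const
  · exact Eventually.of_forall fun t ht s hs => hd s (hsub hs) t (hIoc t ht)

/-- Integration by parts for an arbitrary θ: ∂f/∂s₂ = ∂θ/∂t - Z, where ∂θ/∂t integrates to boundary
values, and then both parts are differentiated in s₁. In the application f is the Lagrangian and θ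
its fibre derivative paired with the variation field, so that Z is the Euler-Lagrange expression. -/
theorem hasMixedDerivAtZero_integral {a b : ℝ} (hab : a < b) {f θ : ℝ × ℝ × ℝ → ℝ}
    (hf : SmoothNear a b f) (hθ : SmoothNear a b θ) :
    HasMixedDerivAtZero (fun s₁ s₂ => ∫ t in a..b, f (s₁, s₂, t))
      (dd (slab a b) d1 θ (0, 0, b) - dd (slab a b) d1 θ (0, 0, a) -
        ∫ t in a..b, dd (slab a b) d1
          (fun q => dd (slab a b) d3 θ q - dd (slab a b) d2 f q) (0, 0, t)) := by
  obtain ⟨δ₁, hδ₁, hf₁⟩ := hf.exists_box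
  obtain ⟨δ₂, hδ₂, hθ₂⟩ := hθ.exists_box
  set δ := min δ₁ δ₂ with hδdef
  have hδ : 0 < δ := lt_min hδ₁ hδ₂
  have hbox : ∀ {η}, δ ≤ η → box δ ⊆ box η := fun h =>
    prod_mono (Ioo_subset_Ioo (neg_le_neg h) h) (prod_mono_left (Ioo_subset_Ioo (neg_le_neg h) h))
  set S := slab a b with hSdef
  set V := S ∩ box δ with hV
  have hf : ContDiffOn ℝ ∞ f V := hf₁.mono (inter_subset_inter_right _ (hbox (min_le_left _ _)))
  have hθ : ContDiffOn ℝ ∞ θ V :=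
    hθ₂.mono (inter_subset_inter_right _ (hbox (min_le_right _ _)))
  have hVn : NiceDomain V := (niceDomain_slab hab).inter_open (isOpen_box δ)
  have hmem : ∀ s₁ ∈ Ioo (-δ) δ, ∀ s₂ ∈ Ioo (-δ) δ, ∀ t ∈ Icc a b, (s₁, s₂, t) ∈ V :=
    fun s₁ h1 s₂ h2 t ht => ⟨ht, h1, h2, mem_univ _⟩
  have h0 : (0 : ℝ) ∈ Ioo (-δ) δ := ⟨by linarith, hδ⟩
  have hev0 : ∀ᶠ s in 𝓝 (0 : ℝ), s ∈ Ioo (-δ) δ := Ioo_mem_nhds h0.1 h0.2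
  have hcont2 : ∀ {h : ℝ × ℝ × ℝ → ℝ}, ContDiffOn ℝ ∞ h V → ∀ s₁ ∈ Ioo (-δ) δ,
      ContinuousOn (Function.uncurry fun s₂ t => h (s₁, s₂, t)) (Ioo (-δ) δ ×ˢ Icc a b) :=
    fun hh s₁ h1 => hh.continuousOn.comp (f := fun z : ℝ × ℝ => (s₁, z.1, z.2)) (by fun_prop)
      fun z hz => hmem s₁ h1 z.1 hz.1 z.2 hz.2
  have hcont1 : ∀ {h : ℝ × ℝ × ℝ → ℝ}, ContDiffOn ℝ ∞ h V →
      ContinuousOn (Function.uncurry fun s₁ t => h (s₁, 0, t)) (Ioo (-δ) δ ×ˢ Icc a b) :=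
    fun hh => hh.continuousOn.comp (f := fun z : ℝ × ℝ => (z.1, 0, z.2)) (by fun_prop)
      fun z hz => hmem z.1 hz.1 0 h0 z.2 hz.2
  have hslice1 : ∀ {h : ℝ × ℝ × ℝ → ℝ}, ContDiffOn ℝ ∞ h V → ∀ s₁ ∈ Ioo (-δ) δ, ∀ t ∈ Icc a b,
      HasDerivAt (fun s => h (s, 0, t)) (dd V d1 h (s₁, 0, t)) s₁ := fun hh s₁ h1 t ht =>
    (hasDerivWithinAt_slice hh (hasDerivWithinAt_line1 0 t _ s₁)
      (fun s hs => hmem s hs 0 h0 t ht) h1).hasDerivAt (Ioo_mem_nhds h1.1 h1.2)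
  have hθ3 : ContDiffOn ℝ ∞ (dd V d3 θ) V := hθ.dd hVn _
  have hf2 : ContDiffOn ℝ ∞ (dd V d2 f) V := hf.dd hVn _
  set Z : ℝ × ℝ × ℝ → ℝ := fun q => dd V d3 θ q - dd V d2 f q with hZ
  have hZs : ContDiffOn ℝ ∞ Z V := hθ3.sub hf2
  -- the first variation
  have hfirst : ∀ s₁ ∈ Ioo (-δ) δ, HasDerivAt (fun s₂ => ∫ t in a..b, f (s₁, s₂, t))
      (∫ t in a..b, dd V d2 f (s₁, 0, t)) 0 := fun s₁ h1 =>
    hasDerivAt_integral_param hδ hab.le (hcont2 hf s₁ h1)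
      (g' := fun s₂ t => dd V d2 f (s₁, s₂, t)) (hcont2 hf2 s₁ h1) fun s₂ h2 t ht =>
        (hasDerivWithinAt_slice hf (hasDerivWithinAt_line2 s₁ t _ s₂)
          (fun s hs => hmem s₁ h1 s hs t ht) h2).hasDerivAt (Ioo_mem_nhds h2.1 h2.2)
  have hint : ∀ {h : ℝ × ℝ × ℝ → ℝ}, ContDiffOn ℝ ∞ h V → ∀ s₁ ∈ Ioo (-δ) δ,
      ContinuousOn (fun t => h (s₁, 0, t)) (Icc a b) := fun hh s₁ h1 =>
    hh.continuousOn.comp (f := fun t => (s₁, 0, t)) (by fun_prop)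
      fun t ht => hmem s₁ h1 0 h0 t ht
  have hII : ∀ {h : ℝ × ℝ × ℝ → ℝ}, ContDiffOn ℝ ∞ h V → ∀ s₁ ∈ Ioo (-δ) δ,
      IntervalIntegrable (fun t => h (s₁, 0, t)) MeasureTheory.volume a b := fun hh s₁ h1 =>
    ContinuousOn.intervalIntegrable (by rw [uIcc_of_le hab.le]; exact hint hh s₁ h1)
  have hsecond : ∀ s₁ ∈ Ioo (-δ) δ, ∫ t in a..b, dd V d2 f (s₁, 0, t) =
      θ (s₁, 0, b) - θ (s₁, 0, a) - ∫ t in a..b, Z (s₁, 0, t) := by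
    intro s₁ h1
    have hftc : ∫ t in a..b, dd V d3 θ (s₁, 0, t) = θ (s₁, 0, b) - θ (s₁, 0, a) :=
      intervalIntegral.integral_eq_sub_of_hasDerivAt_of_le hab.le (hint hθ s₁ h1)
        (fun t ht => (hasDerivWithinAt_slice hθ (hasDerivWithinAt_line3 s₁ 0 (Icc a b) t)
          (fun t ht => hmem s₁ h1 0 h0 t ht) (Ioo_subset_Icc_self ht)).hasDerivAt
            (Icc_mem_nhds ht.1 ht.2)) (hII hθ3 s₁ h1)
    rw [← hftc, ← intervalIntegral.integral_sub (hII hθ3 s₁ h1) (hII hZs s₁ h1)]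
    simp [hZ]
  refine ⟨fun s₁ => ∫ t in a..b, dd V d2 f (s₁, 0, t), hev0.mono hfirst, ?_⟩
  have hgoal : HasDerivAt (fun s₁ => θ (s₁, 0, b) - θ (s₁, 0, a) - ∫ t in a..b, Z (s₁, 0, t))
      (dd V d1 θ (0, 0, b) - dd V d1 θ (0, 0, a) - ∫ t in a..b, dd V d1 Z (0, 0, t)) 0 :=
    ((hslice1 hθ 0 h0 b (right_mem_Icc.2 hab.le)).sub
      (hslice1 hθ 0 h0 a (left_mem_Icc.2 hab.le))).sub
      (hasDerivAt_integral_param hδ hab.le (hcont1 hZs)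
        (g' := fun s₁ t => dd V d1 Z (s₁, 0, t)) (hcont1 (hZs.dd hVn _)) (hslice1 hZs))
  have hbox0 : ∀ t, ((0 : ℝ), (0 : ℝ), t) ∈ box δ := fun t => ⟨h0, h0, mem_univ _⟩
  -- Derivatives within the box agree with those within the slab, so the value does not depend on
  -- the size δ.
  have hZ' : ∀ t ∈ Icc a b, dd V d1 Z (0, 0, t) =
      dd S d1 (fun q => dd S d3 θ q - dd S d2 f q) (0, 0, t) := by
    intro t ht
    have hEq : EqOn Z (fun q => dd S d3 θ q - dd S d2 f q) V := fun q hq => by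
      simp only [hZ, hV, dd_inter_open (isOpen_box δ) hq.2]
    exact (dd_congr hEq (hmem 0 h0 0 h0 t ht)).trans (dd_inter_open (isOpen_box δ) (hbox0 t))
  rw [intervalIntegral.integral_congr (g := fun t => dd V d1 Z (0, 0, t)) (fun t ht => by
    rw [uIcc_of_le hab.le] at ht; exact (hZ' t ht).symm)]
  rw [← dd_inter_open (isOpen_box δ) (hbox0 b), ← dd_inter_open (isOpen_box δ) (hbox0 a)]
  exact hgoal.congr_of_eventuallyEq (hev0.mono hsecond)

theorem HasMixedDerivAtZero.congr {f g : ℝ → ℝ → ℝ} {r : ℝ} (hf : HasMixedDerivAtZero f r)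
    (h : ∀ᶠ z in 𝓝 ((0 : ℝ), (0 : ℝ)), g z.1 z.2 = f z.1 z.2) : HasMixedDerivAtZero g r := by
  obtain ⟨D, hD, hr⟩ := hf
  refine ⟨D, ?_, hr⟩
  filter_upwards [hD, h.curry_nhds] with s hs hs2
  exact hs.congr_of_eventuallyEq hs2

theorem HasMixedDerivAtZero.sum {ι : Type*} {s : Finset ι} {f : ι → ℝ → ℝ → ℝ} {r : ι → ℝ}
    (hf : ∀ i ∈ s, HasMixedDerivAtZero (f i) (r i)) :
    HasMixedDerivAtZero (fun s₁ s₂ => ∑ i ∈ s, f i s₁ s₂) (∑ i ∈ s, r i) := by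
  choose! D hD hr using hf
  refine ⟨fun s₁ => ∑ i ∈ s, D i s₁, ?_, HasDerivAt.fun_sum hr⟩
  have : ∀ᶠ s₁ in 𝓝 (0 : ℝ), ∀ i ∈ s, HasDerivAt (fun s₂ => f i s₁ s₂) (D i s₁) 0 :=
    (Filter.eventually_all_finset s).2 hD
  filter_upwards [this] with s₁ hs
  exact HasDerivAt.fun_sum hs

theorem HasMixedDerivAtZero.unique {f : ℝ → ℝ → ℝ} {r r' : ℝ} (h : HasMixedDerivAtZero f r)
    (h' : HasMixedDerivAtZero f r') : r = r' := by
  obtain ⟨D, hD, hr⟩ := h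
  obtain ⟨D', hD', hr'⟩ := h'
  refine hr.unique (hr'.congr_of_eventuallyEq ?_)
  filter_upwards [hD, hD'] with s h1 h2
  exact h1.unique h2

end FinslerPEnergy

namespace FinslerPEnergy

/-! ### The Euler-Lagrange expression of a variation in a chart -/

theorem dd_apply {X : Type*} [NormedAddCommGroup X] [NormedSpace ℝ X] {n : ℕ} {S : Set X} {q v : X}
    {f : X → E n} (hS : NiceDomain S) (hf : ContDiffOn ℝ ∞ f S) (hq : q ∈ S) (i : Fin n) :
    dd S v (fun q => f q i) q = dd S v f q i :=
  dd_clm_comp hS hf hq (EuclideanSpace.proj i : E n →L[ℝ] ℝ)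

theorem dd_prodMk {X V W : Type*} [NormedAddCommGroup X] [NormedSpace ℝ X] [NormedAddCommGroup V]
    [NormedSpace ℝ V] [NormedAddCommGroup W] [NormedSpace ℝ W] {S : Set X} {q v : X}
    {f : X → V} {g : X → W} (hS : NiceDomain S) (hf : ContDiffOn ℝ ∞ f S)
    (hg : ContDiffOn ℝ ∞ g S) (hq : q ∈ S) :
    dd S v (fun q => (f q, g q)) q = (dd S v f q, dd S v g q) := by
  unfold dd
  rw [((diffAt hf hq).hasFDerivWithinAt.prodMk (diffAt hg hq).hasFDerivWithinAt).fderivWithin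
    (hS.uniqueDiffOn q hq)]
  rfl

theorem _root_.ContDiffOn.coord {X : Type*} [NormedAddCommGroup X] [NormedSpace ℝ X] {n : ℕ}
    {S : Set X} {f : X → E n} (hf : ContDiffOn ℝ ∞ f S) (i : Fin n) :
    ContDiffOn ℝ ∞ (fun q => f q i) S :=
  (EuclideanSpace.proj i : E n →L[ℝ] ℝ).contDiff.comp_contDiffOn hf

section RegularFamily

variable {n : ℕ} {M : Type*} [TopologicalSpace M] {e : OpenPartialHomeomorph M (E n)}
  {O : Set (ℝ × ℝ × ℝ)} {x : ℝ × ℝ × ℝ → E n}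

/-- A smooth family of regular curves in a chart. -/
structure RegularFamily (e : OpenPartialHomeomorph M (E n)) (O : Set (ℝ × ℝ × ℝ))
    (x : ℝ × ℝ × ℝ → E n) : Prop where
  nice : NiceDomain O
  smooth : ContDiffOn ℝ ∞ x O
  mem : ∀ q ∈ O, (x q, dd O d3 x q) ∈ slit e

theorem RegularFamily.smooth_dd (h : RegularFamily e O x) (v : ℝ × ℝ × ℝ) :
    ContDiffOn ℝ ∞ (dd O v x) O := h.smooth.dd h.nice v

theorem RegularFamily.phase (h : RegularFamily e O x) :
    ContDiffOn ℝ ∞ (fun q => (x q, dd O d3 x q)) O := h.smooth.prodMk (h.smooth_dd d3)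

theorem RegularFamily.comp (h : RegularFamily e O x) {f : E n × E n → ℝ}
    (hf : ContDiffOn ℝ ∞ f (slit e)) :
    ContDiffOn ℝ ∞ (fun q => f (x q, dd O d3 x q)) O :=
  hf.comp h.phase h.mem

theorem RegularFamily.dd_comp_phase (h : RegularFamily e O x) {f : E n × E n → ℝ}
    (hf : ContDiffOn ℝ ∞ f (slit e)) {q : ℝ × ℝ × ℝ} (hq : q ∈ O) (v : ℝ × ℝ × ℝ) :
    dd O v (fun q => f (x q, dd O d3 x q)) q =
      dd (slit e) (dd O v x q,
        dd O v (dd O d3 x) q) f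
        (x q, dd O d3 x q) := by
  rw [dd_comp h.nice hf h.phase h.mem hq, dd_prodMk h.nice h.smooth (h.smooth_dd d3) hq]

end RegularFamily

namespace FinslerMetric

variable {n : ℕ} {M : Type*} [TopologicalSpace M] [ChartedSpace (E n) M]
  [IsManifold (I n) ∞ M] (F : FinslerMetric n M) {e : OpenPartialHomeomorph M (E n)}
  {O : Set (ℝ × ℝ × ℝ)} {x : ℝ × ℝ × ℝ → E n}

/-- The fibre derivative of the Lagrangian in the direction of the variation field. -/
def pairing (F : FinslerMetric n M) (e : OpenPartialHomeomorph M (E n)) (p : ℝ)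
    (O : Set (ℝ × ℝ × ℝ)) (x : ℝ × ℝ × ℝ → E n) (q : ℝ × ℝ × ℝ) : ℝ :=
  ∑ j, dd O d2 x q j *
    dd (slit e) (bY j) (F.lag e p) (x q, dd O d3 x q)

theorem contDiffOn_ddY_lag (he : e ∈ atlas (E n) M) (p : ℝ) (j : Fin n) :
    ContDiffOn ℝ ∞ (dd (slit e) (bY j) (F.lag e p)) (slit e) :=
  (F.contDiffOn_lag he p).dd isOpen_slit.niceDomain _

theorem contDiffOn_pairing (he : e ∈ atlas (E n) M) (p : ℝ) (h : RegularFamily e O x) :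
    ContDiffOn ℝ ∞ (F.pairing e p O x) O :=
  ContDiffOn.sum fun j _ => ((h.smooth_dd d2).coord j).mul (h.comp (F.contDiffOn_ddY_lag he p j))

theorem dd_pairing (he : e ∈ atlas (E n) M) (p : ℝ) (h : RegularFamily e O x)
    {q : ℝ × ℝ × ℝ} (hq : q ∈ O) (v : ℝ × ℝ × ℝ) :
    dd O v (F.pairing e p O x) q = ∑ j,
      (dd O v (dd O d2 x) q j *
        dd (slit e) (bY j) (F.lag e p) (x q, dd O d3 x q) +
      dd O d2 x q j * dd (slit e)
        (dd O v x q, dd O v (dd O d3 x) q)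
        (dd (slit e) (bY j) (F.lag e p)) (x q, dd O d3 x q)) := by
  have hL := F.contDiffOn_ddY_lag he p
  unfold pairing
  rw [dd_sum h.nice (fun j _ => ((h.smooth_dd d2).coord j).mul (h.comp (hL j))) hq]
  refine Finset.sum_congr rfl fun j _ => ?_
  rw [dd_mul h.nice ((h.smooth_dd d2).coord j) (h.comp (hL j)) hq, dd_apply h.nice (h.smooth_dd d2) hq,
    h.dd_comp_phase (hL j) hq]

/-- The Euler-Lagrange expression of the family `x`, paired with the variation field. -/
theorem dd_pairing_sub_dd_lag (he : e ∈ atlas (E n) M) (p : ℝ) (h : RegularFamily e O x)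
    {q : ℝ × ℝ × ℝ} (hq : q ∈ O) :
    dd O d3 (F.pairing e p O x) q -
      dd O d2 (fun q => F.lag e p (x q, dd O d3 x q)) q =
      ∑ j, ∑ i, F.lagHess e p i j (x q, dd O d3 x q) *
        (dd O d3 (dd O d3 x) q i +
          unc (F.spray e i) (x q, dd O d3 x q)) *
        dd O d2 x q j := by
  rw [F.dd_pairing he p h hq, h.dd_comp_phase (F.contDiffOn_lag he p) hq, dd_phase_eq,
    ← Finset.sum_add_distrib, ← Finset.sum_sub_distrib]
  refine Finset.sum_congr rfl fun j _ => ?_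
  have hel := F.euler_lagrange_spray he p j (h.mem q hq)
  -- Once ∂/∂t and ∂/∂s₂ are exchanged, the terms ∂L/∂y^j ∂²x^j/∂t∂s₂ of the two sides cancel;
  -- `euler_lagrange_spray` treats the others.
  rw [dd_comm h.smooth h.nice hq d3 d2, dd_phase_eq (dd (slit e) (bY j) (F.lag e p)) (dd O d3 x q)]
  have h2 : ∑ i, F.lagHess e p i j (x q, dd O d3 x q) *
        (dd O d3 (dd O d3 x) q i +
          unc (F.spray e i) (x q, dd O d3 x q)) *
        dd O d2 x q j =
      dd O d2 x q j * (∑ i, dd O d3 (dd O d3 x) q i *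
          F.lagHess e p i j (x q, dd O d3 x q) +
        ∑ i, F.spray e i (x q) (dd O d3 x q) *
          F.lagHess e p i j (x q, dd O d3 x q)) := by
    rw [← Finset.sum_add_distrib, Finset.mul_sum]
    exact Finset.sum_congr rfl fun i _ => by simp only [unc]; ring
  dsimp only at hel
  rw [h2, ← hel]
  simp only [lagHess]
  ring

/-- The linearization of the Euler-Lagrange expression at a geodesic. -/
theorem dd_euler_lagrange (he : e ∈ atlas (E n) M) (p : ℝ) (h : RegularFamily e O x)
    {q : ℝ × ℝ × ℝ} (hq : q ∈ O)
    (hgeo : ∀ i, dd O d3 (dd O d3 x) q i +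
      unc (F.spray e i) (x q, dd O d3 x q) = 0) :
    dd O d1 (fun q => dd O d3 (F.pairing e p O x) q -
      dd O d2 (fun q => F.lag e p (x q, dd O d3 x q)) q) q =
      ∑ j, ∑ i, F.lagHess e p i j (x q, dd O d3 x q) *
        (dd O d3 (dd O d3 (dd O d1 x)) q i +
          dd (slit e) (dd O d1 x q,
            dd O d3 (dd O d1 x) q)
            (unc (F.spray e i)) (x q, dd O d3 x q)) *
        dd O d2 x q j := by
  have h33 : ContDiffOn ℝ ∞ (dd O d3 (dd O d3 x)) O :=
    (h.smooth_dd d3).dd h.nice _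
  have hS : ∀ i, ContDiffOn ℝ ∞ (fun q => dd O d3 (dd O d3 x) q i +
      unc (F.spray e i) (x q, dd O d3 x q)) O := fun i =>
    (h33.coord i).add (h.comp (F.contDiffOn_spray he i))
  have hB := fun i j => h.comp (F.contDiffOn_lagHess he p i j)
  have h2 := fun j => (h.smooth_dd d2).coord j
  have hcomm : dd O d1 (dd O d3 (dd O d3 x)) q =
      dd O d3 (dd O d3 (dd O d1 x)) q := by
    rw [dd_comm (h.smooth_dd d3) h.nice hq]
    exact dd_congr (fun q hq => dd_comm h.smooth h.nice hq d1 d3) hq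
  rw [dd_congr (fun q hq => F.dd_pairing_sub_dd_lag he p h hq) hq,
    dd_sum h.nice (fun j _ => ContDiffOn.sum fun i _ => ((hB i j).mul (hS i)).mul (h2 j)) hq]
  refine Finset.sum_congr rfl fun j _ => ?_
  rw [dd_sum h.nice (fun i _ => ((hB i j).mul (hS i)).mul (h2 j)) hq]
  refine Finset.sum_congr rfl fun i _ => ?_
  -- In the product B_{ij} (ẍ^i + G^i) ∂x^j/∂s₂ the middle factor is 0 at q by `hgeo`, so only its
  -- derivative survives.
  rw [dd_mul h.nice ((hB i j).mul (hS i)) (h2 j) hq, dd_mul h.nice (hB i j) (hS i) hq, hgeo i,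
    dd_add h.nice (h33.coord i) (h.comp (F.contDiffOn_spray he i)) hq,
    dd_apply h.nice h33 hq, h.dd_comp_phase (F.contDiffOn_spray he i) hq, hcomm,
    dd_comm h.smooth h.nice hq d1 d3]
  ring

end FinslerMetric

end FinslerPEnergy

namespace FinslerPEnergy

/-! ### Families of curves on the manifold -/

/-- Identifies one-sided derivatives along the base curve with ∂/∂t of a family at s₁ = s₂ = 0;
openness of W allows W to be dropped from the set of times. -/
theorem hasDerivWithinAt_slab_slice {V : Type*} [NormedAddCommGroup V] [NormedSpace ℝ V]
    {a b t : ℝ} {W : Set (ℝ × ℝ × ℝ)} (hW : IsOpen W) {y : ℝ × ℝ × ℝ → V}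
    (hy : ContDiffOn ℝ ∞ y (slab a b ∩ W)) (ht : t ∈ Icc a b)
    (htW : ((0 : ℝ), (0 : ℝ), t) ∈ W) {g : ℝ → V}
    (hg : ∀ t ∈ Icc a b, ((0 : ℝ), (0 : ℝ), t) ∈ W → g t = y (0, 0, t)) :
    HasDerivWithinAt g (dd (slab a b ∩ W) d3 y (0, 0, t)) (Icc a b) t := by
  set W₀ : Set ℝ := {t | ((0 : ℝ), (0 : ℝ), t) ∈ W} with hW₀
  have hW₀o : IsOpen W₀ := hW.preimage (by fun_prop)
  have h := hasDerivWithinAt_slice hy (hasDerivWithinAt_line3 0 0 (Icc a b ∩ W₀) t)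
    (fun t ht => ⟨ht.1, ht.2⟩) ⟨ht, htW⟩
  have h2 : HasDerivWithinAt g (dd (slab a b ∩ W) d3 y (0, 0, t)) (Icc a b ∩ W₀) t :=
    h.congr (fun t ht => hg t ht.1 ht.2) (hg t ht htW)
  exact (hasDerivWithinAt_inter (hW₀o.mem_nhds htW)).1 h2

theorem contDiffWithinAt_slab_slice {V : Type*} [NormedAddCommGroup V] [NormedSpace ℝ V]
    {a b t : ℝ} {W : Set (ℝ × ℝ × ℝ)} (hW : IsOpen W) {y : ℝ × ℝ × ℝ → V}
    (hy : ContDiffOn ℝ ∞ y (slab a b ∩ W)) (ht : t ∈ Icc a b)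
    (htW : ((0 : ℝ), (0 : ℝ), t) ∈ W) {g : ℝ → V}
    (hg : ∀ t ∈ Icc a b, ((0 : ℝ), (0 : ℝ), t) ∈ W → g t = y (0, 0, t)) :
    ContDiffWithinAt ℝ ∞ g (Icc a b) t := by
  set W₀ : Set ℝ := {t | ((0 : ℝ), (0 : ℝ), t) ∈ W} with hW₀
  have hW₀o : IsOpen W₀ := hW.preimage (by fun_prop)
  have h : ContDiffOn ℝ ∞ (fun t => y (0, 0, t)) (Icc a b ∩ W₀) :=
    hy.comp (f := fun t : ℝ => ((0 : ℝ), (0 : ℝ), t)) (by fun_prop) fun t ht => ⟨ht.1, ht.2⟩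
  exact (contDiffWithinAt_inter (hW₀o.mem_nhds htW)).1
    ((h.congr fun t ht => hg t ht.1 ht.2) t ⟨ht, htW⟩)

section Family

variable {n : ℕ} {M : Type*} [TopologicalSpace M] [ChartedSpace (E n) M]

/-- The uncurried form of a two-parameter family of curves. -/
def fam (α : ℝ → ℝ → ℝ → M) (q : ℝ × ℝ × ℝ) : M := α q.1 q.2.1 q.2.2

/-- The velocity of a family of curves on the time interval `[a, b]`. -/
def velVec (α : ℝ → ℝ → ℝ → M) (a b : ℝ) (q : ℝ × ℝ × ℝ) : TangentSpace (I n) (fam α q) :=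
  mfderivWithin 𝓘(ℝ, ℝ × ℝ × ℝ) (I n) (fam α) (slab a b) q d3

/-- The derivative of a family of curves in the second parameter. -/
def varVec (α : ℝ → ℝ → ℝ → M) (a b : ℝ) (q : ℝ × ℝ × ℝ) : TangentSpace (I n) (fam α q) :=
  mfderivWithin 𝓘(ℝ, ℝ × ℝ × ℝ) (I n) (fam α) (slab a b) q d2

theorem mdifferentiableWithinAt_fam
    {α : ℝ → ℝ → ℝ → M} {a b ε : ℝ}
    (hα : ContMDiffOn 𝓘(ℝ, ℝ × ℝ × ℝ) (I n) ∞ (fam α) (slab a b ∩ box ε)) {q : ℝ × ℝ × ℝ}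
    (hq : q ∈ slab a b ∩ box ε) :
    MDifferentiableWithinAt 𝓘(ℝ, ℝ × ℝ × ℝ) (I n) (fam α) (slab a b) q :=
  ((contMDiffWithinAt_inter ((isOpen_box ε).mem_nhds hq.2)).1
    (hα q hq)).mdifferentiableWithinAt (by simp)

variable [IsManifold (I n) ∞ M] {F : FinslerMetric n M} {e : OpenPartialHomeomorph M (E n)}
  {c : ℝ → M} {α : ℝ → ℝ → ℝ → M} {a b ε t : ℝ}

/-- A neighbourhood of `(0, 0, t)` on which a family of curves lies in a chart. -/
structure ChartNhd (e : OpenPartialHomeomorph M (E n)) (α : ℝ → ℝ → ℝ → M) (a b ε t : ℝ)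
    (W : Set (ℝ × ℝ × ℝ)) : Prop where
  isOpen : IsOpen W
  mem : ((0 : ℝ), (0 : ℝ), t) ∈ W
  subset : W ⊆ box ε
  source : ∀ q ∈ slab a b ∩ W, fam α q ∈ e.source
  regular : RegularFamily e (slab a b ∩ W) (fun q => e (fam α q))

theorem FinslerMetric.IsGeodesic.derivWithin_Icc (hc : F.IsGeodesic c) (he : e ∈ atlas (E n) M)
    (hab : a < b) (hsub : Icc a b ⊆ Icc 0 1) (ht : t ∈ Icc a b) (hs : c t ∈ e.source) :
    derivWithin (fun s => e (c s)) (Icc a b) t = FinslerMetric.coordVel e c t :=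
  ((hc.contDiffWithinAt_pos he (hsub ht) hs).hasDerivWithinAt_derivWithin.mono hsub).derivWithin
    (uniqueDiffOn_Icc hab t ht)

/-- Staying in the chart and having nonzero velocity are open conditions, valid at (0, 0, t) because
the family there is the regular curve c. -/
theorem exists_chartNhd (hc : F.IsGeodesic c) (he : e ∈ atlas (E n) M) (hε : 0 < ε)
    (hab : a < b) (hsub : Icc a b ⊆ Icc 0 1)
    (hα : ContMDiffOn 𝓘(ℝ, ℝ × ℝ × ℝ) (I n) ∞ (fam α) (slab a b ∩ box ε))
    (hbase : ∀ t ∈ Icc (0 : ℝ) 1, α 0 0 t = c t) (ht : t ∈ Icc a b) (hs : c t ∈ e.source) :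
    ∃ W, ChartNhd e α a b ε t W := by
  have hbox0 : ∀ t, ((0 : ℝ), (0 : ℝ), t) ∈ box ε := fun t =>
    ⟨⟨by linarith, hε⟩, ⟨by linarith, hε⟩, mem_univ _⟩
  have hS := niceDomain_slab hab
  obtain ⟨U, hU, hUeq⟩ := continuousOn_iff'.1 hα.continuousOn e.source e.open_source
  have hUmem : ∀ q ∈ slab a b ∩ box ε, (q ∈ U ↔ fam α q ∈ e.source) := fun q hq => by
    have := Set.ext_iff.1 hUeq q
    simp only [mem_inter_iff, mem_preimage] at this
    tauto
  have hW1 : IsOpen (box ε ∩ U) := (isOpen_box ε).inter hU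
  set x : ℝ × ℝ × ℝ → E n := fun q => e (fam α q) with hx
  have hbase' : ∀ t ∈ Icc a b, fam α (0, 0, t) = c t := fun t ht => hbase t (hsub ht)
  have hmem0 : ((0 : ℝ), (0 : ℝ), t) ∈ box ε ∩ U := by
    refine ⟨hbox0 t, (hUmem _ ⟨ht, hbox0 t⟩).2 ?_⟩
    rw [hbase' t ht]; exact hs
  have hsrc : ∀ q ∈ slab a b ∩ (box ε ∩ U), fam α q ∈ e.source := fun q hq =>
    (hUmem q ⟨hq.1, hq.2.1⟩).1 hq.2.2
  have hxs : ContDiffOn ℝ ∞ x (slab a b ∩ (box ε ∩ U)) := fun q hq =>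
    contDiffWithinAt_chart_comp he ((hα q ⟨hq.1, hq.2.1⟩).mono
      (inter_subset_inter_right _ inter_subset_left)) (hsrc q hq)
  have hn := hS.inter_open hW1
  -- The second condition concerns the derivative in the chart, which makes sense only after
  -- shrinking to the first neighbourhood; shrinking again does not change that derivative.
  obtain ⟨U', hU', hU'eq⟩ := continuousOn_iff'.1 (hxs.dd hn d3).continuousOn {0}ᶜ
    isOpen_compl_singleton
  have hU'mem : ∀ q ∈ slab a b ∩ (box ε ∩ U),
      (q ∈ U' ↔ dd (slab a b ∩ (box ε ∩ U)) d3 x q ≠ 0) := fun q hq => by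
    have := Set.ext_iff.1 hU'eq q
    simp only [mem_inter_iff, mem_preimage, mem_compl_iff, mem_singleton_iff] at this
    simp only [mem_inter_iff] at hq
    tauto
  have hW : IsOpen (box ε ∩ U ∩ U') := hW1.inter hU'
  have hd3 : dd (slab a b ∩ (box ε ∩ U)) d3 x (0, 0, t) = FinslerMetric.coordVel e c t := by
    rw [← hc.derivWithin_Icc he hab hsub ht hs]
    refine ((hasDerivWithinAt_slab_slice hW1 hxs ht hmem0 fun t ht _ => ?_).derivWithin
      (uniqueDiffOn_Icc hab t ht)).symm
    simp only [hx, hbase' t ht]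
  refine ⟨box ε ∩ U ∩ U', hW, ⟨hmem0, (hU'mem _ ⟨ht, hmem0⟩).2 ?_⟩, fun q hq => hq.1.1,
    fun q hq => hsrc q ⟨hq.1, hq.2.1⟩, hS.inter_open hW,
    hxs.mono (inter_subset_inter_right _ inter_subset_left), fun q hq => ?_⟩
  · rw [hd3]; exact (hc.phase_mem he (hsub ht) hs).2
  · refine ⟨e.map_source (hsrc q ⟨hq.1, hq.2.1⟩), ?_⟩
    have h1 : dd (slab a b ∩ (box ε ∩ U ∩ U')) d3 x q =
        dd (slab a b ∩ (box ε ∩ U)) d3 x q := by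
      rw [← inter_assoc, dd_inter_open hU' hq.2.2]
    have h2 := (hU'mem q ⟨hq.1, hq.2.1⟩).1 hq.2.2
    rwa [← h1] at h2

/-- The Lagrangian `F^p` on the tangent bundle. -/
def FinslerMetric.pLag (F : FinslerMetric n M) (p : ℝ) (w : TangentBundle (I n) M) : ℝ :=
  (F.toFun w ^ 2) ^ (p / 2)

theorem pLag_eq_lag (he : e ∈ atlas (E n) M) (p : ℝ) {x : M} (hx : x ∈ e.source)
    (v : TangentSpace (I n) x) :
    F.pLag p ⟨x, v⟩ = F.lag e p (e x, mfderiv (I n) (I n) e x v) := by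
  unfold FinslerMetric.pLag FinslerMetric.lag FinslerMetric.sq
  rw [coordVec_mfderiv he hx]

/-- The Lagrangian evaluated on the velocity of a family of curves. -/
def FinslerMetric.famLag (F : FinslerMetric n M) (p : ℝ) (α : ℝ → ℝ → ℝ → M) (a b : ℝ)
    (q : ℝ × ℝ × ℝ) : ℝ := F.pLag p ⟨fam α q, velVec α a b q⟩

/-- The fibre derivative of the Lagrangian at the velocity of a family of curves, in the
direction of the second variation field. -/
def FinslerMetric.famPairing (F : FinslerMetric n M) (p : ℝ) (α : ℝ → ℝ → ℝ → M) (a b : ℝ)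
    (q : ℝ × ℝ × ℝ) : ℝ :=
  deriv (fun u : ℝ => F.pLag p ⟨fam α q, velVec α a b q + u • varVec α a b q⟩) 0

namespace ChartNhd

variable {W : Set (ℝ × ℝ × ℝ)}

theorem coord_vel (he : e ∈ atlas (E n) M) (hab : a < b)
    (hα : ContMDiffOn 𝓘(ℝ, ℝ × ℝ × ℝ) (I n) ∞ (fam α) (slab a b ∩ box ε))
    (h : ChartNhd e α a b ε t W) {q : ℝ × ℝ × ℝ} (hq : q ∈ slab a b ∩ W) (v : ℝ × ℝ × ℝ) :
    mfderiv (I n) (I n) e (fam α q)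
      (mfderivWithin 𝓘(ℝ, ℝ × ℝ × ℝ) (I n) (fam α) (slab a b) q v) =
      dd (slab a b ∩ W) v (fun q => e (fam α q)) q := by
  rw [dd_inter_open h.isOpen hq.2]
  exact (dd_chart_comp he ((niceDomain_slab hab).uniqueDiffOn q hq.1)
    (mdifferentiableWithinAt_fam hα ⟨hq.1, h.subset hq.2⟩) (h.source q hq) v).symm

theorem famLag_eq (he : e ∈ atlas (E n) M) (hab : a < b) (p : ℝ)
    (hα : ContMDiffOn 𝓘(ℝ, ℝ × ℝ × ℝ) (I n) ∞ (fam α) (slab a b ∩ box ε))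
    (h : ChartNhd e α a b ε t W) :
    EqOn (F.famLag p α a b) (fun q => F.lag e p
      (e (fam α q), dd (slab a b ∩ W) d3 (fun q => e (fam α q)) q)) (slab a b ∩ W) := by
  intro q hq
  unfold FinslerMetric.famLag
  rw [pLag_eq_lag he p (h.source q hq)]
  unfold velVec
  rw [h.coord_vel he hab hα hq]

/-- Links the chart-free boundary pairing to its coordinates: the derivative of the chart is linear
on the fibre, so it sends the line of tangent vectors to a line in ℝⁿ. -/
theorem famPairing_eq (he : e ∈ atlas (E n) M) (hab : a < b) (p : ℝ)
    (hα : ContMDiffOn 𝓘(ℝ, ℝ × ℝ × ℝ) (I n) ∞ (fam α) (slab a b ∩ box ε))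
    (h : ChartNhd e α a b ε t W) :
    EqOn (F.famPairing p α a b) (F.pairing e p (slab a b ∩ W) (fun q => e (fam α q)))
      (slab a b ∩ W) := by
  intro q hq
  unfold FinslerMetric.famPairing FinslerMetric.pairing
  rw [← dd_right_eq_sum]
  have h1 : (fun u : ℝ => F.pLag p ⟨fam α q, velVec α a b q + u • varVec α a b q⟩) = fun u =>
      F.lag e p (e (fam α q), dd (slab a b ∩ W) d3 (fun q => e (fam α q)) q +
        u • dd (slab a b ∩ W) d2 (fun q => e (fam α q)) q) := by
    funext u
    rw [pLag_eq_lag he p (h.source q hq), ← h.coord_vel he hab hα hq, ← h.coord_vel he hab hα hq]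
    congr 2
    exact (map_add (mfderiv (I n) (I n) e (fam α q)) _ _).trans
      (congrArg _ (map_smul (mfderiv (I n) (I n) e (fam α q)) u _))
  rw [h1]
  have hl : HasDerivWithinAt (fun u : ℝ => (e (fam α q),
      dd (slab a b ∩ W) d3 (fun q => e (fam α q)) q +
        u • dd (slab a b ∩ W) d2 (fun q => e (fam α q)) q))
      ((0 : E n), dd (slab a b ∩ W) d2 (fun q => e (fam α q)) q) univ 0 := by
    refine (hasDerivWithinAt_const _ _ _).prodMk ?_
    simpa using ((hasDerivAt_id' (0 : ℝ)).smul_const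
      (dd (slab a b ∩ W) d2 (fun q => e (fam α q)) q)).const_add
        (dd (slab a b ∩ W) d3 (fun q => e (fam α q)) q)
  have h2 := hasDerivWithinAt_comp_curve (F.contDiffOn_lag he p) isOpen_slit hl
    (by simpa using h.regular.mem q hq)
  rw [hasDerivWithinAt_univ] at h2
  simpa using h2.deriv

end ChartNhd

end Family

end FinslerPEnergy

namespace FinslerPEnergy

/-! ### The second variation on one smooth piece -/

section SecondVariationPiece

open FinslerMetric

variable {n : ℕ} {M : Type*} [TopologicalSpace M] [ChartedSpace (E n) M]

/-- Variation fields are prescribed as points of the total space, so no transport between fibres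
over equal base points is needed. -/
theorem coordField_eq_of_eq {c : ℝ → M} {X : (t : ℝ) → TangentSpace (I n) (c t)} {x : M}
    {t : ℝ} {v : TangentSpace (I n) x}
    (h : (⟨x, v⟩ : TangentBundle (I n) M) = ⟨c t, X t⟩) (e : OpenPartialHomeomorph M (E n)) :
    coordField e c X t = mfderiv (I n) (I n) e x v :=
  (congrArg (fun w => (coordsOfVec e w).2) h).symm

variable [IsManifold (I n) ∞ M] {F : FinslerMetric n M} {e : OpenPartialHomeomorph M (E n)}
  {c : ℝ → M} {α : ℝ → ℝ → ℝ → M} {a b ε t : ℝ} {W : Set (ℝ × ℝ × ℝ)}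
  {X Y : (t : ℝ) → TangentSpace (I n) (c t)}

/-- The fibre Hessian of the Lagrangian along a curve. -/
def FinslerMetric.hess (F : FinslerMetric n M) (e : OpenPartialHomeomorph M (E n)) (p : ℝ)
    (c : ℝ → M) (t : ℝ) (u v : E n) : ℝ :=
  ∑ j, ∑ i, F.lagHess e p i j (phase e c t) * u i * v j

theorem coordField_eq_deriv (he : e ∈ atlas (E n) M) {γ : ℝ → M}
    (hγ : MDifferentiableAt 𝓘(ℝ, ℝ) (I n) γ 0) (hs : γ 0 ∈ e.source)
    (h : (⟨γ 0, mfderiv 𝓘(ℝ, ℝ) (I n) γ 0 (1 : ℝ)⟩ : TangentBundle (I n) M) = ⟨c t, X t⟩) :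
    coordField e c X t = deriv (fun s => e (γ s)) 0 := by
  rw [coordField_eq_of_eq h e, ← derivWithin_univ, derivWithin_chart_comp he
    uniqueDiffWithinAt_univ (mdifferentiableWithinAt_univ.2 hγ) hs, mfderivWithin_univ]

/-- Treats both variation fields at once: l is the parameter line in the s₁- or the s₂-direction at
fixed time r. -/
theorem coordField_eq_dd (he : e ∈ atlas (E n) M)
    (hα : ContMDiffOn 𝓘(ℝ, ℝ × ℝ × ℝ) (I n) ∞ (fam α) (slab a b ∩ box ε))
    (h : ChartNhd e α a b ε t W) {r : ℝ} (hr : r ∈ Icc a b) (hrW : ((0 : ℝ), (0 : ℝ), r) ∈ W)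
    {l : ℝ → ℝ × ℝ × ℝ} {v : ℝ × ℝ × ℝ} (hl : ContDiff ℝ ∞ l) (hl0 : l 0 = (0, 0, r))
    (hlt : ∀ s, (l s).2.2 = r) (hv : HasDerivAt l v 0)
    (hX : (⟨fam α (l 0), mfderiv 𝓘(ℝ, ℝ) (I n) (fun s => fam α (l s)) 0 (1 : ℝ)⟩ :
      TangentBundle (I n) M) = ⟨c r, X r⟩) :
    coordField e c X r = dd (slab a b ∩ W) v (fun q => e (fam α q)) (0, 0, r) := by
  set T : Set ℝ := l ⁻¹' W with hT
  have hTo : IsOpen T := h.isOpen.preimage hl.continuous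
  have h0T : (0 : ℝ) ∈ T := by rw [hT, mem_preimage, hl0]; exact hrW
  have hslab : ∀ s, l s ∈ slab a b := fun s => by
    change (l s).2.2 ∈ Icc a b
    rw [hlt]; exact hr
  have hmaps : MapsTo l T (slab a b ∩ W) := fun s hs => ⟨hslab s, hs⟩
  have hmaps' : MapsTo l T (slab a b ∩ box ε) := fun s hs => ⟨hslab s, h.subset hs⟩
  have hcm : MDifferentiableAt 𝓘(ℝ, ℝ) (I n) (fun s => fam α (l s)) 0 :=
    ((hα.comp hl.contMDiff.contMDiffOn hmaps').contMDiffAt (hTo.mem_nhds h0T)).mdifferentiableAt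
      (by simp)
  rw [coordField_eq_deriv he hcm (h.source _ (hmaps h0T)) hX]
  have := (hasDerivWithinAt_slice h.regular.smooth hv.hasDerivWithinAt hmaps h0T).hasDerivAt
    (hTo.mem_nhds h0T)
  rw [this.deriv, hl0]

/-- The data of a smooth piece of a variation of a geodesic. -/
structure VariationPiece (F : FinslerMetric n M) (c : ℝ → M)
    (X Y : (t : ℝ) → TangentSpace (I n) (c t)) (α : ℝ → ℝ → ℝ → M) (a b ε : ℝ) : Prop where
  geodesic : F.IsGeodesic c
  pos : 0 < ε
  lt : a < b
  subset : Icc a b ⊆ Icc 0 1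
  smooth : ContMDiffOn 𝓘(ℝ, ℝ × ℝ × ℝ) (I n) ∞ (fam α) (slab a b ∩ box ε)
  base : ∀ t ∈ Icc (0 : ℝ) 1, α 0 0 t = c t
  field₁ : ∀ t ∈ Icc (0 : ℝ) 1,
    (⟨α 0 0 t, mfderiv 𝓘(ℝ, ℝ) (I n) (fun s => α s 0 t) 0 (1 : ℝ)⟩ : TangentBundle (I n) M) =
      ⟨c t, X t⟩
  field₂ : ∀ t ∈ Icc (0 : ℝ) 1,
    (⟨α 0 0 t, mfderiv 𝓘(ℝ, ℝ) (I n) (fun s => α 0 s t) 0 (1 : ℝ)⟩ : TangentBundle (I n) M) =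
      ⟨c t, Y t⟩

namespace VariationPiece

theorem exists_chartNhd (h : VariationPiece F c X Y α a b ε) (he : e ∈ atlas (E n) M)
    (ht : t ∈ Icc a b) (hs : c t ∈ e.source) : ∃ W, ChartNhd e α a b ε t W :=
  FinslerPEnergy.exists_chartNhd h.geodesic he h.pos h.lt h.subset h.smooth h.base ht hs

theorem coordField₁ (h : VariationPiece F c X Y α a b ε) (he : e ∈ atlas (E n) M)
    (hW : ChartNhd e α a b ε t W) {r : ℝ} (hr : r ∈ Icc a b)
    (hrW : ((0 : ℝ), (0 : ℝ), r) ∈ W) :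
    coordField e c X r = dd (slab a b ∩ W) d1 (fun q => e (fam α q)) (0, 0, r) :=
  coordField_eq_dd he h.smooth hW hr hrW (l := fun s => (s, 0, r)) (by fun_prop) rfl
    (fun _ => rfl) (hasDerivWithinAt_univ.1 (hasDerivWithinAt_line1 0 r univ 0))
    (h.field₁ r (h.subset hr))

theorem coordField₂ (h : VariationPiece F c X Y α a b ε) (he : e ∈ atlas (E n) M)
    (hW : ChartNhd e α a b ε t W) {r : ℝ} (hr : r ∈ Icc a b)
    (hrW : ((0 : ℝ), (0 : ℝ), r) ∈ W) :
    coordField e c Y r = dd (slab a b ∩ W) d2 (fun q => e (fam α q)) (0, 0, r) :=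
  coordField_eq_dd he h.smooth hW hr hrW (l := fun s => (0, s, r)) (by fun_prop) rfl
    (fun _ => rfl) (hasDerivWithinAt_univ.1 (hasDerivWithinAt_line2 0 r univ 0))
    (h.field₂ r (h.subset hr))

theorem mem_source (h : VariationPiece F c X Y α a b ε)
    (hW : ChartNhd e α a b ε t W) {r : ℝ} (hr : r ∈ Icc a b)
    (hrW : ((0 : ℝ), (0 : ℝ), r) ∈ W) : c r ∈ e.source := by
  have := hW.source (0, 0, r) ⟨hr, hrW⟩
  rwa [fam, h.base r (h.subset hr)] at this

theorem coordVel_eq (h : VariationPiece F c X Y α a b ε) (he : e ∈ atlas (E n) M)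
    (hW : ChartNhd e α a b ε t W) {r : ℝ} (hr : r ∈ Icc a b)
    (hrW : ((0 : ℝ), (0 : ℝ), r) ∈ W) :
    coordVel e c r = dd (slab a b ∩ W) d3 (fun q => e (fam α q)) (0, 0, r) := by
  rw [← h.geodesic.derivWithin_Icc he h.lt h.subset hr (h.mem_source hW hr hrW)]
  exact (hasDerivWithinAt_slab_slice hW.isOpen hW.regular.smooth hr hrW fun t ht _ => by
    rw [fam, h.base t (h.subset ht)]).derivWithin (uniqueDiffOn_Icc h.lt r hr)

theorem phase_eq (h : VariationPiece F c X Y α a b ε) (he : e ∈ atlas (E n) M)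
    (hW : ChartNhd e α a b ε t W) {r : ℝ} (hr : r ∈ Icc a b)
    (hrW : ((0 : ℝ), (0 : ℝ), r) ∈ W) :
    (e (fam α (0, 0, r)), dd (slab a b ∩ W) d3 (fun q => e (fam α q)) (0, 0, r)) =
      phase e c r := by
  rw [← h.coordVel_eq he hW hr hrW, fam, h.base r (h.subset hr)]; rfl

/-- Provides the hypothesis `hgeo` of `dd_euler_lagrange`: at s₁ = s₂ = 0 the family is the
geodesic. -/
theorem acc (h : VariationPiece F c X Y α a b ε) (he : e ∈ atlas (E n) M)
    (hW : ChartNhd e α a b ε t W) {r : ℝ} (hr : r ∈ Icc a b)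
    (hrW : ((0 : ℝ), (0 : ℝ), r) ∈ W) (i : Fin n) :
    dd (slab a b ∩ W) d3 (dd (slab a b ∩ W) d3 (fun q => e (fam α q))) (0, 0, r) i +
      unc (F.spray e i) (e (fam α (0, 0, r)),
        dd (slab a b ∩ W) d3 (fun q => e (fam α q)) (0, 0, r)) = 0 := by
  have hs := h.mem_source hW hr hrW
  have h1 := (hasDerivWithinAt_slab_slice hW.isOpen (hW.regular.smooth_dd d3) hr hrW
    fun _ ht htW => h.coordVel_eq he hW ht htW).derivWithin (uniqueDiffOn_Icc h.lt r hr)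
  have h2 := ((h.geodesic.contDiffWithinAt_vel he (h.subset hr)
    hs).hasDerivWithinAt_derivWithin.mono h.subset).derivWithin (uniqueDiffOn_Icc h.lt r hr)
  rw [← h1, h2, h.geodesic.acc_eq he (h.subset hr) hs, h.phase_eq he hW hr hrW]
  exact neg_add_cancel _

theorem contDiffWithinAt_coordField (h : VariationPiece F c X Y α a b ε) (he : e ∈ atlas (E n) M)
    (ht : t ∈ Icc a b) (hs : c t ∈ e.source) :
    ContDiffWithinAt ℝ ∞ (coordField e c X) (Icc a b) t := by
  obtain ⟨W, hW⟩ := h.exists_chartNhd he ht hs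
  exact contDiffWithinAt_slab_slice hW.isOpen (hW.regular.smooth_dd d1) ht hW.mem
    fun r hr hrW => h.coordField₁ he hW hr hrW

theorem derivWithin_coordField (h : VariationPiece F c X Y α a b ε) (he : e ∈ atlas (E n) M)
    (hW : ChartNhd e α a b ε t W) {r : ℝ} (hr : r ∈ Icc a b)
    (hrW : ((0 : ℝ), (0 : ℝ), r) ∈ W) :
    derivWithin (coordField e c X) (Icc a b) r = dd (slab a b ∩ W) d3
      (dd (slab a b ∩ W) d1 (fun q => e (fam α q))) (0, 0, r) :=
  (hasDerivWithinAt_slab_slice hW.isOpen (hW.regular.smooth_dd d1) hr hrW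
    fun _ ht htW => h.coordField₁ he hW ht htW).derivWithin (uniqueDiffOn_Icc h.lt r hr)

theorem derivWithin_derivWithin_coordField (h : VariationPiece F c X Y α a b ε)
    (he : e ∈ atlas (E n) M)
    (hW : ChartNhd e α a b ε t W) {r : ℝ} (hr : r ∈ Icc a b)
    (hrW : ((0 : ℝ), (0 : ℝ), r) ∈ W) :
    derivWithin (derivWithin (coordField e c X) (Icc a b)) (Icc a b) r =
      dd (slab a b ∩ W) d3 (dd (slab a b ∩ W) d3
        (dd (slab a b ∩ W) d1 (fun q => e (fam α q)))) (0, 0, r) :=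
  (hasDerivWithinAt_slab_slice hW.isOpen ((hW.regular.smooth_dd d1).dd hW.regular.nice d3) hr hrW
    fun _ ht htW => h.derivWithin_coordField he hW ht htW).derivWithin
      (uniqueDiffOn_Icc h.lt r hr)

theorem smoothNear_famLag (h : VariationPiece F c X Y α a b ε) (p : ℝ) :
    SmoothNear a b (F.famLag p α a b) := by
  intro t ht
  obtain ⟨W, hW⟩ := h.exists_chartNhd (chart_mem_atlas (E n) (c t)) ht (mem_chart_source _ _)
  exact ⟨W, hW.isOpen, hW.mem, (hW.regular.comp (F.contDiffOn_lag (chart_mem_atlas _ _) p)).congr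
    (hW.famLag_eq (chart_mem_atlas _ _) h.lt p h.smooth)⟩

theorem smoothNear_famPairing (h : VariationPiece F c X Y α a b ε) (p : ℝ) :
    SmoothNear a b (F.famPairing p α a b) := by
  intro t ht
  obtain ⟨W, hW⟩ := h.exists_chartNhd (chart_mem_atlas (E n) (c t)) ht (mem_chart_source _ _)
  exact ⟨W, hW.isOpen, hW.mem, (F.contDiffOn_pairing (chart_mem_atlas _ _) p hW.regular).congr
    (hW.famPairing_eq (chart_mem_atlas _ _) h.lt p h.smooth)⟩

/-- The interior term of the second variation. -/
theorem dd_interior (h : VariationPiece F c X Y α a b ε) (he : e ∈ atlas (E n) M) (p : ℝ)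
    (ht : t ∈ Ioo a b) (hs : c t ∈ e.source) :
    dd (slab a b) d1 (fun q => dd (slab a b) d3 (F.famPairing p α a b) q -
      dd (slab a b) d2 (F.famLag p α a b) q) (0, 0, t) =
    F.hess e p c t (F.jacobiOp e c (coordField e c X) t) (coordField e c Y t) := by
  have ht' := Ioo_subset_Icc_self ht
  obtain ⟨W, hW⟩ := h.exists_chartNhd he ht' hs
  have hmem : ((0 : ℝ), (0 : ℝ), t) ∈ slab a b ∩ W := ⟨ht', hW.mem⟩
  have hEq : EqOn (fun q => dd (slab a b) d3 (F.famPairing p α a b) q -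
      dd (slab a b) d2 (F.famLag p α a b) q) (fun q =>
      dd (slab a b ∩ W) d3 (F.pairing e p (slab a b ∩ W) (fun q => e (fam α q))) q -
      dd (slab a b ∩ W) d2 (fun q => F.lag e p (e (fam α q),
        dd (slab a b ∩ W) d3 (fun q => e (fam α q)) q)) q) (slab a b ∩ W) := by
    intro q hq
    dsimp only
    rw [← dd_congr (hW.famPairing_eq he h.lt p h.smooth) hq,
      ← dd_congr (hW.famLag_eq he h.lt p h.smooth) hq, dd_inter_open hW.isOpen hq.2,
      dd_inter_open hW.isOpen hq.2]
  rw [← dd_inter_open hW.isOpen hW.mem, dd_congr hEq hmem,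
    F.dd_euler_lagrange he p hW.regular hmem (h.acc he hW ht' hW.mem)]
  have hξ := h.contDiffWithinAt_coordField he ht' hs
  have hnhd : Icc a b ∈ 𝓝 t := Icc_mem_nhds ht.1 ht.2
  have hnhd' : Icc (0 : ℝ) 1 ∈ 𝓝 t := mem_of_superset hnhd h.subset
  -- The Jacobi operator differentiates within [0, 1], the family within [a, b]; at interior times
  -- of the piece these agree.
  have hd : ∀ {g : ℝ → E n} {s : ℝ}, s ∈ Ioo a b →
      derivWithin g (Icc a b) s = derivWithin g (Icc 0 1) s := fun {g s} hs' => by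
    rw [derivWithin_of_mem_nhds (Icc_mem_nhds hs'.1 hs'.2),
      derivWithin_of_mem_nhds (mem_of_superset (Icc_mem_nhds hs'.1 hs'.2) h.subset)]
  have hd2 : derivWithin (derivWithin (coordField e c X) (Icc a b)) (Icc a b) t =
      derivWithin (derivWithin (coordField e c X) (Icc 0 1)) (Icc 0 1) t := by
    rw [hd ht]
    refine Filter.EventuallyEq.derivWithin_eq ?_ (hd ht)
    exact nhdsWithin_le_nhds (Filter.mem_of_superset (Ioo_mem_nhds ht.1 ht.2) fun s hs => hd hs)
  have hξ' : ContDiffWithinAt ℝ ∞ (coordField e c X) (Icc 0 1) t :=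
    (hξ.contDiffAt hnhd).contDiffWithinAt
  unfold hess
  rw [h.phase_eq he hW ht' hW.mem, ← h.derivWithin_derivWithin_coordField he hW ht' hW.mem,
    ← h.derivWithin_coordField he hW ht' hW.mem, ← h.coordField₁ he hW ht' hW.mem,
    ← h.coordField₂ he hW ht' hW.mem, hd2, hd ht]
  simp only [h.geodesic.jacobiOp_apply he (h.subset ht') hs hξ']

/-- The boundary term of the second variation. -/
theorem dd_boundary (h : VariationPiece F c X Y α a b ε) (he : e ∈ atlas (E n) M) (p : ℝ)
    (ht : t ∈ Icc a b) (hs : c t ∈ e.source) :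
    dd (slab a b) d1 (F.famPairing p α a b) (0, 0, t) =
      ∑ j, (deriv (fun s₁ => deriv (fun s₂ => e (α s₁ s₂ t)) 0) 0 j *
          dd (slit e) (bY j) (F.lag e p) (phase e c t) + coordField e c Y t j *
          dd (slit e) (coordField e c X t, 0) (dd (slit e) (bY j) (F.lag e p)) (phase e c t)) +
      F.hess e p c t (derivWithin (coordField e c X) (Icc a b) t) (coordField e c Y t) := by
  obtain ⟨W, hW⟩ := h.exists_chartNhd he ht hs
  have hmem : ((0 : ℝ), (0 : ℝ), t) ∈ slab a b ∩ W := ⟨ht, hW.mem⟩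
  set T : Set ℝ := (fun s : ℝ => (s, (0 : ℝ), t)) ⁻¹' W with hT
  have hTo : IsOpen T := hW.isOpen.preimage (by fun_prop)
  -- The mixed s-derivative is rewritten at fixed t without mention of [a, b]. Its contribution is
  -- therefore the same from both sides of a break point.
  have hmixed : deriv (fun s₁ => deriv (fun s₂ => e (α s₁ s₂ t)) 0) 0 =
      dd (slab a b ∩ W) d1 (dd (slab a b ∩ W) d2 (fun q => e (fam α q))) (0, 0, t) := by
    have h1 : (fun s₁ => deriv (fun s₂ => e (α s₁ s₂ t)) 0) =ᶠ[𝓝 0] fun s₁ =>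
        dd (slab a b ∩ W) d2 (fun q => e (fam α q)) (s₁, 0, t) := by
      filter_upwards [hTo.mem_nhds (show (0 : ℝ) ∈ T from hW.mem)] with s₁ hs₁
      have hT2 : IsOpen ((fun s : ℝ => (s₁, s, t)) ⁻¹' W) := hW.isOpen.preimage (by fun_prop)
      exact ((hasDerivWithinAt_slice hW.regular.smooth (hasDerivWithinAt_line2 s₁ t _ 0)
        (fun s hs => ⟨ht, hs⟩) hs₁).hasDerivAt (hT2.mem_nhds hs₁)).deriv
    rw [h1.deriv_eq]
    exact ((hasDerivWithinAt_slice (hW.regular.smooth_dd d2) (hasDerivWithinAt_line1 0 t T 0)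
        (fun s hs => ⟨ht, hs⟩) hW.mem).hasDerivAt (hTo.mem_nhds hW.mem)).deriv
  rw [← dd_inter_open hW.isOpen hW.mem, dd_congr (hW.famPairing_eq he h.lt p h.smooth) hmem,
    F.dd_pairing he p hW.regular hmem, dd_comm hW.regular.smooth hW.regular.nice hmem d1 d3,
    h.phase_eq he hW ht hW.mem, ← h.derivWithin_coordField he hW ht hW.mem,
    ← h.coordField₁ he hW ht hW.mem,
    ← h.coordField₂ he hW ht hW.mem, hmixed]
  unfold hess
  rw [← Finset.sum_add_distrib]
  refine Finset.sum_congr rfl fun j _ => ?_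
  -- Separates the part depending on the value of X from the part depending on its one-sided
  -- derivative, the only one that can jump.
  have hsplit : dd (slit e) (coordField e c X t, derivWithin (coordField e c X) (Icc a b) t)
      (dd (slit e) (bY j) (F.lag e p)) (phase e c t) =
      dd (slit e) (coordField e c X t, 0) (dd (slit e) (bY j) (F.lag e p)) (phase e c t) +
      ∑ i, derivWithin (coordField e c X) (Icc a b) t i * F.lagHess e p i j (phase e c t) := by
    rw [dd_phase_eq, dd_left_eq_sum]; rfl
  rw [hsplit, mul_add, Finset.mul_sum, add_assoc]
  congr 2
  exact Finset.sum_congr rfl fun i _ => by ring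

end VariationPiece

end SecondVariationPiece

end FinslerPEnergy

namespace FinslerPEnergy

/-! ### Partitions indexed by natural numbers -/

theorem exists_mem_piece {a : ℕ → ℝ} {t : ℝ} : ∀ {k : ℕ}, a 0 ≤ t → t < a k →
    ∃ i < k, a i ≤ t ∧ t < a (i + 1)
  | 0, h0, hk => absurd hk (not_lt.2 h0)
  | k + 1, h0, hk => by
    rcases lt_or_ge t (a k) with h | h
    · obtain ⟨i, hi, h⟩ := exists_mem_piece h0 h
      exact ⟨i, hi.trans (Nat.lt_succ_self k), h⟩
    · exact ⟨k, Nat.lt_succ_self k, h, hk⟩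

/-- A partition `0 = a 0 < ⋯ < a k = 1` of `[0, 1]`. -/
structure NatPartition (k : ℕ) (a : ℕ → ℝ) : Prop where
  zero : a 0 = 0
  last : a k = 1
  lt : ∀ i < k, a i < a (i + 1)

namespace NatPartition

variable {k : ℕ} {a : ℕ → ℝ}

theorem lt_of_lt (h : NatPartition k a) {i j : ℕ} (hij : i < j) (hj : j ≤ k) : a i < a j := by
  induction j, hij using Nat.le_induction with
  | base => exact h.lt i hj
  | succ j _ ih => exact (ih (by omega)).trans (h.lt j hj)

theorem le_of_le (h : NatPartition k a) {i j : ℕ} (hij : i ≤ j) (hj : j ≤ k) : a i ≤ a j := by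
  rcases hij.eq_or_lt with rfl | hlt
  · exact le_rfl
  · exact (h.lt_of_lt hlt hj).le

theorem mem (h : NatPartition k a) {i : ℕ} (hi : i ≤ k) : a i ∈ Icc (0 : ℝ) 1 :=
  ⟨h.zero ▸ h.le_of_le (Nat.zero_le i) hi, h.last ▸ h.le_of_le hi le_rfl⟩

theorem subset (h : NatPartition k a) {i : ℕ} (hi : i < k) :
    Icc (a i) (a (i + 1)) ⊆ Icc (0 : ℝ) 1 :=
  Icc_subset_Icc (h.mem hi.le).1 (h.mem hi).2

theorem pos (h : NatPartition k a) : 0 < k := by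
  rcases Nat.eq_zero_or_pos k with rfl | hk
  · have := h.zero.symm.trans h.last
    norm_num at this
  · exact hk

end NatPartition

theorem IsPartition.exists_nat {k : ℕ} {τ : Fin (k + 1) → ℝ} (h : IsPartition τ) :
    ∃ a, NatPartition k a ∧ ∀ i : Fin k, τ i.castSucc = a i ∧ τ i.succ = a (i + 1) := by
  -- Indices beyond k are clamped to k; those values are irrelevant.
  refine ⟨fun j => τ ⟨min j k, by omega⟩, ⟨?_, ?_, fun i hi => h.strictMono ?_⟩, fun i => ?_⟩
  · rw [← h.zero]; congr 1
  · rw [← h.last]; congr 1; ext; simp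
  · simp only [Fin.mk_lt_mk]; omega
  · have := i.2
    constructor
    · congr 1; ext; simp
    · congr 1; ext; simp

theorem NatPartition.isPartition {k : ℕ} {a : ℕ → ℝ} (h : NatPartition k a) :
    IsPartition (fun i : Fin (k + 1) => a i) :=
  ⟨fun _ j hij => h.lt_of_lt hij (Nat.lt_succ_iff.1 j.2), h.zero, h.last⟩

/-- Needed for integrability: the density is identified with this expression only inside the piece,
while continuity here holds up to the endpoints. -/
theorem SmoothNear.continuousOn_dd {a b : ℝ} (hab : a < b) {f θ : ℝ × ℝ × ℝ → ℝ}
    (hf : SmoothNear a b f) (hθ : SmoothNear a b θ) :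
    ContinuousOn (fun t => dd (slab a b) d1
      (fun q => dd (slab a b) d3 θ q - dd (slab a b) d2 f q) (0, 0, t)) (Icc a b) := by
  intro t ht
  obtain ⟨W, hW, hmW, hfW⟩ := hf t ht
  obtain ⟨W', hW', hmW', hθW⟩ := hθ t ht
  have hO : IsOpen (W ∩ W') := hW.inter hW'
  have hm : ((0 : ℝ), (0 : ℝ), t) ∈ W ∩ W' := ⟨hmW, hmW'⟩
  have hn := (niceDomain_slab hab).inter_open hO
  have hf' : ContDiffOn ℝ ∞ f (slab a b ∩ (W ∩ W')) :=
    hfW.mono (inter_subset_inter_right _ inter_subset_left)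
  have hθ' : ContDiffOn ℝ ∞ θ (slab a b ∩ (W ∩ W')) :=
    hθW.mono (inter_subset_inter_right _ inter_subset_right)
  have hZ := ((hθ'.dd hn d3).sub (hf'.dd hn d2)).dd hn d1
  refine (contDiffWithinAt_slab_slice hO hZ ht hm fun r hr hrW => ?_).continuousWithinAt
  have hEq : EqOn (fun q => dd (slab a b) d3 θ q - dd (slab a b) d2 f q)
      (fun q => dd (slab a b ∩ (W ∩ W')) d3 θ q - dd (slab a b ∩ (W ∩ W')) d2 f q)
      (slab a b ∩ (W ∩ W')) := fun q hq => by
    simp only [dd_inter_open hO hq.2]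
  exact (dd_inter_open hO hrW).symm.trans (dd_congr hEq ⟨hr, hrW⟩)

/-! ### The second variation formula -/

section Formula

open FinslerMetric

variable {n : ℕ} {M : Type*} [TopologicalSpace M] [ChartedSpace (E n) M]

/-- Absolute homogeneity gives F²(v + av + bv) = (1 + a + b)² F²(v), a polynomial in a and b, also
when v = 0. -/
theorem fundamentalTensor_self [IsManifold (I n) ∞ M] (F : FinslerMetric n M) (x : M)
    (v : TangentSpace (I n) x) : fundamentalTensor F.toFun x v v v = F.toFun ⟨x, v⟩ ^ 2 := by
  have h : ∀ a b : ℝ, F.toFun ⟨x, v + a • v + b • v⟩ ^ 2 =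
      (1 + a + b) ^ 2 * F.toFun ⟨x, v⟩ ^ 2 := by
    intro a b
    have : v + a • v + b • v = (1 + a + b) • v := by module
    rw [this, F.homogeneous, mul_pow, sq_abs]
  unfold fundamentalTensor
  simp only [h]
  have h1 : (fun a : ℝ => deriv (fun b : ℝ => (1 + a + b) ^ 2 * F.toFun ⟨x, v⟩ ^ 2) 0) =
      fun a => 2 * (1 + a) * F.toFun ⟨x, v⟩ ^ 2 := by
    funext a
    have := (((hasDerivAt_id' (0 : ℝ)).const_add (1 + a)).fun_pow 2).mul_const (F.toFun ⟨x, v⟩ ^ 2)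
    rw [this.deriv]
    simp
  rw [h1]
  have := (((hasDerivAt_id' (0 : ℝ)).const_add 1).const_mul 2).mul_const (F.toFun ⟨x, v⟩ ^ 2)
  rw [this.deriv]
  ring

/-- The velocity of a curve of a family. -/
theorem hasMFDerivWithinAt_fam {α : ℝ → ℝ → ℝ → M} {a b ε : ℝ}
    (hα : ContMDiffOn 𝓘(ℝ, ℝ × ℝ × ℝ) (I n) ∞ (fam α) (slab a b ∩ box ε)) {s₁ s₂ t : ℝ}
    (h₁ : s₁ ∈ Ioo (-ε) ε) (h₂ : s₂ ∈ Ioo (-ε) ε) (ht : t ∈ Icc a b) :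
    HasMFDerivWithinAt 𝓘(ℝ, ℝ) (I n) (α s₁ s₂) (Icc a b) t
      ((mfderivWithin 𝓘(ℝ, ℝ × ℝ × ℝ) (I n) (fam α) (slab a b) (s₁, s₂, t)).comp
        (ContinuousLinearMap.toSpanSingleton ℝ d3)) := by
  have hd := mdifferentiableWithinAt_fam hα (q := (s₁, s₂, t)) ⟨ht, h₁, h₂, mem_univ _⟩
  have hl : HasMFDerivWithinAt 𝓘(ℝ, ℝ) 𝓘(ℝ, ℝ × ℝ × ℝ) (fun t : ℝ => (s₁, s₂, t)) (Icc a b) t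
      (ContinuousLinearMap.toSpanSingleton ℝ d3) :=
    (hasDerivWithinAt_line3 s₁ s₂ (Icc a b) t).hasFDerivWithinAt.hasMFDerivWithinAt
  exact hd.hasMFDerivWithinAt.comp (u := slab a b) t hl
    (fun r (hr : r ∈ Icc a b) => show (s₁, s₂, r) ∈ slab a b from hr)

theorem mfderivWithin_fam {α : ℝ → ℝ → ℝ → M} {a b ε : ℝ} (hab : a < b)
    (hα : ContMDiffOn 𝓘(ℝ, ℝ × ℝ × ℝ) (I n) ∞ (fam α) (slab a b ∩ box ε)) {s₁ s₂ t : ℝ}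
    (h₁ : s₁ ∈ Ioo (-ε) ε) (h₂ : s₂ ∈ Ioo (-ε) ε) (ht : t ∈ Icc a b) :
    mfderivWithin 𝓘(ℝ, ℝ) (I n) (α s₁ s₂) (Icc a b) t (1 : ℝ) = velVec α a b (s₁, s₂, t) := by
  have h : mfderivWithin 𝓘(ℝ, ℝ) (I n) (α s₁ s₂) (Icc a b) t = _ :=
    (hasMFDerivWithinAt_fam hα h₁ h₂ ht).mfderivWithin
      (uniqueDiffOn_Icc hab t ht).uniqueMDiffWithinAt
  rw [h]
  change mfderivWithin 𝓘(ℝ, ℝ × ℝ × ℝ) (I n) (fam α) (slab a b) (s₁, s₂, t) ((1 : ℝ) • d3) = _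
  rw [one_smul]
  rfl

/-- The jump of the derivative of a vector field along a curve, in a chart. -/
def jump (e : OpenPartialHomeomorph M (E n)) (c : ℝ → M) (X : (t : ℝ) → TangentSpace (I n) (c t))
    (t : ℝ) : E n :=
  derivWithin (coordField e c X) (Ici t) t - derivWithin (coordField e c X) (Iic t) t

theorem jump_eq_zero {e : OpenPartialHomeomorph M (E n)} {c : ℝ → M}
    {X : (t : ℝ) → TangentSpace (I n) (c t)} {t : ℝ}
    (h : DifferentiableAt ℝ (coordField e c X) t) : jump e c X t = 0 := by
  unfold jump
  rw [h.derivWithin (uniqueDiffOn_Ici t t self_mem_Ici),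
    h.derivWithin (uniqueDiffOn_Iic t t self_mem_Iic), sub_self]

theorem coordField_eq_zero {e : OpenPartialHomeomorph M (E n)} {c : ℝ → M}
    {X : (t : ℝ) → TangentSpace (I n) (c t)} {t : ℝ} (h : X t = 0) : coordField e c X t = 0 := by
  unfold coordField
  rw [h]
  exact map_zero (mfderiv (I n) (I n) e (c t))

variable [IsManifold (I n) ∞ M] {F : FinslerMetric n M} {e : OpenPartialHomeomorph M (E n)}
  {c : ℝ → M} {α : ℝ → ℝ → ℝ → M} {a b ε t : ℝ} {X Y : (t : ℝ) → TangentSpace (I n) (c t)}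

/-- The contribution of the jump at `t` to the second variation. -/
def FinslerMetric.jumpTerm (F : FinslerMetric n M) (p : ℝ) (c : ℝ → M)
    (X Y : (t : ℝ) → TangentSpace (I n) (c t)) (e : OpenPartialHomeomorph M (E n)) (t : ℝ) : ℝ :=
  F.hess e p c t (jump e c X t) (coordField e c Y t)

/-- The density of the second variation. -/
def FinslerMetric.jacobiDensity (F : FinslerMetric n M) (p : ℝ) (c : ℝ → M)
    (X Y : (t : ℝ) → TangentSpace (I n) (c t)) (e : OpenPartialHomeomorph M (E n)) (t : ℝ) : ℝ :=
  F.hess e p c t (F.jacobiOp e c (coordField e c X) t) (coordField e c Y t)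

/-- The second variation of the `p`-energy along a geodesic. -/
def FinslerMetric.indexForm (F : FinslerMetric n M) (p : ℝ) (c : ℝ → M)
    (X Y : (t : ℝ) → TangentSpace (I n) (c t)) : ℝ :=
  -(∑ᶠ t ∈ Ioo (0 : ℝ) 1, F.jumpTerm p c X Y (chartAt (E n) (c t)) t) -
    ∫ t in (0 : ℝ)..1, F.jacobiDensity p c X Y (chartAt (E n) (c t)) t

theorem hess_zero_left (p : ℝ) (v : E n) : F.hess e p c t 0 v = 0 := by simp [hess]

theorem hess_zero_right (p : ℝ) (v : E n) : F.hess e p c t v 0 = 0 := by simp [hess]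

theorem hess_sub_left (p : ℝ) (u v w : E n) :
    F.hess e p c t (u - v) w = F.hess e p c t u w - F.hess e p c t v w := by
  simp only [hess, ← Finset.sum_sub_distrib, PiLp.sub_apply]
  exact Finset.sum_congr rfl fun _ _ => Finset.sum_congr rfl fun _ _ => by ring

/-- Replaces the piece by a half-line, which makes the boundary terms, and with them the jump,
independent of the partition. -/
theorem derivWithin_Icc_left {V : Type*} [NormedAddCommGroup V] [NormedSpace ℝ V] (f : ℝ → V)
    (hab : a < b) : derivWithin f (Icc a b) a = derivWithin f (Ici a) a := by
  refine derivWithin_congr_set ?_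
  filter_upwards [Iio_mem_nhds hab] with s hs
  exact propext ⟨fun h => h.1, fun h => ⟨h, le_of_lt hs⟩⟩

theorem derivWithin_Icc_right {V : Type*} [NormedAddCommGroup V] [NormedSpace ℝ V] (f : ℝ → V)
    (hab : a < b) : derivWithin f (Icc a b) b = derivWithin f (Iic b) b := by
  refine derivWithin_congr_set ?_
  filter_upwards [Ioi_mem_nhds hab] with s hs
  exact propext ⟨fun h => h.2, fun h => ⟨le_of_lt hs, h⟩⟩

/-- The part of the boundary term of the second variation that depends on the variation only
through the curves `t = const`. -/
def FinslerMetric.cornerTerm (F : FinslerMetric n M) (p : ℝ) (c : ℝ → M)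
    (X Y : (t : ℝ) → TangentSpace (I n) (c t)) (α : ℝ → ℝ → ℝ → M)
    (e : OpenPartialHomeomorph M (E n)) (t : ℝ) : ℝ :=
  ∑ j, (deriv (fun s₁ => deriv (fun s₂ => e (α s₁ s₂ t)) 0) 0 j *
      dd (slit e) (bY j) (F.lag e p) (phase e c t) + coordField e c Y t j *
      dd (slit e) (coordField e c X t, 0) (dd (slit e) (bY j) (F.lag e p)) (phase e c t))

/-- At an endpoint of the curves the family is constant in (s₁, s₂) and Y vanishes. -/
theorem cornerTerm_eq_zero {x : M} (hε : 0 < ε) (p : ℝ)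
    (hα : ∀ s₁ ∈ Ioo (-ε) ε, ∀ s₂ ∈ Ioo (-ε) ε, α s₁ s₂ t = x) (hY : Y t = 0) :
    F.cornerTerm p c X Y α e t = 0 := by
  have hnhd : Ioo (-ε) ε ∈ 𝓝 (0 : ℝ) := Ioo_mem_nhds (by linarith) hε
  have h1 : (fun s₁ => deriv (fun s₂ => e (α s₁ s₂ t)) 0) =ᶠ[𝓝 0] fun _ => 0 := by
    filter_upwards [hnhd] with s₁ h1
    have h2 : (fun s₂ => e (α s₁ s₂ t)) =ᶠ[𝓝 0] fun _ => e x := by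
      filter_upwards [hnhd] with s₂ h2
      rw [hα s₁ h1 s₂ h2]
    rw [h2.deriv_eq, deriv_const]
  unfold cornerTerm
  rw [h1.deriv_eq, deriv_const, coordField_eq_zero hY]
  simp

namespace VariationPiece

theorem dd_left (h : VariationPiece F c X Y α a b ε) (p : ℝ) :
    dd (slab a b) d1 (F.famPairing p α a b) (0, 0, a) =
      F.cornerTerm p c X Y α (chartAt (E n) (c a)) a +
      F.hess (chartAt (E n) (c a)) p c a
        (derivWithin (coordField (chartAt (E n) (c a)) c X) (Ici a) a)
        (coordField (chartAt (E n) (c a)) c Y a) := by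
  rw [h.dd_boundary (chart_mem_atlas _ (c a)) p (left_mem_Icc.2 h.lt.le) (mem_chart_source _ _),
    derivWithin_Icc_left _ h.lt]
  rfl

theorem dd_right (h : VariationPiece F c X Y α a b ε) (p : ℝ) :
    dd (slab a b) d1 (F.famPairing p α a b) (0, 0, b) =
      F.cornerTerm p c X Y α (chartAt (E n) (c b)) b +
      F.hess (chartAt (E n) (c b)) p c b
        (derivWithin (coordField (chartAt (E n) (c b)) c X) (Iic b) b)
        (coordField (chartAt (E n) (c b)) c Y b) := by
  rw [h.dd_boundary (chart_mem_atlas _ (c b)) p (right_mem_Icc.2 h.lt.le) (mem_chart_source _ _),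
    derivWithin_Icc_right _ h.lt]
  rfl

/-- Chart independence without a transformation law: by `dd_interior` the density in either chart
equals the same chart-free derivative. -/
theorem density_eq (h : VariationPiece F c X Y α a b ε) (he : e ∈ atlas (E n) M) (p : ℝ)
    (ht : t ∈ Ioo a b) (hs : c t ∈ e.source) :
    F.jacobiDensity p c X Y (chartAt (E n) (c t)) t = F.jacobiDensity p c X Y e t :=
  (h.dd_interior (chart_mem_atlas _ (c t)) p ht (mem_chart_source _ _)).symm.trans
    (h.dd_interior he p ht hs)

theorem jumpTerm_eq_zero (h : VariationPiece F c X Y α a b ε) (p : ℝ) (ht : t ∈ Ioo a b) :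
    F.jumpTerm p c X Y (chartAt (E n) (c t)) t = 0 := by
  have h1 := h.contDiffWithinAt_coordField (chart_mem_atlas (E n) (c t))
    (Ioo_subset_Icc_self ht) (mem_chart_source _ _)
  unfold jumpTerm
  rw [jump_eq_zero ((h1.contDiffAt (Icc_mem_nhds ht.1 ht.2)).differentiableAt (by simp)),
    hess_zero_left]

theorem intervalIntegrable_famLag (h : VariationPiece F c X Y α a b ε) (p : ℝ) :
    ∀ᶠ z in 𝓝 ((0 : ℝ), (0 : ℝ)), IntervalIntegrable
      (fun t => F.famLag p α a b (z.1, z.2, t)) MeasureTheory.volume a b := by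
  obtain ⟨δ, hδ, hs⟩ := (h.smoothNear_famLag p).exists_box
  have h0 : Ioo (-δ) δ ∈ 𝓝 (0 : ℝ) := Ioo_mem_nhds (by linarith) hδ
  filter_upwards [prod_mem_nhds h0 h0] with z hz
  refine ContinuousOn.intervalIntegrable ?_
  rw [uIcc_of_le h.lt.le]
  exact hs.continuousOn.comp (f := fun t => (z.1, z.2, t)) (by fun_prop)
    fun t ht => ⟨ht, hz.1, hz.2, mem_univ _⟩

/-- The integrand of the `p`-energy. -/
theorem energy_integrand (h : VariationPiece F c X Y α a b ε) (p : ℝ) {s₁ s₂ : ℝ}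
    (h₁ : s₁ ∈ Ioo (-ε) ε) (h₂ : s₂ ∈ Ioo (-ε) ε) (ht : t ∈ Ioo a b) :
    fundamentalTensor F.toFun (α s₁ s₂ t) (mfderiv 𝓘(ℝ, ℝ) (I n) (α s₁ s₂) t (1 : ℝ))
      (mfderiv 𝓘(ℝ, ℝ) (I n) (α s₁ s₂) t (1 : ℝ)) (mfderiv 𝓘(ℝ, ℝ) (I n) (α s₁ s₂) t (1 : ℝ)) ^
        (p / 2) = F.famLag p α a b (s₁, s₂, t) := by
  have ht' := Ioo_subset_Icc_self ht
  have hfin : mfderiv 𝓘(ℝ, ℝ) (I n) (α s₁ s₂) t (1 : ℝ) = velVec α a b (s₁, s₂, t) := by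
    rw [← mfderivWithin_fam h.lt h.smooth h₁ h₂ ht', mfderivWithin_of_mem_nhds
      (Icc_mem_nhds ht.1 ht.2)]
  rw [fundamentalTensor_self, hfin]
  rfl

end VariationPiece

theorem IsVariation.exists_pieces {x₀ x₁ : M} (hc : F.IsGeodesic c)
    (hv : IsVariation x₀ x₁ c X Y ε α) :
    ∃ k a, NatPartition k a ∧ ∀ i < k, VariationPiece F c X Y α (a i) (a (i + 1)) ε := by
  obtain ⟨k, τ, hτ, hsm⟩ := hv.smooth
  obtain ⟨a, ha, haτ⟩ := hτ.exists_nat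
  refine ⟨k, a, ha, fun i hi =>
    ⟨hc, hv.pos, ha.lt i hi, ha.subset hi, ?_, hv.base, hv.field₁, hv.field₂⟩⟩
  have := hsm ⟨i, hi⟩
  rw [(haτ ⟨i, hi⟩).1, (haτ ⟨i, hi⟩).2] at this
  exact this.mono fun q hq => ⟨hq.2.1, hq.2.2.1, hq.1⟩

/-- The second variation formula. -/
theorem hasMixedDerivAtZero_energy {x₀ x₁ : M} (hc : F.IsGeodesic c) (p : ℝ)
    (hY0 : Y 0 = 0) (hY1 : Y 1 = 0) (hv : IsVariation x₀ x₁ c X Y ε α) :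
    HasMixedDerivAtZero (fun s₁ s₂ => F.energy p (α s₁ s₂)) (F.indexForm p c X Y) := by
  obtain ⟨k, a, ha, hpc⟩ := hv.exists_pieces hc
  have hbnd : Ioo (-ε) ε ∈ 𝓝 (0 : ℝ) := Ioo_mem_nhds (by linarith [hv.pos]) hv.pos
  -- the sum over the pieces
  have hsum := HasMixedDerivAtZero.sum (s := Finset.range k)
    (f := fun i s₁ s₂ => ∫ t in a i..a (i + 1), F.famLag p α (a i) (a (i + 1)) (s₁, s₂, t))
    fun i hi => hasMixedDerivAtZero_integral (ha.lt i (Finset.mem_range.1 hi))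
      ((hpc i (Finset.mem_range.1 hi)).smoothNear_famLag p)
      ((hpc i (Finset.mem_range.1 hi)).smoothNear_famPairing p)
  have hval : ∑ i ∈ Finset.range k, (dd (slab (a i) (a (i + 1))) d1
        (F.famPairing p α (a i) (a (i + 1))) (0, 0, a (i + 1)) -
      dd (slab (a i) (a (i + 1))) d1 (F.famPairing p α (a i) (a (i + 1))) (0, 0, a i) -
      ∫ t in a i..a (i + 1), dd (slab (a i) (a (i + 1))) d1 (fun q =>
        dd (slab (a i) (a (i + 1))) d3 (F.famPairing p α (a i) (a (i + 1))) q -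
        dd (slab (a i) (a (i + 1))) d2 (F.famLag p α (a i) (a (i + 1))) q) (0, 0, t)) =
      F.indexForm p c X Y := by
    rw [Finset.sum_sub_distrib]
    unfold indexForm
    congr 1
    -- P and Q are the boundary terms from the left and from the right at t, both in the chart at
    -- c(t); their corner terms coincide.
    · set P : ℝ → ℝ := fun t => F.cornerTerm p c X Y α (chartAt (E n) (c t)) t +
        F.hess (chartAt (E n) (c t)) p c t
          (derivWithin (coordField (chartAt (E n) (c t)) c X) (Iic t) t)
          (coordField (chartAt (E n) (c t)) c Y t) with hP
      set Q : ℝ → ℝ := fun t => F.cornerTerm p c X Y α (chartAt (E n) (c t)) t +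
        F.hess (chartAt (E n) (c t)) p c t
          (derivWithin (coordField (chartAt (E n) (c t)) c X) (Ici t) t)
          (coordField (chartAt (E n) (c t)) c Y t) with hQ
      have h1 : ∀ i ∈ Finset.range k, dd (slab (a i) (a (i + 1))) d1
            (F.famPairing p α (a i) (a (i + 1))) (0, 0, a (i + 1)) -
          dd (slab (a i) (a (i + 1))) d1 (F.famPairing p α (a i) (a (i + 1))) (0, 0, a i) =
          P (a (i + 1)) - Q (a i) := fun i hi => by
        rw [(hpc i (Finset.mem_range.1 hi)).dd_left p, (hpc i (Finset.mem_range.1 hi)).dd_right p]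
      rw [Finset.sum_congr rfl h1, Finset.sum_sub_distrib]
      obtain ⟨m, rfl⟩ : ∃ m, k = m + 1 := ⟨k - 1, by have := ha.pos; omega⟩
      -- The last P and the first Q belong to t = 1 and t = 0 and vanish; the others pair up at the
      -- inner break points.
      rw [Finset.sum_range_succ, Finset.sum_range_succ']
      have hP1 : P (a (m + 1)) = 0 := by
        rw [ha.last, hP]
        dsimp only
        rw [cornerTerm_eq_zero (x := x₁) hv.pos p (fun s₁ h1 s₂ h2 => (hv.mem s₁ h1 s₂ h2).2.1) hY1,
          coordField_eq_zero hY1, hess_zero_right, add_zero]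
      have hQ0 : Q (a 0) = 0 := by
        rw [ha.zero, hQ]
        dsimp only
        rw [cornerTerm_eq_zero (x := x₀) hv.pos p (fun s₁ h1 s₂ h2 => (hv.mem s₁ h1 s₂ h2).1) hY0,
          coordField_eq_zero hY0, hess_zero_right, add_zero]
      rw [hP1, hQ0, add_zero, add_zero, ← Finset.sum_sub_distrib]
      have h2 : ∀ i ∈ Finset.range m, P (a (i + 1)) - Q (a (i + 1)) =
          -F.jumpTerm p c X Y (chartAt (E n) (c (a (i + 1)))) (a (i + 1)) := fun i _ => by
        simp only [hP, hQ, jumpTerm, jump, hess_sub_left]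
        ring
      rw [Finset.sum_congr rfl h2, Finset.sum_neg_distrib]
      congr 1
      have hinj : Set.InjOn (fun i => a (i + 1)) (Finset.range m : Set ℕ) := by
        intro i hi j hj hij
        simp only [Finset.coe_range, mem_Iio] at hi hj
        rcases lt_trichotomy i j with h | h | h
        · exact absurd hij (ha.lt_of_lt (by omega) (by omega)).ne
        · exact h
        · exact absurd hij (ha.lt_of_lt (by omega) (by omega)).ne'
      rw [← Finset.sum_image (f := fun t => F.jumpTerm p c X Y (chartAt (E n) (c t)) t) hinj]
      symm
      -- The sum over all times in (0, 1) is supported on the inner break points, since X is smooth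
      -- inside each piece.
      refine finsum_mem_eq_sum_of_subset _ ?_ ?_
      · rintro t ⟨ht, hts⟩
        rw [Function.mem_support] at hts
        obtain ⟨i, hi, hi1, hi2⟩ := exists_mem_piece (a := a) (t := t) (k := m + 1)
          (by rw [ha.zero]; exact ht.1.le) (by rw [ha.last]; exact ht.2)
        rcases hi1.eq_or_lt with h | h
        · rcases Nat.eq_zero_or_pos i with rfl | hpos
          · rw [ha.zero] at h
            exact absurd h ht.1.ne
          · simp only [Finset.coe_image, Finset.coe_range, mem_image, mem_Iio]
            exact ⟨i - 1, by omega, by rw [← h]; congr 1; omega⟩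
        · exact absurd ((hpc i hi).jumpTerm_eq_zero p ⟨h, hi2⟩) hts
      · intro t ht
        simp only [Finset.coe_image, Finset.coe_range, mem_image, mem_Iio] at ht
        obtain ⟨i, hi, rfl⟩ := ht
        exact ⟨ha.zero ▸ ha.lt_of_lt (Nat.succ_pos i) (by omega),
          ha.last ▸ ha.lt_of_lt (by omega) le_rfl⟩
    · have h1 : ∀ i < k, EqOn (fun t => dd (slab (a i) (a (i + 1))) d1 (fun q =>
          dd (slab (a i) (a (i + 1))) d3 (F.famPairing p α (a i) (a (i + 1))) q -
          dd (slab (a i) (a (i + 1))) d2 (F.famLag p α (a i) (a (i + 1))) q) (0, 0, t))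
          (fun t => F.jacobiDensity p c X Y (chartAt (E n) (c t)) t) (Ioo (a i) (a (i + 1))) :=
        fun i hi t ht =>
          (hpc i hi).dd_interior (chart_mem_atlas (E n) (c t)) p ht (mem_chart_source _ _)
      have h2 : ∀ i < k, IntervalIntegrable
          (fun t => F.jacobiDensity p c X Y (chartAt (E n) (c t)) t) MeasureTheory.volume
          (a i) (a (i + 1)) := fun i hi => by
        refine IntervalIntegrable.congr_uIoo ?_ (by
          rw [uIoo_of_le (ha.lt i hi).le]; exact h1 i hi)
        refine ContinuousOn.intervalIntegrable ?_
        rw [uIcc_of_le (ha.lt i hi).le]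
        exact SmoothNear.continuousOn_dd (ha.lt i hi) ((hpc i hi).smoothNear_famLag p)
          ((hpc i hi).smoothNear_famPairing p)
      have h3 := intervalIntegral.sum_integral_adjacent_intervals h2
      rw [ha.zero, ha.last] at h3
      rw [← h3]
      refine Finset.sum_congr rfl fun i hi => ?_
      exact intervalIntegral.integral_congr_Ioo_of_le (ha.lt i (Finset.mem_range.1 hi)).le
        (h1 i (Finset.mem_range.1 hi))
  rw [hval] at hsum
  refine hsum.congr ?_
  have hint : ∀ᶠ z in 𝓝 ((0 : ℝ), (0 : ℝ)), ∀ i ∈ Finset.range k, IntervalIntegrable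
      (fun t => F.famLag p α (a i) (a (i + 1)) (z.1, z.2, t)) MeasureTheory.volume
      (a i) (a (i + 1)) := (Filter.eventually_all_finset _).2 fun i hi =>
    (hpc i (Finset.mem_range.1 hi)).intervalIntegrable_famLag p
  filter_upwards [hint, prod_mem_nhds hbnd hbnd] with z hz hzb
  -- The energy uses two-sided derivatives, which are known to be the velocities of the pieces only
  -- off the break points; this suffices for the integral.
  have hE : ∀ i < k, EqOn (fun t => F.famLag p α (a i) (a (i + 1)) (z.1, z.2, t))
      (fun t => fundamentalTensor F.toFun (α z.1 z.2 t)
        (mfderiv 𝓘(ℝ, ℝ) (I n) (α z.1 z.2) t (1 : ℝ))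
        (mfderiv 𝓘(ℝ, ℝ) (I n) (α z.1 z.2) t (1 : ℝ))
        (mfderiv 𝓘(ℝ, ℝ) (I n) (α z.1 z.2) t (1 : ℝ)) ^ (p / 2)) (Ioo (a i) (a (i + 1))) :=
    fun i hi t ht => ((hpc i hi).energy_integrand p hzb.1 hzb.2 ht).symm
  have h3 := intervalIntegral.sum_integral_adjacent_intervals (n := k) fun i hi =>
    (hz i (Finset.mem_range.2 hi)).congr_uIoo (by
      rw [uIoo_of_le (ha.lt i hi).le]; exact hE i hi)
  rw [ha.zero, ha.last] at h3
  unfold energy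
  rw [← h3]
  refine Finset.sum_congr rfl fun i hi => ?_
  exact (intervalIntegral.integral_congr_Ioo_of_le (ha.lt i (Finset.mem_range.1 hi)).le
    (hE i (Finset.mem_range.1 hi))).symm

end Formula

end FinslerPEnergy

namespace FinslerPEnergy

/-! ### Existence of variations -/

/-- A hereditary property of intervals that holds locally to the right and to the left of each
point holds on the pieces of some partition. -/
theorem exists_natPartition {P : ℝ → ℝ → Prop}
    (hmono : ∀ a b a' b', a ≤ a' → b' ≤ b → P a b → P a' b')
    (hright : ∀ t ∈ Ico (0 : ℝ) 1, ∃ u ∈ Ioc t 1, P t u)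
    (hleft : ∀ t ∈ Ioc (0 : ℝ) 1, ∃ u ∈ Ico 0 t, P u t) :
    ∃ k a, NatPartition k a ∧ ∀ i < k, P (a i) (a (i + 1)) := by
  -- Connectedness argument: Q s says that [0, s] has a good partition. The supremum of such s has
  -- the property by `hleft`, and equals 1 by `hright`.
  set Q : ℝ → Prop := fun s => ∃ (k : ℕ) (a : ℕ → ℝ), a 0 = 0 ∧ a k = s ∧
    ∀ i < k, a i < a (i + 1) ∧ P (a i) (a (i + 1)) with hQ
  have hext : ∀ s u, Q s → s < u → P s u → Q u := by
    rintro s u ⟨k, a, h0, hk, ha⟩ hsu hP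
    refine ⟨k + 1, Function.update a (k + 1) u, ?_, by simp, fun i hi => ?_⟩
    · rw [Function.update_of_ne (by omega), h0]
    · rcases (Nat.lt_succ_iff.1 hi).eq_or_lt with rfl | h
      · rw [Function.update_of_ne (by omega), Function.update_self, hk]
        exact ⟨hsu, hP⟩
      · rw [Function.update_of_ne (by omega), Function.update_of_ne (by omega)]
        exact ha i h
  set S : Set ℝ := {s ∈ Icc (0 : ℝ) 1 | Q s} with hS
  have h0S : (0 : ℝ) ∈ S := ⟨⟨le_rfl, zero_le_one⟩, 0, fun _ => 0, rfl, rfl, fun i hi => by omega⟩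
  have hbdd : BddAbove S := ⟨1, fun s hs => hs.1.2⟩
  have hσ : sSup S ∈ Icc (0 : ℝ) 1 := ⟨le_csSup hbdd h0S, csSup_le ⟨0, h0S⟩ fun s hs => hs.1.2⟩
  have hQσ : Q (sSup S) := by
    rcases hσ.1.eq_or_lt with h | h
    · rw [← h]; exact h0S.2
    · obtain ⟨u, hu, hP⟩ := hleft _ ⟨h, hσ.2⟩
      obtain ⟨s, hs, hus⟩ := exists_lt_of_lt_csSup ⟨0, h0S⟩ hu.2
      rcases (le_csSup hbdd hs).eq_or_lt with h' | h'
      · rw [← h']; exact hs.2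
      · exact hext s _ hs.2 h' (hmono _ _ _ _ hus.le le_rfl hP)
  have hone : sSup S = 1 := by
    by_contra hne
    obtain ⟨u, hu, hP⟩ := hright _ ⟨hσ.1, lt_of_le_of_ne hσ.2 hne⟩
    exact absurd (le_csSup hbdd ⟨⟨hσ.1.trans hu.1.le, hu.2⟩, hext _ _ hQσ hu.1 hP⟩)
      (not_le.2 hu.1)
  rw [hone] at hQσ
  obtain ⟨k, a, h0, hk, ha⟩ := hQσ
  exact ⟨k, a, ⟨h0, hk, fun i hi => (ha i hi).1⟩, fun i hi => (ha i hi).2⟩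

theorem exists_mem_piece' {a : ℕ → ℝ} {t : ℝ} : ∀ {k : ℕ}, a 0 < t → t ≤ a k →
    ∃ i < k, a i < t ∧ t ≤ a (i + 1)
  | 0, h0, hk => absurd hk (not_le.2 h0)
  | k + 1, h0, hk => by
    rcases le_or_gt t (a k) with h | h
    · obtain ⟨i, hi, h⟩ := exists_mem_piece' h0 h
      exact ⟨i, hi.trans (Nat.lt_succ_self k), h⟩
    · exact ⟨k, Nat.lt_succ_self k, h, hk⟩

section Existence

open FinslerMetric

variable {n : ℕ} {M : Type*} [TopologicalSpace M] [ChartedSpace (E n) M]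

theorem exists_right_left_of_pieces {k : ℕ} {a : ℕ → ℝ} (ha : NatPartition k a)
    {P : ℝ → ℝ → Prop} (h : ∀ i < k, P (a i) (a (i + 1)))
    (hmono : ∀ a b a' b', a ≤ a' → b' ≤ b → P a b → P a' b') :
    (∀ t ∈ Ico (0 : ℝ) 1, ∃ u ∈ Ioc t 1, P t u) ∧ (∀ t ∈ Ioc (0 : ℝ) 1, ∃ u ∈ Ico 0 t, P u t) := by
  constructor
  · intro t ht
    obtain ⟨i, hi, h1, h2⟩ := exists_mem_piece (a := a) (t := t) (k := k)
      (by rw [ha.zero]; exact ht.1) (by rw [ha.last]; exact ht.2)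
    exact ⟨a (i + 1), ⟨h2, (ha.mem hi).2⟩, hmono _ _ _ _ h1 le_rfl (h i hi)⟩
  · intro t ht
    obtain ⟨i, hi, h1, h2⟩ := exists_mem_piece' (a := a) (t := t) (k := k)
      (by rw [ha.zero]; exact ht.1) (by rw [ha.last]; exact ht.2)
    exact ⟨a i, ⟨(ha.mem hi.le).1, h1⟩, hmono _ _ _ _ le_rfl h2 (h i hi)⟩

variable [IsManifold (I n) ∞ M] {F : FinslerMetric n M} {e : OpenPartialHomeomorph M (E n)}
  {c : ℝ → M} {a b ε t : ℝ} {X Y : (t : ℝ) → TangentSpace (I n) (c t)}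

/-- The vector field `X` along `c` is smooth on `[a, b]`. -/
def SmoothField (c : ℝ → M) (X : (t : ℝ) → TangentSpace (I n) (c t)) (a b : ℝ) : Prop :=
  ContMDiffOn 𝓘(ℝ, ℝ) (I n).tangent ∞
    (fun t => (⟨c t, X t⟩ : TangentBundle (I n) M)) (Icc a b)

theorem exists_smoothField_partition (hX : X ∈ tangentPathSpace c) :
    ∃ k a, NatPartition k a ∧ ∀ i < k, SmoothField c X (a i) (a (i + 1)) := by
  obtain ⟨-, -, -, k, τ, hτ, h⟩ := hX
  obtain ⟨a, ha, haτ⟩ := hτ.exists_nat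
  refine ⟨k, a, ha, fun i hi => ?_⟩
  have := h ⟨i, hi⟩
  rw [(haτ ⟨i, hi⟩).1, (haτ ⟨i, hi⟩).2] at this
  exact this

theorem exists_smoothField_right_left (hX : X ∈ tangentPathSpace c) :
    (∀ t ∈ Ico (0 : ℝ) 1, ∃ u ∈ Ioc t 1, SmoothField c X t u) ∧
    (∀ t ∈ Ioc (0 : ℝ) 1, ∃ u ∈ Ico 0 t, SmoothField c X u t) := by
  obtain ⟨k, a, ha, h⟩ := exists_smoothField_partition hX
  exact exists_right_left_of_pieces ha h
    fun _ _ _ _ h1 h2 h => ContMDiffOn.mono h (Icc_subset_Icc h1 h2)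

/-- A partition adapted to two vector fields along a curve. -/
theorem exists_adapted_partition (hc : ContinuousOn c (Icc 0 1))
    (hX : X ∈ tangentPathSpace c) (hY : Y ∈ tangentPathSpace c) :
    ∃ k a, NatPartition k a ∧ ∀ i < k, SmoothField c X (a i) (a (i + 1)) ∧
      SmoothField c Y (a i) (a (i + 1)) ∧
      ∃ e ∈ atlas (E n) M, ∀ t ∈ Icc (a i) (a (i + 1)), c t ∈ e.source := by
  have hcs : ∀ t ∈ Icc (0 : ℝ) 1, ∃ δ > 0, ∀ s ∈ Icc (0 : ℝ) 1, |s - t| < δ →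
      c s ∈ (chartAt (E n) (c t)).source := fun t ht => by
    have := (hc t ht).eventually
      ((chartAt (E n) (c t)).open_source.mem_nhds (mem_chart_source _ (c t)))
    obtain ⟨δ, hδ, h⟩ := Metric.eventually_nhds_iff.1 (eventually_nhdsWithin_iff.1 this)
    exact ⟨δ, hδ, fun s hs hst => h (by rwa [Real.dist_eq]) hs⟩
  refine exists_natPartition (P := fun a b => SmoothField c X a b ∧ SmoothField c Y a b ∧
    ∃ e ∈ atlas (E n) M, ∀ t ∈ Icc a b, c t ∈ e.source) ?_ ?_ ?_
  · rintro a b a' b' h1 h2 ⟨hX, hY, e, he, hs⟩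
    exact ⟨hX.mono (Icc_subset_Icc h1 h2), hY.mono (Icc_subset_Icc h1 h2), e, he,
      fun t ht => hs t (Icc_subset_Icc h1 h2 ht)⟩
  · intro t ht
    obtain ⟨u, hu, hXu⟩ := (exists_smoothField_right_left hX).1 t ht
    obtain ⟨v, hv, hYv⟩ := (exists_smoothField_right_left hY).1 t ht
    obtain ⟨δ, hδ, hs⟩ := hcs t ⟨ht.1, ht.2.le⟩
    have hw1 : min (min u v) (t + δ / 2) ≤ u := (min_le_left _ _).trans (min_le_left _ _)
    have hw2 : min (min u v) (t + δ / 2) ≤ v := (min_le_left _ _).trans (min_le_right _ _)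
    have hw3 : min (min u v) (t + δ / 2) ≤ t + δ / 2 := min_le_right _ _
    refine ⟨min (min u v) (t + δ / 2), ⟨lt_min (lt_min hu.1 hv.1) (by linarith), hw1.trans hu.2⟩,
      hXu.mono (Icc_subset_Icc le_rfl hw1), hYv.mono (Icc_subset_Icc le_rfl hw2),
      _, chart_mem_atlas _ (c t), fun s hs' => hs s ⟨ht.1.trans hs'.1, ?_⟩ ?_⟩
    · exact hs'.2.trans (hw1.trans hu.2)
    · rw [abs_of_nonneg (by linarith [hs'.1])]
      linarith [hs'.2]
  · intro t ht
    obtain ⟨u, hu, hXu⟩ := (exists_smoothField_right_left hX).2 t ht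
    obtain ⟨v, hv, hYv⟩ := (exists_smoothField_right_left hY).2 t ht
    obtain ⟨δ, hδ, hs⟩ := hcs t ⟨ht.1.le, ht.2⟩
    have hw1 : u ≤ max (max u v) (t - δ / 2) := (le_max_left _ _).trans (le_max_left _ _)
    have hw2 : v ≤ max (max u v) (t - δ / 2) := (le_max_right _ _).trans (le_max_left _ _)
    have hw3 : t - δ / 2 ≤ max (max u v) (t - δ / 2) := le_max_right _ _
    refine ⟨max (max u v) (t - δ / 2), ⟨hu.1.trans hw1, max_lt (max_lt hu.2 hv.2) (by linarith)⟩,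
      hXu.mono (Icc_subset_Icc hw1 le_rfl), hYv.mono (Icc_subset_Icc hw2 le_rfl),
      _, chart_mem_atlas _ (c t), fun s hs' => hs s ⟨?_, hs'.2.trans ht.2⟩ ?_⟩
    · exact (hu.1.trans hw1).trans hs'.1
    · rw [abs_of_nonpos (by linarith [hs'.2])]
      linarith [hs'.1]

theorem mfderiv_chart_symm_comp (he : e ∈ atlas (E n) M) {x : ℝ → E n} {v : E n}
    (hx : HasDerivAt x v 0) (h0 : x 0 ∈ e.target) :
    (⟨e.symm (x 0), mfderiv 𝓘(ℝ, ℝ) (I n) (fun s => e.symm (x s)) 0 (1 : ℝ)⟩ :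
      TangentBundle (I n) M) = vecOfCoords e (x 0, v) := by
  have h1 := ((mdiff_chart he).mdifferentiableAt_symm h0).hasMFDerivAt.comp (0 : ℝ)
    hx.hasFDerivAt.hasMFDerivAt
  unfold vecOfCoords coordVec
  congr 1
  have h2 : mfderiv 𝓘(ℝ, ℝ) (I n) (fun s => e.symm (x s)) 0 = _ := h1.mfderiv
  rw [h2]
  change mfderiv (I n) (I n) e.symm (x 0) ((1 : ℝ) • v) = _
  rw [one_smul]

theorem vecOfCoords_coordField (he : e ∈ atlas (E n) M) (hs : c t ∈ e.source) :
    vecOfCoords e (e (c t), coordField e c X t) = ⟨c t, X t⟩ := coordVec_mfderiv he hs (X t)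

theorem contDiffOn_coords_of_smoothField (he : e ∈ atlas (E n) M)
    (hs : ∀ t ∈ Icc a b, c t ∈ e.source) (hX : SmoothField c X a b) :
    ContDiffOn ℝ ∞ (fun t => e (c t)) (Icc a b) ∧ ContDiffOn ℝ ∞ (coordField e c X) (Icc a b) := by
  have h : ContDiffOn ℝ ∞ (fun t => (e (c t), coordField e c X t)) (Icc a b) :=
    contMDiffOn_iff_contDiffOn.1 ((contMDiffOn_coordsOfVec he).comp hX fun t ht => hs t ht)
  exact ⟨contDiff_fst.comp_contDiffOn h, contDiff_snd.comp_contDiffOn h⟩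

theorem hasDerivAt_chart_of_field (he : e ∈ atlas (E n) M) {γ : ℝ → M}
    (hγ : ContMDiffAt 𝓘(ℝ, ℝ) (I n) ∞ γ 0) (hs : γ 0 ∈ e.source)
    (h : (⟨γ 0, mfderiv 𝓘(ℝ, ℝ) (I n) γ 0 (1 : ℝ)⟩ : TangentBundle (I n) M) = ⟨c t, X t⟩) :
    HasDerivAt (fun s => e (γ s)) (coordField e c X t) 0 := by
  rw [coordField_eq_deriv he (hγ.mdifferentiableAt (by simp)) hs h]
  exact ((contDiffWithinAt_chart_comp he (S := univ) hγ hs).contDiffAt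
    univ_mem).differentiableAt (by simp) |>.hasDerivAt

/-- Extension of a family of points to a family of curves with given variation fields,
inside a chart. -/
theorem exists_family_in_chart (he : e ∈ atlas (E n) M) (hab : a < b)
    (hs : ∀ t ∈ Icc a b, c t ∈ e.source) (hX : SmoothField c X a b) (hY : SmoothField c Y a b)
    {β : ℝ → ℝ → M} (hε : 0 < ε)
    (hβ : ContMDiffOn 𝓘(ℝ, ℝ × ℝ × ℝ) (I n) ∞ (fun q : ℝ × ℝ × ℝ => β q.1 q.2.1) (box ε))
    (h₁ : (⟨β 0 0, mfderiv 𝓘(ℝ, ℝ) (I n) (fun s => β s 0) 0 (1 : ℝ)⟩ : TangentBundle (I n) M) =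
      ⟨c a, X a⟩)
    (h₂ : (⟨β 0 0, mfderiv 𝓘(ℝ, ℝ) (I n) (fun s => β 0 s) 0 (1 : ℝ)⟩ : TangentBundle (I n) M) =
      ⟨c a, Y a⟩) :
    ∃ (δ : ℝ) (γ : ℝ → ℝ → ℝ → M), 0 < δ ∧ δ ≤ ε ∧
      ContMDiffOn 𝓘(ℝ, ℝ × ℝ × ℝ) (I n) ∞ (fam γ) (slab a b ∩ box δ) ∧
      (∀ s₁ ∈ Ioo (-δ) δ, ∀ s₂ ∈ Ioo (-δ) δ, γ s₁ s₂ a = β s₁ s₂) ∧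
      (∀ t ∈ Icc a b, γ 0 0 t = c t) ∧
      (∀ t ∈ Icc a b, (⟨γ 0 0 t, mfderiv 𝓘(ℝ, ℝ) (I n) (fun s => γ s 0 t) 0 (1 : ℝ)⟩ :
        TangentBundle (I n) M) = ⟨c t, X t⟩) ∧
      (∀ t ∈ Icc a b, (⟨γ 0 0 t, mfderiv 𝓘(ℝ, ℝ) (I n) (fun s => γ 0 s t) 0 (1 : ℝ)⟩ :
        TangentBundle (I n) M) = ⟨c t, Y t⟩) ∧
      (X b = 0 → Y b = 0 → ∀ s₁ s₂, γ s₁ s₂ b = c b) := by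
  have ha : a ∈ Icc a b := left_mem_Icc.2 hab.le
  have hb : b ∈ Icc a b := right_mem_Icc.2 hab.le
  have h0 : β 0 0 = c a := congrArg Bundle.TotalSpace.proj h₁
  have hz : (0 : ℝ) ∈ Ioo (-ε) ε := ⟨by linarith, hε⟩
  obtain ⟨hec, hξ⟩ := contDiffOn_coords_of_smoothField he hs hX
  obtain ⟨-, hη⟩ := contDiffOn_coords_of_smoothField he hs hY
  set ξ := coordField e c X with hξdef
  set η := coordField e c Y with hηdef
  -- The deviation of β from the first-order family at t = a. It vanishes at 0 together with both
  -- first derivatives, so adding a multiple of it in x does not change the variation fields; the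
  -- weight (b - t)/(b - a) makes x start at β and leaves no correction at t = b.
  set r : ℝ → ℝ → E n := fun s₁ s₂ => e (β s₁ s₂) - e (c a) - s₁ • ξ a - s₂ • η a with hr
  set x : ℝ → ℝ → ℝ → E n := fun s₁ s₂ t =>
    e (c t) + s₁ • ξ t + s₂ • η t + ((b - t) / (b - a)) • r s₁ s₂ with hx
  have hr0 : r 0 0 = 0 := by simp [hr, h0]
  have hx0 : ∀ t, x 0 0 t = e (c t) := fun t => by simp [hx, hr0]
  have hxa : ∀ s₁ s₂, x s₁ s₂ a = e (β s₁ s₂) := fun s₁ s₂ => by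
    simp only [hx, hr]
    rw [div_self (sub_ne_zero.2 hab.ne'), one_smul]
    abel
  have hβ₁ : ContMDiffAt 𝓘(ℝ, ℝ) (I n) ∞ (fun s => β s 0) 0 := by
    have hl : ContDiff ℝ ∞ (fun s : ℝ => (s, (0 : ℝ), (0 : ℝ))) := by fun_prop
    exact (hβ.contMDiffAt ((isOpen_box ε).mem_nhds ⟨hz, hz, mem_univ _⟩)).comp (0 : ℝ)
      hl.contMDiff.contMDiffAt
  have hβ₂ : ContMDiffAt 𝓘(ℝ, ℝ) (I n) ∞ (fun s => β 0 s) 0 := by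
    have hl : ContDiff ℝ ∞ (fun s : ℝ => ((0 : ℝ), s, (0 : ℝ))) := by fun_prop
    exact (hβ.contMDiffAt ((isOpen_box ε).mem_nhds ⟨hz, hz, mem_univ _⟩)).comp (0 : ℝ)
      hl.contMDiff.contMDiffAt
  have hβs : β 0 0 ∈ e.source := h0 ▸ hs a ha
  have hr₁ : HasDerivAt (fun s => r s 0) 0 0 :=
    ((((hasDerivAt_chart_of_field he hβ₁ hβs h₁).sub_const (e (c a))).fun_sub
      ((hasDerivAt_id' (0 : ℝ)).smul_const (ξ a))).sub_const ((0 : ℝ) • η a)).congr_deriv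
        (by rw [one_smul, sub_self])
  have hr₂ : HasDerivAt (fun s => r 0 s) 0 0 :=
    (((hasDerivAt_chart_of_field he hβ₂ hβs h₂).sub_const (e (c a))).sub_const
      ((0 : ℝ) • ξ a)).fun_sub ((hasDerivAt_id' (0 : ℝ)).smul_const (η a)) |>.congr_deriv
        (by rw [one_smul, sub_self])
  have hx₁ : ∀ t, HasDerivAt (fun s => x s 0 t) (ξ t) 0 := fun t =>
    ((((hasDerivAt_id' (0 : ℝ)).smul_const (ξ t)).const_add (e (c t))).add_const
      ((0 : ℝ) • η t)).fun_add (hr₁.fun_const_smul ((b - t) / (b - a))) |>.congr_deriv (by simp)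
  have hx₂ : ∀ t, HasDerivAt (fun s => x 0 s t) (η t) 0 := fun t =>
    (((hasDerivAt_id' (0 : ℝ)).smul_const (η t)).const_add (e (c t) + (0 : ℝ) • ξ t)).fun_add
      (hr₂.fun_const_smul ((b - t) / (b - a))) |>.congr_deriv (by simp)
  set O : Set (ℝ × ℝ × ℝ) := box ε ∩ (fun q : ℝ × ℝ × ℝ => β q.1 q.2.1) ⁻¹' e.source with hO
  have hOo : IsOpen O := hβ.continuousOn.isOpen_inter_preimage (isOpen_box ε) e.open_source
  have hO0 : ∀ t, ((0 : ℝ), (0 : ℝ), t) ∈ O := fun t => ⟨⟨hz, hz, mem_univ _⟩, hβs⟩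
  have hβe : ContDiffOn ℝ ∞ (fun q : ℝ × ℝ × ℝ => e (β q.1 q.2.1)) O := fun q hq =>
    contDiffWithinAt_chart_comp he ((hβ q hq.1).mono inter_subset_left) hq.2
  have htime : ∀ {g : ℝ → E n}, ContDiffOn ℝ ∞ g (Icc a b) →
      ContDiffOn ℝ ∞ (fun q : ℝ × ℝ × ℝ => g q.2.2) (slab a b ∩ O) := fun hg =>
    hg.comp (f := fun q : ℝ × ℝ × ℝ => q.2.2) (by fun_prop) fun q hq => hq.1
  have hxs : ContDiffOn ℝ ∞ (fun q : ℝ × ℝ × ℝ => x q.1 q.2.1 q.2.2) (slab a b ∩ O) := by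
    have h1 := htime hec
    have h2 := htime hξ
    have h3 := htime hη
    have h4 := hβe.mono (inter_subset_right (s := slab a b))
    have hs₁ : ContDiffOn ℝ ∞ (fun q : ℝ × ℝ × ℝ => q.1) (slab a b ∩ O) := by fun_prop
    have hs₂ : ContDiffOn ℝ ∞ (fun q : ℝ × ℝ × ℝ => q.2.1) (slab a b ∩ O) := by fun_prop
    have hl : ContDiffOn ℝ ∞ (fun q : ℝ × ℝ × ℝ => (b - q.2.2) / (b - a)) (slab a b ∩ O) := by
      fun_prop
    exact ((h1.add (hs₁.smul h2)).add (hs₂.smul h3)).add (hl.smul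
      (((h4.sub contDiffOn_const).sub (hs₁.smul contDiffOn_const)).sub
        (hs₂.smul contDiffOn_const)))
  -- Size of the parameters for which β stays in the chart domain and x in the chart target,
  -- uniformly in t.
  obtain ⟨δ₀, hδ₀, hP⟩ := exists_box_of_eventually (a := a) (b := b)
    (P := fun q => q ∈ O ∧ (q ∈ slab a b → x q.1 q.2.1 q.2.2 ∈ e.target)) (fun t ht => by
      refine Filter.Eventually.and (hOo.mem_nhds (hO0 t)) (eventually_nhdsWithin_iff.1 ?_)
      have hcont := ((continuousWithinAt_inter (hOo.mem_nhds (hO0 t))).1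
        (hxs.continuousOn _ ⟨ht, hO0 t⟩))
      refine hcont.eventually (e.open_target.mem_nhds ?_)
      change x 0 0 t ∈ e.target
      rw [hx0]
      exact e.map_source (hs t ht))
  have hsub : box (min δ₀ ε) ⊆ box δ₀ := fun q hq =>
    ⟨⟨by linarith [hq.1.1, min_le_left δ₀ ε], by linarith [hq.1.2, min_le_left δ₀ ε]⟩,
      ⟨by linarith [hq.2.1.1, min_le_left δ₀ ε], by linarith [hq.2.1.2, min_le_left δ₀ ε]⟩,
      mem_univ _⟩
  have hP' := fun q (hq : q ∈ slab a b ∩ box (min δ₀ ε)) => hP q ⟨hq.1, hsub hq.2⟩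
  refine ⟨min δ₀ ε, fun s₁ s₂ t => e.symm (x s₁ s₂ t), lt_min hδ₀ hε, min_le_right _ _, ?_, ?_,
    ?_, ?_, ?_, ?_⟩
  · exact (contMDiffOn_symm_of_mem_maximalAtlas (mem_maxAtlas he)).comp
      (hxs.mono fun q hq => ⟨hq.1, (hP' q hq).1⟩).contMDiffOn fun q hq => (hP' q hq).2 hq.1
  · intro s₁ hs₁ s₂ hs₂
    have := (hP' (s₁, s₂, a) ⟨ha, hs₁, hs₂, mem_univ _⟩).1.2
    dsimp only
    rw [hxa, e.left_inv this]
  · intro t ht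
    dsimp only
    rw [hx0, e.left_inv (hs t ht)]
  · intro t ht
    refine (mfderiv_chart_symm_comp he (hx₁ t)
      (by rw [hx0]; exact e.map_source (hs t ht))).trans ?_
    rw [hx0]
    exact vecOfCoords_coordField he (hs t ht)
  · intro t ht
    refine (mfderiv_chart_symm_comp he (hx₂ t)
      (by rw [hx0]; exact e.map_source (hs t ht))).trans ?_
    rw [hx0]
    exact vecOfCoords_coordField he (hs t ht)
  · intro hXb hYb s₁ s₂
    have hξb : ξ b = 0 := coordField_eq_zero hXb
    have hηb : η b = 0 := coordField_eq_zero hYb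
    simp only [hx]
    rw [hξb, hηb]
    simp [e.left_inv (hs b hb)]

end Existence

end FinslerPEnergy

namespace FinslerPEnergy

/-! ### Gluing families of curves along a partition -/

theorem slab_union {a b d : ℝ} (hab : a ≤ b) (hbd : b ≤ d) :
    slab a b ∪ slab b d = slab a d := by
  ext q
  exact Set.ext_iff.1 (Icc_union_Icc_eq_Icc hab hbd) q.2.2

theorem isClosed_slab (a b : ℝ) : IsClosed (slab a b) :=
  isClosed_Icc.preimage (by fun_prop : Continuous fun q : ℝ × ℝ × ℝ => q.2.2)

theorem box_mono {δ ε : ℝ} (h : δ ≤ ε) : box δ ⊆ box ε := fun _ hq =>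
  ⟨⟨by linarith [hq.1.1], by linarith [hq.1.2]⟩,
    ⟨by linarith [hq.2.1.1], by linarith [hq.2.1.2]⟩, mem_univ _⟩

/-- Pasting for relatively closed sets: a point off one set is not in its closure and imposes no
condition there. -/
theorem continuousOn_inter_union_of_isClosed {Z T : Type*} [TopologicalSpace Z]
    [TopologicalSpace T] {f : Z → T} {A B O : Set Z} (hA : IsClosed A) (hB : IsClosed B)
    (hfA : ContinuousOn f (A ∩ O)) (hfB : ContinuousOn f (B ∩ O)) :
    ContinuousOn f ((A ∪ B) ∩ O) := by
  have key : ∀ {A : Set Z}, IsClosed A → ContinuousOn f (A ∩ O) → ∀ q ∈ O,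
      ContinuousWithinAt f (A ∩ O) q := fun {A} hA hf q hq => by
    by_cases hqA : q ∈ A
    · exact hf q ⟨hqA, hq⟩
    · exact continuousWithinAt_of_notMem_closure fun h =>
        hqA (hA.closure_subset_iff.2 inter_subset_left h)
  intro q hq
  rw [union_inter_distrib_right]
  exact (key hA hfA q hq.2).union (key hB hfB q hq.2)

theorem NatPartition.continuousOn_slab {k : ℕ} {a : ℕ → ℝ} (ha : NatPartition k a)
    {T : Type*} [TopologicalSpace T] {f : ℝ × ℝ × ℝ → T} {O : Set (ℝ × ℝ × ℝ)}
    (hf : ∀ j < k, ContinuousOn f (slab (a j) (a (j + 1)) ∩ O)) :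
    ContinuousOn f (slab 0 1 ∩ O) := by
  have h : ∀ i < k, ContinuousOn f (slab 0 (a (i + 1)) ∩ O) := by
    intro i
    induction i with
    | zero => intro h; rw [← ha.zero]; exact hf 0 h
    | succ i ih =>
      intro h
      rw [← slab_union (ha.mem (i := i + 1) h.le).1 (ha.lt (i + 1) h).le]
      exact continuousOn_inter_union_of_isClosed (isClosed_slab _ _) (isClosed_slab _ _)
        (ih (by omega)) (hf (i + 1) h)
  obtain ⟨m, rfl⟩ : ∃ m, k = m + 1 := ⟨k - 1, by have := ha.pos; omega⟩
  have := h m (Nat.lt_succ_self m)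
  rwa [ha.last] at this

section Existence

open FinslerMetric

variable {n : ℕ} {M : Type*} [TopologicalSpace M] [ChartedSpace (E n) M]

theorem velocity_congr {γ γ' : ℝ → M} (h : γ = γ') (t : ℝ) :
    (⟨γ t, mfderiv 𝓘(ℝ, ℝ) (I n) γ t (1 : ℝ)⟩ : TangentBundle (I n) M) =
      ⟨γ' t, mfderiv 𝓘(ℝ, ℝ) (I n) γ' t (1 : ℝ)⟩ := by
  subst h; rfl

variable {c : ℝ → M} {α : ℝ → ℝ → ℝ → M} {ε : ℝ} {X Y : (t : ℝ) → TangentSpace (I n) (c t)}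

/-- A variation over the first `i` pieces of a partition. -/
structure PartialVariation (c : ℝ → M) (X Y : (t : ℝ) → TangentSpace (I n) (c t)) (a : ℕ → ℝ)
    (i : ℕ) (ε : ℝ) (α : ℝ → ℝ → ℝ → M) : Prop where
  pos : 0 < ε
  smooth : ∀ j < i, ContMDiffOn 𝓘(ℝ, ℝ × ℝ × ℝ) (I n) ∞ (fam α)
    (slab (a j) (a (j + 1)) ∩ box ε)
  smooth_end : ContMDiffOn 𝓘(ℝ, ℝ × ℝ × ℝ) (I n) ∞ (fun q : ℝ × ℝ × ℝ => α q.1 q.2.1 (a i))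
    (box ε)
  start : ∀ s₁ s₂, α s₁ s₂ 0 = c 0
  eq_end : X (a i) = 0 → Y (a i) = 0 → ∀ s₁ s₂, α s₁ s₂ (a i) = c (a i)
  field₁ : ∀ t ∈ Icc 0 (a i),
    (⟨α 0 0 t, mfderiv 𝓘(ℝ, ℝ) (I n) (fun s => α s 0 t) 0 (1 : ℝ)⟩ : TangentBundle (I n) M) =
      ⟨c t, X t⟩
  field₂ : ∀ t ∈ Icc 0 (a i),
    (⟨α 0 0 t, mfderiv 𝓘(ℝ, ℝ) (I n) (fun s => α 0 s t) 0 (1 : ℝ)⟩ : TangentBundle (I n) M) =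
      ⟨c t, Y t⟩

theorem PartialVariation.zero {a : ℕ → ℝ} (ha : a 0 = 0) (hX : X 0 = 0) (hY : Y 0 = 0) :
    PartialVariation c X Y a 0 1 (fun _ _ _ => c 0) := by
  have h0 : ∀ {X : (t : ℝ) → TangentSpace (I n) (c t)}, X 0 = 0 → ∀ t ∈ Icc 0 (a 0),
      (⟨c 0, mfderiv 𝓘(ℝ, ℝ) (I n) (fun _ : ℝ => c 0) 0 (1 : ℝ)⟩ : TangentBundle (I n) M) =
        ⟨c t, X t⟩ := fun {X} hX t ht => by
    rw [ha] at ht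
    obtain rfl : t = 0 := le_antisymm ht.2 ht.1
    rw [mfderiv_const, hX]
    rfl
  refine ⟨one_pos, fun j hj => by omega, contMDiffOn_const, fun _ _ => rfl, fun _ _ _ _ => ?_,
    h0 hX, h0 hY⟩
  rw [ha]

variable [IsManifold (I n) ∞ M] {F : FinslerMetric n M} {e : OpenPartialHomeomorph M (E n)}

/-- The next chart family starts from the final points of the given one. Variations need smoothness
only piece by piece, so agreement at t = a i is enough. The final points are fixed when both fields
vanish there, which is used at t = 1. -/
theorem PartialVariation.succ {a : ℕ → ℝ} {i : ℕ} (h : PartialVariation c X Y a i ε α)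
    (h0 : 0 ≤ a i) (hlt : ∀ j ≤ i, a j < a (j + 1)) (hle : ∀ j < i, a (j + 1) ≤ a i)
    (hX : SmoothField c X (a i) (a (i + 1))) (hY : SmoothField c Y (a i) (a (i + 1)))
    (he : e ∈ atlas (E n) M) (hs : ∀ t ∈ Icc (a i) (a (i + 1)), c t ∈ e.source) :
    ∃ δ α', PartialVariation c X Y a (i + 1) δ α' := by
  have hi := hlt i le_rfl
  obtain ⟨δ, γ, hδ, hδε, hγ, hstart, -, hγ₁, hγ₂, h_end⟩ :=
    exists_family_in_chart he hi hs hX hY (β := fun s₁ s₂ => α s₁ s₂ (a i)) h.pos h.smooth_end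
      (h.field₁ (a i) ⟨h0, le_rfl⟩) (h.field₂ (a i) ⟨h0, le_rfl⟩)
  set α' : ℝ → ℝ → ℝ → M := fun s₁ s₂ t => if t ≤ a i then α s₁ s₂ t else γ s₁ s₂ t with hα'
  have hle' : ∀ {t}, t ≤ a i → ∀ s₁ s₂, α' s₁ s₂ t = α s₁ s₂ t := fun ht _ _ => if_pos ht
  have hgt : ∀ {t}, a i < t → ∀ s₁ s₂, α' s₁ s₂ t = γ s₁ s₂ t := fun ht _ _ =>
    if_neg (not_le.2 ht)
  refine ⟨δ, α', hδ, fun j hj => ?_, ?_, fun s₁ s₂ => ?_, fun hXb hYb s₁ s₂ => ?_,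
    fun t ht => ?_, fun t ht => ?_⟩
  · rcases (Nat.lt_succ_iff.1 hj).eq_or_lt with rfl | hj
    · refine hγ.congr fun q hq => ?_
      change α' q.1 q.2.1 q.2.2 = γ q.1 q.2.1 q.2.2
      -- At t = a i the definition still selects the old family; the new one agrees with it there by
      -- `hstart`.
      rcases hq.1.1.eq_or_lt with heq | hlt
      · rw [hle' heq.symm.le, ← heq, hstart _ hq.2.1 _ hq.2.2.1]
      · exact hgt hlt _ _
    · refine ((h.smooth j hj).mono (inter_subset_inter_right _ (box_mono hδε))).congr
        fun q hq => hle' (hq.1.2.trans (hle j hj)) _ _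
  · have hm : ContDiff ℝ ∞ (fun q : ℝ × ℝ × ℝ => (q.1, q.2.1, a (i + 1))) := by fun_prop
    refine (hγ.comp hm.contMDiff.contMDiffOn fun q hq =>
      ⟨right_mem_Icc.2 hi.le, hq.1, hq.2.1, mem_univ _⟩).congr fun q _ => hgt hi _ _
  · rw [hle' h0, h.start]
  · rw [hgt hi, h_end hXb hYb]
  · rcases le_or_gt t (a i) with hta | hta
    · exact (velocity_congr (funext fun s => hle' hta s 0) 0).trans (h.field₁ t ⟨ht.1, hta⟩)
    · exact (velocity_congr (funext fun s => hgt hta s 0) 0).trans (hγ₁ t ⟨hta.le, ht.2⟩)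
  · rcases le_or_gt t (a i) with hta | hta
    · exact (velocity_congr (funext fun s => hle' hta 0 s) 0).trans (h.field₂ t ⟨ht.1, hta⟩)
    · exact (velocity_congr (funext fun s => hgt hta 0 s) 0).trans (hγ₂ t ⟨hta.le, ht.2⟩)

/-- Nonvanishing of the velocity is an open condition that holds along c, hence on a whole box by
compactness of [a, b]. -/
theorem eventually_regular {a b : ℝ} (hc : F.IsGeodesic c) (hε : 0 < ε) (hab : a < b)
    (hsub : Icc a b ⊆ Icc 0 1)
    (hα : ContMDiffOn 𝓘(ℝ, ℝ × ℝ × ℝ) (I n) ∞ (fam α) (slab a b ∩ box ε))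
    (hbase : ∀ t ∈ Icc (0 : ℝ) 1, α 0 0 t = c t) :
    ∀ᶠ δ in 𝓝[>] (0 : ℝ), ∀ q ∈ slab a b ∩ box δ, velVec (n := n) α a b q ≠ 0 := by
  obtain ⟨δ, hδ, h⟩ := exists_box_of_eventually (a := a) (b := b)
    (P := fun q => q ∈ slab a b → velVec (n := n) α a b q ≠ 0) (fun t ht => by
      have he := chart_mem_atlas (E n) (c t)
      obtain ⟨W, hW⟩ := exists_chartNhd hc he hε hab hsub hα hbase ht (mem_chart_source _ _)
      filter_upwards [hW.isOpen.mem_nhds hW.mem] with q hq hqs h0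
      have h1 := hW.coord_vel he hab hα ⟨hqs, hq⟩ d3
      refine (hW.regular.mem q ⟨hqs, hq⟩).2 ?_
      dsimp only
      rw [← h1]
      change mfderiv (I n) (I n) _ (fam α q) (velVec α a b q) = 0
      rw [h0]
      exact map_zero (mfderiv (I n) (I n) _ (fam α q)))
  filter_upwards [Ioo_mem_nhdsGT hδ] with δ' hδ' q hq
  exact h q ⟨hq.1, box_mono hδ'.2.le hq.2⟩ hq.1

/-- Every pair of vector fields along a geodesic is realized by a variation. -/
theorem exists_isVariation {x₀ x₁ : M} (hcΩ : c ∈ pathSpace n x₀ x₁) (hc : F.IsGeodesic c)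
    (hX : X ∈ tangentPathSpace c) (hY : Y ∈ tangentPathSpace c) :
    ∃ ε α, IsVariation x₀ x₁ c X Y ε α := by
  obtain ⟨k, a, ha, hpc⟩ := exists_adapted_partition hc.smooth.continuousOn hX hY
  have hpart : ∀ i ≤ k, ∃ ε α, PartialVariation c X Y a i ε α := by
    intro i
    induction i with
    | zero => exact fun _ => ⟨_, _, PartialVariation.zero ha.zero hX.1 hY.1⟩
    | succ i ih =>
      intro hi
      obtain ⟨ε, α, h⟩ := ih (by omega)
      obtain ⟨hXi, hYi, e, he, hs⟩ := hpc i hi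
      exact h.succ (ha.mem (by omega)).1 (fun j hj => ha.lt j (by omega))
        (fun j hj => ha.le_of_le hj (by omega)) hXi hYi he hs
  obtain ⟨ε, α, h⟩ := hpart k le_rfl
  have hk := ha.last
  have hf₁ := h.field₁
  have hf₂ := h.field₂
  have h_end := h.eq_end
  rw [hk] at hf₁ hf₂ h_end
  have hbase : ∀ t ∈ Icc (0 : ℝ) 1, α 0 0 t = c t := fun t ht =>
    congrArg Bundle.TotalSpace.proj (hf₁ t ht)
  have hreg : ∀ᶠ δ in 𝓝[>] (0 : ℝ), ∀ i ∈ Finset.range k,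
      ∀ q ∈ slab (a i) (a (i + 1)) ∩ box δ, velVec (n := n) α (a i) (a (i + 1)) q ≠ 0 :=
    (Filter.eventually_all_finset _).2 fun i hi => by
      have hi := Finset.mem_range.1 hi
      exact eventually_regular hc h.pos (ha.lt i hi) (ha.subset hi) (h.smooth i hi) hbase
  -- The parameters are restricted once more so that all curves of the family are regular on every
  -- piece.
  obtain ⟨δ, hδreg, hδ⟩ := (hreg.and (Ioo_mem_nhdsGT h.pos)).exists
  have hsm : ∀ i < k, ContMDiffOn 𝓘(ℝ, ℝ × ℝ × ℝ) (I n) ∞ (fam α)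
      (slab (a i) (a (i + 1)) ∩ box δ) := fun i hi =>
    (h.smooth i hi).mono (inter_subset_inter_right _ (box_mono hδ.2.le))
  have hcont : ContinuousOn (fun q : ℝ × ℝ × ℝ => α q.1 q.2.1 q.2.2)
      (Ioo (-δ) δ ×ˢ Ioo (-δ) δ ×ˢ Icc 0 1) :=
    (ha.continuousOn_slab fun j hj => (hsm j hj).continuousOn).mono fun q hq =>
      ⟨hq.2.2, hq.1, hq.2.1, mem_univ _⟩
  refine ⟨δ, α, hδ.1, fun s₁ h₁ s₂ h₂ => ⟨?_, ?_, ?_, k, _, ha.isPartition, fun i => ⟨?_, ?_⟩⟩,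
    hbase, hcont, ⟨k, _, ha.isPartition, fun i => ?_⟩, hf₁, hf₂⟩
  · rw [h.start, hcΩ.1]
  · rw [h_end hX.2.1 hY.2.1, hcΩ.2.1]
  · exact hcont.comp (f := fun t => (s₁, s₂, t)) (by fun_prop) fun t ht => ⟨h₁, h₂, ht⟩
  · have hm : ContDiff ℝ ∞ (fun t : ℝ => (s₁, s₂, t)) := by fun_prop
    exact (hsm i i.2).comp hm.contMDiff.contMDiffOn fun t ht => ⟨ht, h₁, h₂, mem_univ _⟩
  · intro t ht
    have := mfderivWithin_fam (ha.lt i i.2) (hsm i i.2) h₁ h₂ ht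
    exact fun h0 => hδreg i (Finset.mem_range.2 i.2) (s₁, s₂, t) ⟨ht, h₁, h₂, mem_univ _⟩
      (this.symm.trans h0)
  · exact (hsm i i.2).mono fun q hq => ⟨hq.2.2, hq.1, hq.2.1, mem_univ _⟩

end Existence

end FinslerPEnergy

namespace FinslerPEnergy

/-! ### Smoothness across a break point -/

/-- Solutions of linear differential equations with smooth coefficients are smooth. -/
theorem contDiffOn_of_linear_ode {V : Type*} [NormedAddCommGroup V] [NormedSpace ℝ V]
    {H : ℝ → V →L[ℝ] V} {u : ℝ → V} {J : Set ℝ} (hJ : IsOpen J) (hH : ContDiffOn ℝ ∞ H J)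
    (hu : ∀ t ∈ J, HasDerivAt u (H t (u t)) t) : ContDiffOn ℝ ∞ u J := by
  refine contDiffOn_infty.2 fun m => ?_
  induction m with
  | zero => exact contDiffOn_zero.2 fun t ht => (hu t ht).continuousAt.continuousWithinAt
  | succ m ih =>
    push_cast
    refine (contDiffOn_succ_iff_deriv_of_isOpen hJ).2
      ⟨fun t ht => (hu t ht).differentiableAt.differentiableWithinAt, fun h => ?_, ?_⟩
    · exact absurd h (by simp)
    -- Bootstrapping: if u is of class C^m, so is u' = H u.
    · exact ((hH.of_le (by exact_mod_cast le_top)).clm_apply ih).congr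
        fun t ht => (hu t ht).deriv

/-- A local version of `hasDerivAt_of_hasDerivAt_of_ne`. -/
theorem hasDerivAt_of_eventually_hasDerivAt {V : Type*} [NormedAddCommGroup V] [NormedSpace ℝ V]
    {f g : ℝ → V} {x : ℝ} (hd : ∀ᶠ y in 𝓝[≠] x, HasDerivAt f (g y) y) (hf : ContinuousAt f x)
    (hg : ContinuousAt g x) : HasDerivAt f (g x) x := by
  have key : ∀ {s : Set ℝ}, 𝓝[s] x ≤ 𝓝[≠] x → ∀ᶠ y in 𝓝[s] x, HasDerivAt f (g y) y :=
    fun h => h hd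
  have hlim : ∀ {s : Set ℝ}, 𝓝[s] x ≤ 𝓝[≠] x → Tendsto (fun y => deriv f y) (𝓝[s] x) (𝓝 (g x)) :=
    fun {s} h => (hg.tendsto.mono_left nhdsWithin_le_nhds).congr' <| by
      filter_upwards [key h] with y hy using hy.deriv.symm
  have h1 := hasDerivWithinAt_Ici_of_tendsto_deriv (s := {y | HasDerivAt f (g y) y})
    (fun y hy => HasDerivAt.differentiableAt hy |>.differentiableWithinAt) hf.continuousWithinAt
    (key (nhdsWithin_mono x fun y hy => ne_of_gt hy)) (hlim (nhdsWithin_mono x fun y hy => ne_of_gt hy))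
  have h2 := hasDerivWithinAt_Iic_of_tendsto_deriv (s := {y | HasDerivAt f (g y) y})
    (fun y hy => HasDerivAt.differentiableAt hy |>.differentiableWithinAt) hf.continuousWithinAt
    (key (nhdsWithin_mono x fun y hy => ne_of_lt hy)) (hlim (nhdsWithin_mono x fun y hy => ne_of_lt hy))
  simpa using h2.union h1

/-! ### The linearized equation along a geodesic and test fields -/

section Regularity

open FinslerMetric

variable {n : ℕ} {M : Type*} [TopologicalSpace M] [ChartedSpace (E n) M]
  {e : OpenPartialHomeomorph M (E n)} {c : ℝ → M} {a b t : ℝ} {X Y : (t : ℝ) → TangentSpace (I n) (c t)}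

/-- The field along `c` which in the chart `e` has the constant coordinates `w`, multiplied by
the function `ρ`. -/
def bumpField (e : OpenPartialHomeomorph M (E n)) (c : ℝ → M) (ρ : ℝ → ℝ) (w : E n) (t : ℝ) :
    TangentSpace (I n) (c t) := (ρ t • (coordVec e (e (c t)) w : E n) : E n)

theorem bumpField_eq_zero {ρ : ℝ → ℝ} {w : E n} (h : ρ t = 0) : bumpField e c ρ w t = 0 := by
  unfold bumpField
  rw [h]
  exact zero_smul ℝ _

theorem vecOfCoords_bumpField {ρ : ℝ → ℝ} {w : E n} (hs : c t ∈ e.source) :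
    (⟨c t, bumpField e c ρ w t⟩ : TangentBundle (I n) M) = vecOfCoords e (e (c t), ρ t • w) :=
  Bundle.TotalSpace.ext (e.left_inv hs).symm (heq_of_eq (coordVec_smul e (e (c t)) w (ρ t)).symm)

variable [IsManifold (I n) ∞ M] {F : FinslerMetric n M}

/-- The spray coefficients as a vector. -/
def FinslerMetric.sprayVec (F : FinslerMetric n M) (e : OpenPartialHomeomorph M (E n))
    (q : E n × E n) : E n := WithLp.toLp 2 fun i => unc (F.spray e i) q

theorem contDiffOn_sprayVec (he : e ∈ atlas (E n) M) :
    ContDiffOn ℝ ∞ (F.sprayVec e) (slit e) :=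
  contDiffOn_euclidean.2 fun i => F.contDiffOn_spray he i

theorem contDiffWithinAt_fderiv_sprayVec (hc : F.IsGeodesic c) (he : e ∈ atlas (E n) M)
    (ht : t ∈ Icc (0 : ℝ) 1) (hs : c t ∈ e.source) :
    ContDiffWithinAt ℝ ∞ (fun t => fderivWithin ℝ (F.sprayVec e) (slit e) (phase e c t))
      (Icc 0 1) t := by
  have h : ContDiffOn ℝ ∞ (fderivWithin ℝ (F.sprayVec e) (slit e)) (slit e) :=
    (contDiffOn_sprayVec he).fderivWithin isOpen_slit.uniqueDiffOn (by simp)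
  exact (h.contDiffAt (isOpen_slit.mem_nhds (hc.phase_mem he ht hs))).comp_contDiffWithinAt t
    (hc.contDiffWithinAt_phase he ht hs)

/-- Vector form ξ'' + A(t)(ξ, ξ'), where A is the derivative of the spray along c and is smooth in
t: the form suited to the theory of linear equations. -/
theorem jacobiOp_eq (hc : F.IsGeodesic c) (he : e ∈ atlas (E n) M)
    (ht : t ∈ Icc (0 : ℝ) 1) (hs : c t ∈ e.source) {ξ : ℝ → E n}
    (hξ : ContDiffWithinAt ℝ ∞ ξ (Icc 0 1) t) :
    F.jacobiOp e c ξ t = derivWithin (derivWithin ξ (Icc 0 1)) (Icc 0 1) t +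
      fderivWithin ℝ (F.sprayVec e) (slit e) (phase e c t) (ξ t, derivWithin ξ (Icc 0 1) t) := by
  ext i
  rw [hc.jacobiOp_apply he ht hs hξ i, PiLp.add_apply]
  congr 1
  exact dd_apply isOpen_slit.niceDomain (contDiffOn_sprayVec he) (hc.phase_mem he ht hs) i

/-- Used twice: to keep the sign of the density near a time where it is nonzero, and to extend the
Jacobi equation to t = 0 and t = 1. -/
theorem continuousWithinAt_jacobiOp (hc : F.IsGeodesic c) (he : e ∈ atlas (E n) M)
    (ht : t ∈ Icc (0 : ℝ) 1) (hs : c t ∈ e.source) {ξ : ℝ → E n}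
    (hξ : ∀ᶠ s in 𝓝[Icc 0 1] t, ContDiffWithinAt ℝ ∞ ξ (Icc 0 1) s) :
    ContinuousWithinAt (F.jacobiOp e c ξ) (Icc 0 1) t := by
  have hξt : ContDiffWithinAt ℝ ∞ ξ (Icc 0 1) t := hξ.self_of_nhdsWithin ht
  have h1 := contDiffWithinAt_derivWithin hξt uniqueDiffOn_unitInterval ht
  have h2 := contDiffWithinAt_derivWithin h1 uniqueDiffOn_unitInterval ht
  have h3 := (contDiffWithinAt_fderiv_sprayVec hc he ht hs).clm_apply (hξt.prodMk h1)
  refine (h2.add h3).continuousWithinAt.congr_of_eventuallyEq ?_ (jacobiOp_eq hc he ht hs hξt)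
  filter_upwards [hξ, hc.eventually_mem ht hs] with s hs1 hs2
  exact jacobiOp_eq hc he hs2.1 hs2.2 hs1

theorem contDiffWithinAt_coordField (he : e ∈ atlas (E n) M) {S : Set ℝ}
    (hX : ContMDiffWithinAt 𝓘(ℝ, ℝ) (I n).tangent ∞
      (fun t => (⟨c t, X t⟩ : TangentBundle (I n) M)) S t) (hs : c t ∈ e.source) :
    ContDiffWithinAt ℝ ∞ (coordField e c X) S t := by
  have hopen : IsOpen {w : TangentBundle (I n) M | w.1 ∈ e.source} :=
    e.open_source.preimage (FiberBundle.continuous_proj (E n) (TangentSpace (I n) : M → Type _))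
  have h := contMDiffWithinAt_iff_contDiffWithinAt.1
    (((contMDiffOn_coordsOfVec he).contMDiffAt (hopen.mem_nhds hs)).comp_contMDiffWithinAt t hX)
  exact contDiff_snd.contDiffAt.comp_contDiffWithinAt t h

theorem contMDiffWithinAt_of_coordField (he : e ∈ atlas (E n) M) {S : Set ℝ}
    (hec : ContDiffWithinAt ℝ ∞ (fun t => e (c t)) S t)
    (hξ : ContDiffWithinAt ℝ ∞ (coordField e c X) S t) (ht : t ∈ S)
    (hs : ∀ᶠ s in 𝓝[S] t, c s ∈ e.source) :
    ContMDiffWithinAt 𝓘(ℝ, ℝ) (I n).tangent ∞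
      (fun t => (⟨c t, X t⟩ : TangentBundle (I n) M)) S t := by
  have hopen : IsOpen (e.target ×ˢ (univ : Set (E n))) := e.open_target.prod isOpen_univ
  have hst := hs.self_of_nhdsWithin ht
  have hm : (e (c t), coordField e c X t) ∈ e.target ×ˢ (univ : Set (E n)) :=
    ⟨e.map_source hst, mem_univ _⟩
  refine (((contMDiffOn_vecOfCoords he).contMDiffAt (hopen.mem_nhds hm)).comp_contMDiffWithinAt t
      (f := fun t => (e (c t), coordField e c X t))
      (hec.prodMk hξ).contMDiffWithinAt).congr_of_eventuallyEq ?_ ?_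
  · filter_upwards [hs] with s hs'
    exact (vecOfCoords_coordField he hs').symm
  · exact (vecOfCoords_coordField he hst).symm

theorem coordField_bumpField (he : e ∈ atlas (E n) M) {ρ : ℝ → ℝ} {w : E n}
    (hs : c t ∈ e.source) : coordField e c (bumpField e c ρ w) t = ρ t • w := by
  have h : (coordsOfVec e ⟨c t, bumpField e c ρ w t⟩).2 = ρ t • w := by
    rw [vecOfCoords_bumpField hs, coordsOfVec_vecOfCoords he (e.map_source hs)]
  exact h

theorem contMDiffOn_bumpField (hc : F.IsGeodesic c) (he : e ∈ atlas (E n) M) {ρ : ℝ → ℝ}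
    (hρ : ContDiff ℝ ∞ ρ) (hsupp : ∀ t ∈ Icc (0 : ℝ) 1, t ∈ tsupport ρ → c t ∈ e.source)
    (w : E n) :
    ContMDiffOn 𝓘(ℝ, ℝ) (I n).tangent ∞
      (fun t => (⟨c t, bumpField e c ρ w t⟩ : TangentBundle (I n) M)) (Icc 0 1) := by
  intro t ht
  by_cases hts : t ∈ tsupport ρ
  · have hs := hsupp t ht hts
    have hev := hc.eventually_mem ht hs
    refine contMDiffWithinAt_of_coordField he (hc.contDiffWithinAt_pos he ht hs) ?_ ht
      (hev.mono fun s hs => hs.2)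
    refine ((hρ.contDiffAt.contDiffWithinAt).smul
      (contDiffWithinAt_const (c := w))).congr_of_eventuallyEq ?_ (coordField_bumpField he hs)
    filter_upwards [hev] with s hs'
    exact coordField_bumpField he hs'.2
  -- Off the support of ρ the curve may leave the chart and the coordinate vector is meaningless,
  -- but its factor ρ vanishes nearby and the field is the zero section.
  · have h0 := (Bundle.contMDiff_zeroSection ℝ (TangentSpace (I n) : M → Type _)
      (IB := I n) (n := ∞) (F := E n)).comp_contMDiffOn hc.smooth
    refine (h0 t ht).congr_of_eventuallyEq ?_ ?_
    · filter_upwards [nhdsWithin_le_nhds ((isClosed_tsupport ρ).isOpen_compl.mem_nhds hts)]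
        with s hs
      simp only [bumpField_eq_zero (image_eq_zero_of_notMem_tsupport hs)]
      rfl
    · simp only [bumpField_eq_zero (image_eq_zero_of_notMem_tsupport hts)]
      rfl

theorem bumpField_mem (hc : F.IsGeodesic c) (he : e ∈ atlas (E n) M) {ρ : ℝ → ℝ}
    (hρ : ContDiff ℝ ∞ ρ) (hsupp : ∀ t ∈ Icc (0 : ℝ) 1, t ∈ tsupport ρ → c t ∈ e.source)
    (h0 : ρ 0 = 0) (h1 : ρ 1 = 0) (w : E n) : bumpField e c ρ w ∈ tangentPathSpace c := by
  have h := contMDiffOn_bumpField hc he hρ hsupp w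
  have ha : NatPartition 1 (fun i => (i : ℝ)) := ⟨by simp, by simp, fun i _ => by simp⟩
  exact ⟨bumpField_eq_zero h0, bumpField_eq_zero h1, h.continuousOn, 1, _, ha.isPartition,
    fun i => h.mono (ha.subset i.2)⟩

end Regularity

end FinslerPEnergy

namespace FinslerPEnergy

/-! ### Finite exceptional sets of times -/

theorem NatPartition.exists_finite {k : ℕ} {a : ℕ → ℝ} (ha : NatPartition k a) :
    ∃ S : Set ℝ, S.Finite ∧ ∀ t ∈ Icc (0 : ℝ) 1, t ∉ S → ∃ i < k, t ∈ Ioo (a i) (a (i + 1)) := by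
  refine ⟨a '' Iic k, (finite_Iic k).image a, fun t ht hts => ?_⟩
  have hne : ∀ i ≤ k, t ≠ a i := fun i hi h => hts ⟨i, hi, h.symm⟩
  have h1 := lt_of_le_of_ne ht.2 (ha.last ▸ hne k le_rfl)
  obtain ⟨i, hi, hi1, hi2⟩ := exists_mem_piece (a := a) (t := t) (k := k)
    (by rw [ha.zero]; exact ht.1) (by rw [ha.last]; exact h1)
  exact ⟨i, hi, lt_of_le_of_ne hi1 (hne i hi.le).symm, hi2⟩

theorem integral_congr_of_finite {f g : ℝ → ℝ} {a b : ℝ} {S : Set ℝ} (hS : S.Finite)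
    (hab : a ≤ b) (h : ∀ t ∈ Icc a b, t ∉ S → f t = g t) :
    ∫ t in a..b, f t = ∫ t in a..b, g t := by
  refine intervalIntegral.integral_congr_ae ?_
  filter_upwards [hS.countable.ae_notMem MeasureTheory.volume] with t ht hab'
  rw [uIoc_of_le hab] at hab'
  exact h t (Ioc_subset_Icc_self hab') ht

/-! ### Vanishing of the second variation -/

section Vanishing

open FinslerMetric

variable {n : ℕ} {M : Type*} [TopologicalSpace M] [ChartedSpace (E n) M]
  [IsManifold (I n) ∞ M] {F : FinslerMetric n M} {e : OpenPartialHomeomorph M (E n)}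
  {c : ℝ → M} {a b p t : ℝ} {x₀ x₁ : M} {X Y : (t : ℝ) → TangentSpace (I n) (c t)}

/-- `t` is an interior time near which the field `X` along `c` is smooth. -/
def FieldSmoothAt (c : ℝ → M) (X : (t : ℝ) → TangentSpace (I n) (c t)) (t : ℝ) : Prop :=
  t ∈ Ioo (0 : ℝ) 1 ∧ ∀ᶠ s in 𝓝 t, ContMDiffAt 𝓘(ℝ, ℝ) (I n).tangent ∞
    (fun t => (⟨c t, X t⟩ : TangentBundle (I n) M)) s

theorem FieldSmoothAt.eventually (h : FieldSmoothAt c X t) :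
    ∀ᶠ s in 𝓝 t, FieldSmoothAt c X s :=
  Filter.Eventually.and (Ioo_mem_nhds h.1.1 h.1.2) (eventually_eventually_nhds.2 h.2)

theorem FieldSmoothAt.contDiffAt (h : FieldSmoothAt c X t) (he : e ∈ atlas (E n) M)
    (hs : c t ∈ e.source) : ContDiffAt ℝ ∞ (coordField e c X) t :=
  (contDiffWithinAt_coordField he (S := univ) h.2.self_of_nhds hs).contDiffAt univ_mem

theorem SmoothField.fieldSmoothAt (h : SmoothField c X a b) (hsub : Icc a b ⊆ Icc 0 1)
    (ht : t ∈ Ioo a b) : FieldSmoothAt c X t := by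
  refine ⟨?_, ?_⟩
  · have := interior_mono hsub
    rw [interior_Icc, interior_Icc] at this
    exact this ht
  · filter_upwards [Ioo_mem_nhds ht.1 ht.2] with s hs
    exact ContMDiffOn.contMDiffAt h (Icc_mem_nhds hs.1 hs.2)

theorem exists_finite_fieldSmoothAt (hX : X ∈ tangentPathSpace c) :
    ∃ S : Set ℝ, S.Finite ∧ ∀ t ∈ Icc (0 : ℝ) 1, t ∉ S → FieldSmoothAt c X t := by
  obtain ⟨k, a, ha, h⟩ := exists_smoothField_partition hX
  obtain ⟨S, hS, hSt⟩ := ha.exists_finite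
  refine ⟨S, hS, fun t ht hts => ?_⟩
  obtain ⟨i, hi, hti⟩ := hSt t ht hts
  exact (h i hi).fieldSmoothAt (ha.subset hi) hti

/-- A variation with these fields is only an auxiliary tool: on its pieces `density_eq` gives the
chart independence. -/
theorem exists_finite_density_eq (hcΩ : c ∈ pathSpace n x₀ x₁) (hc : F.IsGeodesic c)
    (hX : X ∈ tangentPathSpace c) (hY : Y ∈ tangentPathSpace c) (p : ℝ) :
    ∃ S : Set ℝ, S.Finite ∧ ∀ t ∈ Icc (0 : ℝ) 1, t ∉ S → ∀ e ∈ atlas (E n) M, c t ∈ e.source →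
      F.jacobiDensity p c X Y (chartAt (E n) (c t)) t = F.jacobiDensity p c X Y e t := by
  obtain ⟨ε, α, hv⟩ := exists_isVariation hcΩ hc hX hY
  obtain ⟨k, a, ha, hpc⟩ := hv.exists_pieces hc
  obtain ⟨S, hS, hSt⟩ := ha.exists_finite
  refine ⟨S, hS, fun t ht hts e he hs => ?_⟩
  obtain ⟨i, hi, hti⟩ := hSt t ht hts
  exact (hpc i hi).density_eq he p hti hs

theorem eq_zero_of_hess (hc : F.IsGeodesic c) (he : e ∈ atlas (E n) M)
    (ht : t ∈ Icc (0 : ℝ) 1) (hs : c t ∈ e.source) (hp0 : p ≠ 0) (hp1 : p ≠ 1) {u : E n}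
    (h : ∀ w, F.hess e p c t u w = 0) : u = 0 := by
  refine F.eq_zero_of_sum_lagHess he hp0 hp1 (hc.phase_mem he ht hs) fun j => ?_
  rw [← h (basisVec j), hess, Finset.sum_comm]
  simp [basisVec_apply, mul_comm]

theorem hess_smul_right (p r : ℝ) (u v : E n) :
    F.hess e p c t u (r • v) = r * F.hess e p c t u v := by
  simp only [hess, Finset.mul_sum, PiLp.smul_apply, smul_eq_mul]
  exact Finset.sum_congr rfl fun _ _ => Finset.sum_congr rfl fun _ _ => by ring

theorem continuousWithinAt_hess (hc : F.IsGeodesic c) (he : e ∈ atlas (E n) M)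
    (ht : t ∈ Icc (0 : ℝ) 1) (hs : c t ∈ e.source) (p : ℝ) {u : ℝ → E n}
    (hu : ContinuousWithinAt u (Icc 0 1) t) (w : E n) :
    ContinuousWithinAt (fun t => F.hess e p c t (u t) w) (Icc 0 1) t := by
  refine tendsto_finsetSum _ fun j _ => tendsto_finsetSum _ fun i _ => ?_
  have h1 : ContinuousWithinAt (fun t => F.lagHess e p i j (phase e c t)) (Icc 0 1) t :=
    (((F.contDiffOn_lagHess he p i j).contDiffAt (isOpen_slit.mem_nhds
      (hc.phase_mem he ht hs))).comp_contDiffWithinAt t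
        (hc.contDiffWithinAt_phase he ht hs)).continuousWithinAt
  have h2 : ContinuousWithinAt (fun t => u t i) (Icc 0 1) t :=
    (EuclideanSpace.proj i : E n →L[ℝ] ℝ).continuous.continuousAt.comp_continuousWithinAt hu
  exact (h1.mul h2).mul continuousWithinAt_const

theorem FieldSmoothAt.continuousAt_jacobiOp (h : FieldSmoothAt c X t) (hc : F.IsGeodesic c)
    (he : e ∈ atlas (E n) M) (hs : c t ∈ e.source) :
    ContinuousWithinAt (F.jacobiOp e c (coordField e c X)) (Icc 0 1) t := by
  have ht := Ioo_subset_Icc_self h.1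
  refine continuousWithinAt_jacobiOp hc he ht hs ?_
  filter_upwards [nhdsWithin_le_nhds h.eventually, hc.eventually_mem ht hs] with s hs1 hs2
  exact (hs1.contDiffAt he hs2.2).contDiffWithinAt

theorem FieldSmoothAt.jumpTerm_eq_zero (h : FieldSmoothAt c X t) (p : ℝ) :
    F.jumpTerm p c X Y (chartAt (E n) (c t)) t = 0 := by
  unfold jumpTerm
  rw [jump_eq_zero ((h.contDiffAt (chart_mem_atlas _ _)
    (mem_chart_source _ _)).differentiableAt (by simp)), hess_zero_left]

theorem eventually_mem_source (hc : F.IsGeodesic c) (ht : t ∈ Ioo (0 : ℝ) 1)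
    (hs : c t ∈ e.source) : ∀ᶠ s in 𝓝 t, c s ∈ e.source := by
  have h := hc.eventually_mem (Ioo_subset_Icc_self ht) hs
  rw [nhdsWithin_eq_nhds.2 (Icc_mem_nhds ht.1 ht.2)] at h
  exact h.mono fun s hs => hs.2

theorem density_bumpField_eq_zero {ρ : ℝ → ℝ} {w : E n} {e' : OpenPartialHomeomorph M (E n)}
    (h : ρ t = 0) : F.jacobiDensity p c X (bumpField e c ρ w) e' t = 0 := by
  unfold jacobiDensity
  rw [coordField_eq_zero (bumpField_eq_zero h), hess_zero_right]

theorem jumpTerm_bumpField_eq_zero {ρ : ℝ → ℝ} {w : E n} {e' : OpenPartialHomeomorph M (E n)}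
    (h : ρ t = 0) : F.jumpTerm p c X (bumpField e c ρ w) e' t = 0 := by
  unfold jumpTerm
  rw [coordField_eq_zero (bumpField_eq_zero h), hess_zero_right]

/-- A smooth bump function with small support around an interior time. -/
theorem exists_bump {P : ℝ → Prop} {t₀ : ℝ} (ht₀ : t₀ ∈ Ioo (0 : ℝ) 1)
    (hP : ∀ᶠ t in 𝓝 t₀, P t) :
    ∃ (δ : ℝ) (ρ : ℝ → ℝ), 0 < δ ∧ ContDiff ℝ ∞ ρ ∧ ρ t₀ = 1 ∧ ρ 0 = 0 ∧ ρ 1 = 0 ∧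
      (∀ t ∈ Ioo (t₀ - δ) (t₀ + δ), 0 < ρ t) ∧
      (∀ t ∉ Ioo (t₀ - δ) (t₀ + δ), ρ t = 0) ∧
      tsupport ρ = Icc (t₀ - δ) (t₀ + δ) ∧
      ∀ t ∈ Icc (t₀ - δ) (t₀ + δ), t ∈ Ioo (0 : ℝ) 1 ∧ P t := by
  obtain ⟨δ, hδ, hball⟩ := Metric.nhds_basis_closedBall.eventually_iff.1
    ((Filter.Eventually.and (Ioo_mem_nhds ht₀.1 ht₀.2) hP))
  let ρ : ContDiffBump t₀ := ⟨δ / 2, δ, by linarith, by linarith⟩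
  rw [Real.closedBall_eq_Icc] at hball
  have hzero : ∀ t ∉ Ioo (t₀ - δ) (t₀ + δ), ρ t = 0 := fun t ht => by
    by_contra h
    have : t ∈ Function.support ρ := h
    rw [ρ.support_eq, Real.ball_eq_Ioo] at this
    exact ht this
  have hout : ∀ t ∉ Ioo (0 : ℝ) 1, ρ t = 0 := fun t ht =>
    hzero t fun h => ht (hball (Ioo_subset_Icc_self h)).1
  refine ⟨δ, ρ, hδ, ρ.contDiff, ρ.one_of_mem_closedBall ?_, hout 0 (by simp), hout 1 (by simp),
    fun t ht => ρ.pos_of_mem_ball ?_, hzero, ?_, fun t ht => hball ht⟩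
  · exact Metric.mem_closedBall_self (by change 0 ≤ δ / 2; linarith)
  · rw [Real.ball_eq_Ioo]; exact ht
  · rw [ρ.tsupport_eq, Real.closedBall_eq_Icc]

/-- If the second variation vanishes, then the Jacobi equation holds where `X` is smooth. -/
theorem jacobiOp_eq_zero (hcΩ : c ∈ pathSpace n x₀ x₁) (hc : F.IsGeodesic c)
    (hX : X ∈ tangentPathSpace c) (hp0 : p ≠ 0) (hp1 : p ≠ 1)
    (hI : ∀ Y ∈ tangentPathSpace c, F.indexForm p c X Y = 0) {t₀ : ℝ}
    (hG : FieldSmoothAt c X t₀) (he : e ∈ atlas (E n) M) (hs : c t₀ ∈ e.source) :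
    F.jacobiOp e c (coordField e c X) t₀ = 0 := by
  refine eq_zero_of_hess hc he (Ioo_subset_Icc_self hG.1) hs hp0 hp1 fun w => ?_
  by_contra hne
  set D : ℝ → ℝ := fun t => F.hess e p c t (F.jacobiOp e c (coordField e c X) t) w with hD
  have hDc : ∀ t, FieldSmoothAt c X t → c t ∈ e.source → ContinuousAt D t := fun t ht hst =>
    (continuousWithinAt_hess hc he (Ioo_subset_Icc_self ht.1) hst p
      (ht.continuousAt_jacobiOp hc he hst) w).continuousAt (Icc_mem_nhds ht.1.1 ht.1.2)
  -- Multiplying by D t₀ treats both signs of D t₀ at once.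
  have hpos : ∀ᶠ t in 𝓝 t₀, 0 < D t₀ * D t :=
    ((hDc t₀ hG hs).const_mul (D t₀) : Tendsto _ _ _).eventually (lt_mem_nhds
      (mul_self_pos.2 hne))
  obtain ⟨δ, ρ, hδ, hρ, -, h0, h1, hρpos, hρ0, hsupp, hP⟩ := exists_bump hG.1
    (hG.eventually.and ((eventually_mem_source hc hG.1 hs).and hpos))
  have hY := bumpField_mem hc he hρ (fun t _ ht => (hP t (hsupp ▸ ht)).2.2.1) h0 h1 w
  have hIY := hI _ hY
  -- X is smooth on the support of the bump, so only the integral contributes.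
  have hjump : ∑ᶠ t ∈ Ioo (0 : ℝ) 1,
      F.jumpTerm p c X (bumpField e c ρ w) (chartAt (E n) (c t)) t = 0 := by
    refine finsum_mem_eq_zero_of_forall_eq_zero fun t _ => ?_
    by_cases htδ : t ∈ Ioo (t₀ - δ) (t₀ + δ)
    · exact (hP t (Ioo_subset_Icc_self htδ)).2.1.jumpTerm_eq_zero p
    · exact jumpTerm_bumpField_eq_zero (hρ0 t htδ)
  unfold indexForm at hIY
  rw [hjump, neg_zero, zero_sub, neg_eq_zero] at hIY
  set f : ℝ → ℝ := fun t => F.jacobiDensity p c X (bumpField e c ρ w) (chartAt (E n) (c t)) t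
    with hf
  have hfs : Function.support f ⊆ Ioo (t₀ - δ) (t₀ + δ) := fun t ht => by
    by_contra h
    exact ht (density_bumpField_eq_zero (hρ0 t h))
  have hfs' : Function.support f ⊆ Ioc 0 1 := fun t ht =>
    Ioo_subset_Ioc_self (hP t (Ioo_subset_Icc_self (hfs ht))).1
  rw [intervalIntegral.integral_eq_integral_of_support_subset hfs',
    ← intervalIntegral.integral_eq_integral_of_support_subset
      (hfs.trans Ioo_subset_Ioc_self)] at hIY
  obtain ⟨S, hS, hSt⟩ := exists_finite_density_eq hcΩ hc hX hY p
  -- Replaces the moving chart at c(t) by the fixed chart e, off a finite set of times.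
  rw [integral_congr_of_finite (g := fun t => ρ t * D t) hS (by linarith) fun t ht hts => by
    have hPt := hP t ht
    rw [hf]
    dsimp only
    rw [hSt t (Ioo_subset_Icc_self hPt.1) hts e he hPt.2.2.1]
    unfold jacobiDensity
    rw [coordField_bumpField he hPt.2.2.1, hess_smul_right]] at hIY
  have hint : IntervalIntegrable (fun t => D t₀ * (ρ t * D t)) MeasureTheory.volume
      (t₀ - δ) (t₀ + δ) := by
    refine ContinuousOn.intervalIntegrable ?_
    rw [uIcc_of_le (by linarith)]
    exact fun t ht => (continuousAt_const.mul (hρ.continuous.continuousAt.mul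
      (hDc t (hP t ht).2.1 (hP t ht).2.2.1))).continuousWithinAt
  have := intervalIntegral.intervalIntegral_pos_of_pos_on hint (fun t ht => by
    have h2 := (hP t (Ioo_subset_Icc_self ht)).2.2.2
    have h3 := hρpos t ht
    calc 0 < ρ t * (D t₀ * D t) := mul_pos h3 h2
      _ = _ := by ring) (by linarith)
  rw [intervalIntegral.integral_const_mul, hIY, mul_zero] at this
  exact lt_irrefl _ this

/-- If the second variation vanishes, then the derivative of `X` does not jump. -/
theorem jump_eq_zero_of_indexForm (hcΩ : c ∈ pathSpace n x₀ x₁) (hc : F.IsGeodesic c)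
    (hX : X ∈ tangentPathSpace c) (hp0 : p ≠ 0) (hp1 : p ≠ 1)
    (hI : ∀ Y ∈ tangentPathSpace c, F.indexForm p c X Y = 0) {t₀ : ℝ}
    (ht₀ : t₀ ∈ Ioo (0 : ℝ) 1) : jump (chartAt (E n) (c t₀)) c X t₀ = 0 := by
  set e := chartAt (E n) (c t₀) with hedef
  have he : e ∈ atlas (E n) M := chart_mem_atlas _ _
  have hs : c t₀ ∈ e.source := mem_chart_source _ _
  refine eq_zero_of_hess hc he (Ioo_subset_Icc_self ht₀) hs hp0 hp1 fun w => ?_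
  obtain ⟨S, hS, hSt⟩ := exists_finite_fieldSmoothAt hX
  -- The support is taken so small that t₀ is the only time in it at which X may fail to be smooth;
  -- a single jump remains.
  have hS' : ∀ᶠ t in 𝓝 t₀, t ∉ S \ {t₀} :=
    (hS.subset sdiff_subset).isClosed.isOpen_compl.mem_nhds fun h => h.2 rfl
  obtain ⟨δ, ρ, hδ, hρ, hρ1, h0, h1, -, hρ0, hsupp, hP⟩ := exists_bump ht₀
    ((eventually_mem_source hc ht₀ hs).and hS')
  have hY := bumpField_mem hc he hρ (fun t _ ht => (hP t (hsupp ▸ ht)).2.1) h0 h1 w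
  have hIY := hI _ hY
  have hint : ∫ t in (0 : ℝ)..1, F.jacobiDensity p c X (bumpField e c ρ w)
      (chartAt (E n) (c t)) t = 0 := by
    rw [integral_congr_of_finite (g := fun _ => 0) hS zero_le_one fun t ht hts => by
      unfold jacobiDensity
      rw [jacobiOp_eq_zero hcΩ hc hX hp0 hp1 hI (hSt t ht hts) (chart_mem_atlas _ _)
        (mem_chart_source _ _), hess_zero_left]]
    simp
  have hjump : ∑ᶠ t ∈ Ioo (0 : ℝ) 1,
      F.jumpTerm p c X (bumpField e c ρ w) (chartAt (E n) (c t)) t =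
      F.jumpTerm p c X (bumpField e c ρ w) e t₀ := by
    rw [finsum_eq_single _ t₀ fun t hne => ?_, finsum_eq_if, if_pos ht₀]
    by_cases ht : t ∈ Ioo (0 : ℝ) 1
    · rw [finsum_eq_if, if_pos ht]
      by_cases htδ : t ∈ Ioo (t₀ - δ) (t₀ + δ)
      · exact (hSt t (Ioo_subset_Icc_self ht) fun hts =>
          (hP t (Ioo_subset_Icc_self htδ)).2.2 ⟨hts, hne⟩).jumpTerm_eq_zero p
      · exact jumpTerm_bumpField_eq_zero (hρ0 t htδ)
    · rw [finsum_eq_if, if_neg ht]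
  unfold indexForm at hIY
  rw [hint, sub_zero, neg_eq_zero, hjump] at hIY
  unfold jumpTerm at hIY
  rwa [coordField_bumpField he hs, hρ1, one_smul] at hIY

end Vanishing

end FinslerPEnergy

namespace FinslerPEnergy

/-! ### Smoothness of null fields and the Jacobi equation -/

section JacobiFields

open FinslerMetric

variable {n : ℕ} {M : Type*} [TopologicalSpace M] [ChartedSpace (E n) M]
  [IsManifold (I n) ∞ M] {F : FinslerMetric n M} {e : OpenPartialHomeomorph M (E n)}
  {c : ℝ → M} {p t : ℝ} {x₀ x₁ : M} {X Y : (t : ℝ) → TangentSpace (I n) (c t)}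

/-- If the Jacobi equation holds where `X` is smooth and the derivative of `X` does not jump,
then `X` is smooth at interior times. -/
theorem fieldSmoothAt_of_jump_eq_zero (hc : F.IsGeodesic c) (hX : X ∈ tangentPathSpace c)
    (hJac : ∀ t, FieldSmoothAt c X t → ∀ e ∈ atlas (E n) M, c t ∈ e.source →
      F.jacobiOp e c (coordField e c X) t = 0) {t₀ : ℝ} (ht₀ : t₀ ∈ Ioo (0 : ℝ) 1)
    (hjump : jump (chartAt (E n) (c t₀)) c X t₀ = 0) : FieldSmoothAt c X t₀ := by
  set e := chartAt (E n) (c t₀) with hedef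
  have he : e ∈ atlas (E n) M := chart_mem_atlas _ _
  have hs : c t₀ ∈ e.source := mem_chart_source _ _
  obtain ⟨d, hd, hXd⟩ := (exists_smoothField_right_left hX).1 t₀ ⟨ht₀.1.le, ht₀.2⟩
  obtain ⟨b, hb, hXb⟩ := (exists_smoothField_right_left hX).2 t₀ ⟨ht₀.1, ht₀.2.le⟩
  set ξ := coordField e c X with hξdef
  have hbt : t₀ ∈ Icc b t₀ := ⟨hb.2.le, le_rfl⟩
  have htd : t₀ ∈ Icc t₀ d := ⟨le_rfl, hd.1.le⟩
  have hξb : ContDiffWithinAt ℝ ∞ ξ (Icc b t₀) t₀ := contDiffWithinAt_coordField he (hXb t₀ hbt) hs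
  have hξd : ContDiffWithinAt ℝ ∞ ξ (Icc t₀ d) t₀ := contDiffWithinAt_coordField he (hXd t₀ htd) hs
  have hunion : Icc b t₀ ∪ Icc t₀ d ∈ 𝓝 t₀ := by
    rw [Icc_union_Icc_eq_Icc hb.2.le hd.1.le]
    exact Icc_mem_nhds hb.2 hd.1
  obtain ⟨δ, hδ, hball⟩ := Metric.eventually_nhds_iff_ball.1
    ((Filter.Eventually.and (Ioo_mem_nhds hb.2 hd.1)
      (Filter.Eventually.and (Ioo_mem_nhds ht₀.1 ht₀.2) (eventually_mem_source hc ht₀ hs))))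
  set J := Metric.ball t₀ δ with hJ
  have hJo : IsOpen J := Metric.isOpen_ball
  have hJ0 : t₀ ∈ J := Metric.mem_ball_self hδ
  have hG : ∀ t ∈ J, t ≠ t₀ → FieldSmoothAt c X t := fun t ht hne => by
    rcases lt_or_gt_of_ne hne with h | h
    · exact hXb.fieldSmoothAt (Icc_subset_Icc hb.1 ht₀.2.le) ⟨(hball t ht).1.1, h⟩
    · exact hXd.fieldSmoothAt (Icc_subset_Icc ht₀.1.le hd.2) ⟨h, (hball t ht).1.2⟩
  have hξt : ∀ t ∈ J, t ≠ t₀ → ContDiffAt ℝ ∞ ξ t := fun t ht hne =>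
    (hG t ht hne).contDiffAt he (hball t ht).2.2
  -- At t₀ the two one-sided derivatives exist and coincide because there is no jump.
  have hξ' : ∀ t ∈ J, HasDerivAt ξ (deriv ξ t) t := fun t ht => by
    rcases eq_or_ne t t₀ with rfl | hne
    · have h1 := hξd.hasDerivWithinAt_derivWithin
      have h2 := hξb.hasDerivWithinAt_derivWithin
      rw [derivWithin_Icc_left _ hd.1] at h1
      rw [derivWithin_Icc_right _ hb.2, ← sub_eq_zero.1 hjump] at h2
      exact ((h2.union h1).hasDerivAt hunion).differentiableAt.hasDerivAt
    · exact ((hξt t ht hne).differentiableAt (by simp)).hasDerivAt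
  -- On each side ξ is smooth up to t₀, so its derivative is continuous from that side.
  have hside : ∀ {r s : ℝ}, r < s → t₀ ∈ Icc r s → ContDiffWithinAt ℝ ∞ ξ (Icc r s) t₀ →
      ContinuousWithinAt (deriv ξ) (Icc r s) t₀ := fun {r s} hrs hmem h => by
    have hEq : ∀ t ∈ J, t ∈ Icc r s → deriv ξ t = derivWithin ξ (Icc r s) t := fun t ht hts =>
      ((hξ' t ht).hasDerivWithinAt.derivWithin (uniqueDiffOn_Icc hrs t hts)).symm
    refine (contDiffWithinAt_derivWithin h (uniqueDiffOn_Icc hrs)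
      hmem).continuousWithinAt.congr_of_eventuallyEq ?_ (hEq t₀ hJ0 hmem)
    filter_upwards [self_mem_nhdsWithin, nhdsWithin_le_nhds (hJo.mem_nhds hJ0)] with t h1 h2
    exact hEq t h2 h1
  have hvc : ContinuousAt (deriv ξ) t₀ :=
    ((hside hb.2 hbt hξb).union (hside hd.1 htd hξd)).continuousAt hunion
  set A : ℝ → E n × E n →L[ℝ] E n := fun t =>
    fderivWithin ℝ (F.sprayVec e) (slit e) (phase e c t) with hA
  have hAs : ∀ t ∈ J, ContDiffAt ℝ ∞ A t := fun t ht =>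
    (contDiffWithinAt_fderiv_sprayVec hc he (Ioo_subset_Icc_self (hball t ht).2.1)
      (hball t ht).2.2).contDiffAt (Icc_mem_nhds (hball t ht).2.1.1 (hball t ht).2.1.2)
  have hv : ∀ t ∈ J, t ≠ t₀ → HasDerivAt (deriv ξ) (-A t (ξ t, deriv ξ t)) t :=
    fun t ht hne => by
      have ht01 := (hball t ht).2.1
      have hnhd := Icc_mem_nhds ht01.1 ht01.2
      have hw := hξt t ht hne
      have h1 := (contDiffWithinAt_derivWithin hw.contDiffWithinAt uniqueDiffOn_unitInterval
        (Ioo_subset_Icc_self ht01)).hasDerivWithinAt_derivWithin.hasDerivAt hnhd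
      have h2 := hJac t (hG t ht hne) e he (hball t ht).2.2
      rw [jacobiOp_eq hc he (Ioo_subset_Icc_self ht01) (hball t ht).2.2 hw.contDiffWithinAt,
        add_eq_zero_iff_eq_neg, derivWithin_of_mem_nhds (f := ξ) hnhd] at h2
      rw [h2] at h1
      refine h1.congr_of_eventuallyEq ?_
      filter_upwards [Ioo_mem_nhds ht01.1 ht01.2] with s hs'
      exact (derivWithin_of_mem_nhds (Icc_mem_nhds hs'.1 hs'.2)).symm
  -- The equation gives ξ'' near t₀ as an expression continuous at t₀, so ξ' is differentiable at t₀
  -- with the limiting value.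
  have hv₀ : HasDerivAt (deriv ξ) (-A t₀ (ξ t₀, deriv ξ t₀)) t₀ := by
    refine hasDerivAt_of_eventually_hasDerivAt (g := fun t => -A t (ξ t, deriv ξ t)) ?_ hvc
      (((hAs t₀ hJ0).continuousAt.clm_apply ((hξ' t₀ hJ0).continuousAt.prodMk hvc)).neg)
    filter_upwards [self_mem_nhdsWithin, nhdsWithin_le_nhds (hJo.mem_nhds hJ0)] with t h1 h2
    exact hv t h2 h1
  -- The first-order system (ξ, ξ')' = (ξ', -A(ξ, ξ')).
  set H : ℝ → (E n × E n) →L[ℝ] (E n × E n) := fun t =>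
    (ContinuousLinearMap.inl ℝ (E n) (E n)).comp (ContinuousLinearMap.snd ℝ (E n) (E n)) -
      (ContinuousLinearMap.inr ℝ (E n) (E n)).comp (A t) with hH
  have hHs : ContDiffOn ℝ ∞ H J := contDiffOn_const.sub
    (contDiffOn_const.clm_comp fun t ht => (hAs t ht).contDiffWithinAt)
  have hu := contDiffOn_of_linear_ode (u := fun t => (ξ t, deriv ξ t)) hJo hHs fun t ht => by
    have h2 : HasDerivAt (deriv ξ) (-A t (ξ t, deriv ξ t)) t := by
      rcases eq_or_ne t t₀ with rfl | hne
      · exact hv₀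
      · exact hv t ht hne
    refine ((hξ' t ht).prodMk h2).congr_deriv ?_
    change _ = ((deriv ξ t, (0 : E n)) - ((0 : E n), A t (ξ t, deriv ξ t)))
    rw [Prod.mk_sub_mk, sub_zero, zero_sub]
  have hξs : ContDiffOn ℝ ∞ ξ J := contDiff_fst.comp_contDiffOn hu
  refine ⟨ht₀, ?_⟩
  filter_upwards [hJo.mem_nhds hJ0] with t ht
  have ht01 := (hball t ht).2.1
  refine contMDiffWithinAt_of_coordField he (S := univ) ?_
    (hξs.contDiffAt (hJo.mem_nhds ht)).contDiffWithinAt (mem_univ t) ?_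
  · exact ((hc.contDiffWithinAt_pos he (Ioo_subset_Icc_self ht01) (hball t ht).2.2).contDiffAt
      (Icc_mem_nhds ht01.1 ht01.2)).contDiffWithinAt
  · rw [nhdsWithin_univ]
    exact eventually_mem_source hc ht01 (hball t ht).2.2

/-- A field for which the second variation vanishes is a Jacobi field. -/
theorem isJacobi_of_indexForm_eq_zero (hcΩ : c ∈ pathSpace n x₀ x₁) (hc : F.IsGeodesic c)
    (hX : X ∈ tangentPathSpace c) (hp0 : p ≠ 0) (hp1 : p ≠ 1)
    (hI : ∀ Y ∈ tangentPathSpace c, F.indexForm p c X Y = 0) : F.IsJacobi c X := by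
  have hJac : ∀ t, FieldSmoothAt c X t → ∀ e ∈ atlas (E n) M, c t ∈ e.source →
      F.jacobiOp e c (coordField e c X) t = 0 := fun t ht e he hs =>
    jacobiOp_eq_zero hcΩ hc hX hp0 hp1 hI ht he hs
  have hG : ∀ t ∈ Ioo (0 : ℝ) 1, FieldSmoothAt c X t := fun t ht =>
    fieldSmoothAt_of_jump_eq_zero hc hX hJac ht
      (jump_eq_zero_of_indexForm hcΩ hc hX hp0 hp1 hI ht)
  have hsm : ContMDiffOn 𝓘(ℝ, ℝ) (I n).tangent ∞
      (fun t => (⟨c t, X t⟩ : TangentBundle (I n) M)) (Icc 0 1) := by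
    intro t ht
    -- At the two endpoints smoothness holds already, since X is smooth on the closed first and last
    -- pieces.
    rcases ht.1.eq_or_lt with rfl | h0
    · obtain ⟨d, hd, h⟩ := (exists_smoothField_right_left hX).1 0 ⟨le_rfl, one_pos⟩
      refine ContMDiffWithinAt.mono_of_mem_nhdsWithin (h 0 ⟨le_rfl, hd.1.le⟩) ?_
      filter_upwards [self_mem_nhdsWithin, nhdsWithin_le_nhds (Iio_mem_nhds hd.1)] with s h1 h2
      exact ⟨h1.1, le_of_lt h2⟩
    rcases ht.2.eq_or_lt with rfl | h1
    · obtain ⟨b, hb, h⟩ := (exists_smoothField_right_left hX).2 1 ⟨one_pos, le_rfl⟩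
      refine ContMDiffWithinAt.mono_of_mem_nhdsWithin (h 1 ⟨hb.2.le, le_rfl⟩) ?_
      filter_upwards [self_mem_nhdsWithin, nhdsWithin_le_nhds (Ioi_mem_nhds hb.2)] with s h1 h2
      exact ⟨le_of_lt h2, h1.2⟩
    · exact (hG t ⟨h0, h1⟩).2.self_of_nhds.contMDiffWithinAt
  refine ⟨hsm, fun e he t ht hs => ?_⟩
  change F.jacobiOp e c (coordField e c X) t = 0
  have hev := hc.eventually_mem ht hs
  have hcont : ContinuousWithinAt (F.jacobiOp e c (coordField e c X)) (Icc 0 1) t := by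
    refine continuousWithinAt_jacobiOp hc he ht hs ?_
    filter_upwards [hev] with s hs'
    exact contDiffWithinAt_coordField he (hsm s hs'.1) hs'.2
  -- The operator is continuous on [0, 1] and zero on the dense subset (0, 1).
  have hne : (𝓝[Ioo 0 1] t).NeBot := by
    rw [← mem_closure_iff_nhdsWithin_neBot, closure_Ioo zero_ne_one]
    exact ht
  refine tendsto_nhds_unique (hcont.mono Ioo_subset_Icc_self) (tendsto_const_nhds.congr' ?_)
  filter_upwards [self_mem_nhdsWithin, nhdsWithin_mono t Ioo_subset_Icc_self hev] with s h1 h2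
  exact (hJac s (hG s h1) e he h2.2).symm

/-- The second variation vanishes on Jacobi fields. -/
theorem indexForm_eq_zero_of_isJacobi (h : F.IsJacobi c X) (p : ℝ) :
    F.indexForm p c X Y = 0 := by
  have hjump : ∑ᶠ t ∈ Ioo (0 : ℝ) 1, F.jumpTerm p c X Y (chartAt (E n) (c t)) t = 0 :=
    finsum_mem_eq_zero_of_forall_eq_zero fun t ht =>
      (SmoothField.fieldSmoothAt h.smooth subset_rfl ht).jumpTerm_eq_zero p
  have hint : ∫ t in (0 : ℝ)..1, F.jacobiDensity p c X Y (chartAt (E n) (c t)) t = 0 := by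
    rw [integral_congr_of_finite (g := fun _ => 0) finite_empty zero_le_one fun t ht _ => by
      unfold jacobiDensity
      rw [show F.jacobiOp (chartAt (E n) (c t)) c (coordField (chartAt (E n) (c t)) c X) t = 0 from
        h.eq_zero _ (chart_mem_atlas _ _) t ht (mem_chart_source _ _), hess_zero_left]]
    simp
  unfold indexForm
  rw [hjump, hint, neg_zero, sub_zero]

theorem isSecondVariation_indexForm (hcΩ : c ∈ pathSpace n x₀ x₁) (hc : F.IsGeodesic c)
    (hX : X ∈ tangentPathSpace c) (hY : Y ∈ tangentPathSpace c) (p : ℝ) :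
    F.IsSecondVariation p x₀ x₁ c X Y (F.indexForm p c X Y) :=
  ⟨exists_isVariation hcΩ hc hX hY, fun _ _ hv => hasMixedDerivAtZero_energy hc p hY.1 hY.2.1 hv⟩

theorem FinslerMetric.IsSecondVariation.unique {r r' : ℝ}
    (h : F.IsSecondVariation p x₀ x₁ c X Y r) (h' : F.IsSecondVariation p x₀ x₁ c X Y r') :
    r = r' := by
  obtain ⟨⟨ε, α, hα⟩, h⟩ := h
  exact (h ε α hα).unique (h'.2 ε α hα)

/-- The index form is a value with the required property, which justifies the choice in the
definition of `secondVariation`. -/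
theorem isSecondVariation_secondVariation (hcΩ : c ∈ pathSpace n x₀ x₁) (hc : F.IsGeodesic c)
    (hX : X ∈ tangentPathSpace c) (hY : Y ∈ tangentPathSpace c) (p : ℝ) :
    F.IsSecondVariation p x₀ x₁ c X Y (F.secondVariation p x₀ x₁ c X Y) :=
  Classical.epsilon_spec ⟨_, isSecondVariation_indexForm hcΩ hc hX hY p⟩

theorem secondVariation_eq_indexForm (hcΩ : c ∈ pathSpace n x₀ x₁) (hc : F.IsGeodesic c)
    (hX : X ∈ tangentPathSpace c) (hY : Y ∈ tangentPathSpace c) (p : ℝ) :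
    F.secondVariation p x₀ x₁ c X Y = F.indexForm p c X Y :=
  (isSecondVariation_secondVariation hcΩ hc hX hY p).unique
    (isSecondVariation_indexForm hcΩ hc hX hY p)

end JacobiFields

end FinslerPEnergy

end

open FinslerPEnergy in
theorem mainTheorem8 {n : ℕ} {M : Type*} [TopologicalSpace M] [T2Space M]
    [SecondCountableTopology M] [ConnectedSpace M] [ChartedSpace (E n) M] [IsManifold (I n) ∞ M]
    (F : FinslerMetric n M) (p : ℝ) (hp0 : p ≠ 0) (hp1 : p ≠ 1) (x₀ x₁ : M)
    (c : ℝ → M) (hc : c ∈ pathSpace n x₀ x₁) (hgeo : F.IsGeodesic c)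
    (X : (t : ℝ) → TangentSpace (I n) (c t)) (hX : X ∈ tangentPathSpace c) :
    (∀ Y ∈ tangentPathSpace c,
      F.IsSecondVariation p x₀ x₁ c X Y (F.secondVariation p x₀ x₁ c X Y)) ∧
    ((∀ Y ∈ tangentPathSpace c, F.secondVariation p x₀ x₁ c X Y = 0) ↔ F.IsJacobi c X) := by
  refine ⟨fun Y hY => isSecondVariation_secondVariation hc hgeo hX hY p, fun h => ?_,
    fun h Y hY => ?_⟩
  · exact isJacobi_of_indexForm_eq_zero hc hgeo hX hp0 hp1 fun Y hY => by
      rw [← secondVariation_eq_indexForm hc hgeo hX hY, h Y hY]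
  · rw [secondVariation_eq_indexForm hc hgeo hX hY, indexForm_eq_zero_of_isJacobi h]
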